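/- **Theorem 2.** Let $[m]=\{1,\dots,m\}$. For positive integers $n$ and $\omega$ let $c(n)$ be the number of $\omega$-colorable connected chordal graphs with vertex set $[n]$ (chordal: no induced cycle of length at least $4$). There is one algorithm that, given positive integers $n$ and $\omega$, computes $c(n)$ using $O(n^7)$ arithmetic operations, with an implied constant independent of $n$ and $\omega$. In fact, on a unit-cost random access machine on nonnegative integers with addition, (truncated) subtraction and multiplication, the total number of elementary steps, including memory accesses, tests and assignments, is $O(n^7)$. Moreover, $c(n)$ is determined by the following system of recurrences. For a chordal graph $G$ and a clique $X\subseteq V(G)$, the evaporation sequence $L_1,L_2,\dots,L_t$ of $G$ with exception set $X$ arises by repeatedly removing all vertices outside $X$ that are simplicial in the current graph (that is, whose neighborhood there is a clique), until only $X$ is left; $L_i$ is the set removed in step $i$. Then $G$ evaporates at time $t$, $L_G(X)=L_t$ (with $L_G(X)=\emptyset$ if $t=0$), and a nonempty set $S\subseteq V(G)\setminus X$ evaporates at time $\max\{i: L_i\cap S\neq\emptyset\}$. A set $C$ sees all of $T$ if $T\subseteq N(C)$. All graphs counted below are $\omega$-colorable, connected and chordal, $X=[x]$ is a clique and the exception set,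 and all arguments are nonnegative integers. * $g(t,x,k,z)$ ($x\ge1$, $z<x$): graphs on $[x+k]$ that evaporate in time at most $t$, such that each component of $G\setminus X$ has a neighbor in $X\setminus[z]$. * $\tilde g(t,x,k,z)$ ($t\ge1$, $x\ge 1$, $z<x$): in addition each component of $G\setminus X$ evaporates at time exactly $t$. $\tilde g_p(t,x,k,z)$: in addition to that, no component of $G\setminus X$ sees all of $X$. * $\tilde g_1(t,x,k)$ (resp. $\tilde g_{\ge2}(t,x,k)$, $x\ge1$): graphs on $[x+k]$ such that each component of $G\setminus X$ evaporates at time exactly $t$ and sees all of $X$, and there is exactly one component (resp. there are at least two). * $f(t,x,l,k)$ ($t,l\ge1$): graphs on $[x+l+k]$ that evaporate at time exactly $t$, such that $G\setminus X$ is connected, $L_G(X)=[x+l]\setminus[x]$, and $[x+l]$ is a clique. * $\tilde f(t,x,l,k)$ ($t,l\geq 1$): in addition $G\setminus[x+l]$ is nonempty and each of its components evaporates at time exactly $t-1$. $\tilde f_p(t,x,l,k)$: in addition to that, no component of $G\setminus[x+l]$ sees all of $[x+l]$. $\tilde f_p(t,x,l,k,z)$ ($z\le x$): as $\tilde f_p(t,x,l,k)$,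 with "$G\setminus X$ is connected" replaced by "$G\setminus[z]$ is connected". (a) These functions satisfy the recurrences, for $t\ge1$ in the first five and $t\ge2$ in the others, and $k\ge1$ (for $g$: $k\ge 0$), on the domains above: $$g(t,x,k,z)=\sum_{k'=0}^k\binom k{k'}\tilde g(t,x,k',z)\,g(t-1,x,k-k',z),$$ $$\tilde g(t,x,k,z)=\sum_{k'=1}^k\sum_{x'=1}^x\Big(\tbinom x{x'}-\tbinom z{x'}\Big)\tbinom{k-1}{k'-1}\tilde g_1(t,x',k')\,\tilde g(t,x,k-k',z),$$ $$\tilde g_p(t,x,k,z)=\sum_{k'=1}^k\sum_{x'=1}^{x-1}\Big(\tbinom x{x'}-\tbinom z{x'}\Big)\tbinom{k-1}{k'-1}\tilde g_1(t,x',k')\,\tilde g_p(t,x,k-k',z),$$ $$\tilde g_1(t,x,k)=\sum_{l=1}^k\binom kl f(t,x,l,k-l),$$ $$\tilde g_{\ge2}(t,x,k)=\sum_{k'=1}^{k-1}\binom{k-1}{k'-1}\tilde g_1(t,x,k')\big(\tilde g_1(t,x,k-k')+\tilde g_{\ge2}(t,x,k-k')\big),$$ $$f(t,x,l,k)=\sum_{k'=1}^k\binom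 k{k'}\tilde f(t,x,l,k')\,g(t-2,x+l,k-k',x)\quad(x+l\le\omega),$$ $$\tilde f(t,x,l,k)=\tilde f_p(t,x,l,k)+\sum_{k'=1}^k\tbinom k{k'}\tilde g_1(t-1,x+l,k')\tilde f_p(t,x,l,k-k')+\sum_{k'=1}^k\tbinom k{k'}\tilde g_{\ge2}(t-1,x+l,k')\,\tilde g_p(t-1,x+l,k-k',x),$$ $$\tilde f_p(t,x,l,k)=\tilde f_p(t,x,l,k,x)\quad(k\ge0),$$ $$\tilde f_p(t,x,l,k,z)=\sum_{k'=1}^k\ \sum_{\substack{0\le x'\le x,\ 0\le l'\le l\\ 0<x'+l'<x+l}}\tbinom{k-1}{k'-1}\tbinom l{l'}\tilde g_1(t-1,x'+l',k')\,A\,B,$$ where $A=\binom x{x'}$ if $l'>0$ and $A=\binom x{x'}-\binom z{x'}$ if $l'=0$, and $B=\tilde f_p(t,x+l',l-l',k-k',z)$ if $l'<l$ and $B=\tilde g_p(t-1,x+l,k-k',z)$ if $l'=l$. The base cases are: $g(0,x,0,z)=1$ and $g(0,x,k,z)=0$ for $k>0$, when $x\le\omega$; $\tilde g(t,x,0,z)=\tilde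 g_p(t,x,0,z)=1$, when $x\le\omega$; $\tilde g_1(t,x,k)=\tilde g_{\ge2}(t,x,k)=0$ if $t=0$ or $k=0$; $f(t,x,l,k)=0$ if $x+l>\omega$, and, if $x+l\le\omega$, $f(1,x,l,0)=1$, $f(1,x,l,k)=0$ for $k>0$, and $f(t,x,l,0)=0$ for $t\ge2$; $\tilde f(t,x,l,k)=\tilde f_p(t,x,l,k,z)=0$ if $t=1$ or $k=0$. (b) $c(n)=\sum_{t=1}^n\tilde g_1(t,0,n)$ for all $n\ge1$. (c) The recurrences and base cases determine $c(n)$: for every family of tables of nonnegative integers that satisfies them, $\sum_{t=1}^n\tilde g_1(t,0,n)=c(n)$ for all $n\ge1$. -/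

import Mathlib

namespace ChordalCount

/-! ### Chordal graphs -/

section Graphs

variable {V : Type*}

/-- A graph is chordal if it has no induced cycle of length at least `4`. -/
def IsChordal (G : SimpleGraph V) : Prop :=
  ∀ m : ℕ, 4 ≤ m → IsEmpty (SimpleGraph.cycleGraph m ↪g G)

/-- The graphs that are counted: `ω`-colorable, connected and chordal. -/
structure Admissible (ω : ℕ) (G : SimpleGraph V) : Prop where
  colorable : G.Colorable ω
  connected : G.Connected
  chordal : IsChordal G

/-- The open neighborhood `N(S)` of a vertex set `S`. -/
def nbhd (G : SimpleGraph V) (S : Set V) : Set V :=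
  {v | v ∉ S ∧ ∃ u ∈ S, G.Adj u v}

/-- `S` sees all of `T`, that is, `T ⊆ N(S)`. -/
def SeesAll (G : SimpleGraph V) (S T : Set V) : Prop :=
  T ⊆ nbhd G S

/-- The graph `G \ S`, obtained by deleting the vertices in `S`, is connected. -/
def ConnectedOff (G : SimpleGraph V) (S : Set V) : Prop :=
  (G.induce Sᶜ).Connected

/-- The vertex sets of the connected components of `G \ S`. -/
def compsOff (G : SimpleGraph V) (S : Set V) : Set (Set V) :=
  {C | ∃ c : (G.induce Sᶜ).ConnectedComponent, C = Subtype.val '' c.supp}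

/-! ### The evaporation sequence -/

/-- The vertices of `R` that are simplicial in the induced subgraph `G[R]`. -/
def simplicialIn (G : SimpleGraph V) (R : Set V) : Set V :=
  {v | v ∈ R ∧ G.IsClique (G.neighborSet v ∩ R)}

/-- The vertices that are left after `i` steps of the evaporation with exception set `X`: in each
step all vertices outside `X` that are simplicial in what is left of the graph are removed. -/
def alive (G : SimpleGraph V) (X : Set V) : ℕ → Set V
  | 0 => Set.univ
  | i + 1 => alive G X i \ (simplicialIn G (alive G X i) \ X)

/-- The set `L_i` (`i ≥ 1`) of the evaporation sequence with exception set `X`. It is empty for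
`i = 0`, and for every `i` that is larger than the length of the sequence. -/
def layer (G : SimpleGraph V) (X : Set V) (i : ℕ) : Set V :=
  alive G X (i - 1) \ alive G X i

/-- `G` evaporates at time (exactly) `t` with exception set `X`. -/
def EvaporatesAt (G : SimpleGraph V) (X : Set V) (t : ℕ) : Prop :=
  alive G X t = X ∧ ∀ s < t, alive G X s ≠ X

/-- `G` evaporates in time at most `t` with exception set `X`. -/
def EvaporatesWithin (G : SimpleGraph V) (X : Set V) (t : ℕ) : Prop :=
  ∃ s ≤ t, EvaporatesAt G X s

/-- The vertex set `S` evaporates at time (exactly) `t` in `G` with exception set `X`: the largest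
index `i` such that `L_i` meets `S` is `t`. -/
def SetEvaporatesAt (G : SimpleGraph V) (X S : Set V) (t : ℕ) : Prop :=
  (layer G X t ∩ S).Nonempty ∧ ∀ i, t < i → layer G X i ∩ S = ∅

end Graphs

/-! ### The numbers to be computed and the counter functions

The vertex set `[m] = {1, …, m}` is represented by `Fin m`; the label `i` is the element with value
`i - 1`. -/

/-- The interval of labels `[a + 1, b]` in `[m]`. In particular `block m 0 x` is `[x]`. -/
def block (m a b : ℕ) : Set (Fin m) :=
  {v | a ≤ v.val ∧ v.val < b}

/-- `c(n)`: the number of `ω`-colorable connected chordal graphs with vertex set `[n]`. -/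
noncomputable def connChordalCount (ω n : ℕ) : ℕ :=
  {G : SimpleGraph (Fin n) | Admissible ω G}.ncard

/-- The graphs counted by `g(t, x, k, z)`; here `X = [x]`. -/
def gSet (ω t x k z : ℕ) : Set (SimpleGraph (Fin (x + k))) :=
  {G | Admissible ω G ∧ G.IsClique (block (x + k) 0 x) ∧
    EvaporatesWithin G (block (x + k) 0 x) t ∧
    ∀ C ∈ compsOff G (block (x + k) 0 x),
      (nbhd G C ∩ (block (x + k) 0 x \ block (x + k) 0 z)).Nonempty}

/-- The graphs counted by `g̃(t, x, k, z)`. -/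
def gTildeSet (ω t x k z : ℕ) : Set (SimpleGraph (Fin (x + k))) :=
  {G | G ∈ gSet ω t x k z ∧
    ∀ C ∈ compsOff G (block (x + k) 0 x), SetEvaporatesAt G (block (x + k) 0 x) C t}

/-- The graphs counted by `g̃_p(t, x, k, z)`. -/
def gTildePSet (ω t x k z : ℕ) : Set (SimpleGraph (Fin (x + k))) :=
  {G | G ∈ gTildeSet ω t x k z ∧
    ∀ C ∈ compsOff G (block (x + k) 0 x), ¬ SeesAll G C (block (x + k) 0 x)}

/-- The common part of the definitions of `g̃_1(t, x, k)` and `g̃_{≥2}(t, x, k)`. -/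
def gTildeAllSet (ω t x k : ℕ) : Set (SimpleGraph (Fin (x + k))) :=
  {G | Admissible ω G ∧ G.IsClique (block (x + k) 0 x) ∧
    EvaporatesWithin G (block (x + k) 0 x) t ∧
    ∀ C ∈ compsOff G (block (x + k) 0 x),
      SetEvaporatesAt G (block (x + k) 0 x) C t ∧ SeesAll G C (block (x + k) 0 x)}

/-- The graphs counted by `g̃_1(t, x, k)`. -/
def gTildeOneSet (ω t x k : ℕ) : Set (SimpleGraph (Fin (x + k))) :=
  {G | G ∈ gTildeAllSet ω t x k ∧ (compsOff G (block (x + k) 0 x)).ncard = 1}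

/-- The graphs counted by `g̃_{≥2}(t, x, k)`. -/
def gTildeTwoSet (ω t x k : ℕ) : Set (SimpleGraph (Fin (x + k))) :=
  {G | G ∈ gTildeAllSet ω t x k ∧ 2 ≤ (compsOff G (block (x + k) 0 x)).ncard}

/-- The part of the definition of `f(t, x, l, k)` that does not concern the connectedness of
`G \ X`: `G` evaporates at time exactly `t` with exception set `X = [x]`, the last set of the
evaporation sequence is `L = [x + 1, x + l]`, and `X ∪ L = [x + l]` is a clique. -/
def fCoreSet (ω t x l k : ℕ) : Set (SimpleGraph (Fin (x + l + k))) :=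
  {G | Admissible ω G ∧ EvaporatesAt G (block (x + l + k) 0 x) t ∧
    layer G (block (x + l + k) 0 x) t = block (x + l + k) x (x + l) ∧
    G.IsClique (block (x + l + k) 0 (x + l))}

/-- The graphs counted by `f(t, x, l, k)`. -/
def fSet (ω t x l k : ℕ) : Set (SimpleGraph (Fin (x + l + k))) :=
  {G | G ∈ fCoreSet ω t x l k ∧ ConnectedOff G (block (x + l + k) 0 x)}

/-- The condition that distinguishes `f̃` from `f`: `G \ (X ∪ L)` has at least one component, and
all its components evaporate at time exactly `t - 1`. -/
def LateComps (t x l k : ℕ) (G : SimpleGraph (Fin (x + l + k))) : Prop :=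
  (compsOff G (block (x + l + k) 0 (x + l))).Nonempty ∧
    ∀ C ∈ compsOff G (block (x + l + k) 0 (x + l)),
      SetEvaporatesAt G (block (x + l + k) 0 x) C (t - 1)

/-- The condition that distinguishes `f̃_p` from `f̃`: no component of `G \ (X ∪ L)` sees all of
`X ∪ L`. -/
def ProperComps (x l k : ℕ) (G : SimpleGraph (Fin (x + l + k))) : Prop :=
  ∀ C ∈ compsOff G (block (x + l + k) 0 (x + l)),
    ¬ SeesAll G C (block (x + l + k) 0 (x + l))

/-- The graphs counted by `f̃(t, x, l, k)`. -/
def fTildeSet (ω t x l k : ℕ) : Set (SimpleGraph (Fin (x + l + k))) :=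
  {G | G ∈ fSet ω t x l k ∧ LateComps t x l k G}

/-- The graphs counted by `f̃_p(t, x, l, k)`. -/
def fTildePSet (ω t x l k : ℕ) : Set (SimpleGraph (Fin (x + l + k))) :=
  {G | G ∈ fTildeSet ω t x l k ∧ ProperComps x l k G}

/-- The graphs counted by `f̃_p(t, x, l, k, z)`: the graph `G \ [z]`, instead of `G \ X`, has to be
connected. -/
def fTildePZSet (ω t x l k z : ℕ) : Set (SimpleGraph (Fin (x + l + k))) :=
  {G | G ∈ fCoreSet ω t x l k ∧ ConnectedOff G (block (x + l + k) 0 z) ∧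
    LateComps t x l k G ∧ ProperComps x l k G}

/-- A family of dynamic-programming tables, one for each of the functions `g`, `g̃`, `g̃_p`, `g̃_1`,
`g̃_{≥2}`, `f`, `f̃`, `f̃_p` (four arguments) and `f̃_p` (five arguments). -/
structure Tables where
  g : ℕ → ℕ → ℕ → ℕ → ℕ
  gTilde : ℕ → ℕ → ℕ → ℕ → ℕ
  gTildeP : ℕ → ℕ → ℕ → ℕ → ℕ
  gTildeOne : ℕ → ℕ → ℕ → ℕ
  gTildeTwo : ℕ → ℕ → ℕ → ℕ
  f : ℕ → ℕ → ℕ → ℕ → ℕ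
  fTilde : ℕ → ℕ → ℕ → ℕ → ℕ
  fTildeP : ℕ → ℕ → ℕ → ℕ → ℕ
  fTildePZ : ℕ → ℕ → ℕ → ℕ → ℕ → ℕ

/-- The counter functions. -/
noncomputable def counters (ω : ℕ) : Tables where
  g t x k z := (gSet ω t x k z).ncard
  gTilde t x k z := (gTildeSet ω t x k z).ncard
  gTildeP t x k z := (gTildePSet ω t x k z).ncard
  gTildeOne t x k := (gTildeOneSet ω t x k).ncard
  gTildeTwo t x k := (gTildeTwoSet ω t x k).ncard
  f t x l k := (fSet ω t x l k).ncard
  fTilde t x l k := (fTildeSet ω t x l k).ncard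
  fTildeP t x l k := (fTildePSet ω t x l k).ncard
  fTildePZ t x l k z := (fTildePZSet ω t x l k z).ncard

/-- The recurrences and the base cases, on the domains of the respective functions. All natural
number subtractions below are exact. -/
structure SatisfiesRecurrences (ω : ℕ) (T : Tables) : Prop where
  g_base : ∀ x k z, 1 ≤ x → x ≤ ω → z < x → T.g 0 x k z = if k = 0 then 1 else 0
  g_rec : ∀ t x k z, 1 ≤ t → 1 ≤ x → z < x →
    T.g t x k z = ∑ k' ∈ Finset.Icc 0 k,
      k.choose k' * T.gTilde t x k' z * T.g (t - 1) x (k - k') z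
  gTilde_base : ∀ t x z, 1 ≤ t → 1 ≤ x → x ≤ ω → z < x → T.gTilde t x 0 z = 1
  gTilde_rec : ∀ t x k z, 1 ≤ t → 1 ≤ x → 1 ≤ k → z < x →
    T.gTilde t x k z = ∑ k' ∈ Finset.Icc 1 k, ∑ x' ∈ Finset.Icc 1 x,
      (x.choose x' - z.choose x') * (k - 1).choose (k' - 1) *
        T.gTildeOne t x' k' * T.gTilde t x (k - k') z
  gTildeP_base : ∀ t x z, 1 ≤ t → 1 ≤ x → x ≤ ω → z < x → T.gTildeP t x 0 z = 1
  gTildeP_rec : ∀ t x k z, 1 ≤ t → 1 ≤ x → 1 ≤ k → z < x →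
    T.gTildeP t x k z = ∑ k' ∈ Finset.Icc 1 k, ∑ x' ∈ Finset.Icc 1 (x - 1),
      (x.choose x' - z.choose x') * (k - 1).choose (k' - 1) *
        T.gTildeOne t x' k' * T.gTildeP t x (k - k') z
  gTildeOne_base : ∀ t x k, t = 0 ∨ k = 0 → T.gTildeOne t x k = 0
  gTildeOne_rec : ∀ t x k, 1 ≤ t → 1 ≤ k →
    T.gTildeOne t x k = ∑ l ∈ Finset.Icc 1 k, k.choose l * T.f t x l (k - l)
  gTildeTwo_base : ∀ t x k, 1 ≤ x → t = 0 ∨ k = 0 → T.gTildeTwo t x k = 0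
  gTildeTwo_rec : ∀ t x k, 1 ≤ t → 1 ≤ x → 1 ≤ k →
    T.gTildeTwo t x k = ∑ k' ∈ Finset.Icc 1 (k - 1),
      (k - 1).choose (k' - 1) * T.gTildeOne t x k' *
        (T.gTildeOne t x (k - k') + T.gTildeTwo t x (k - k'))
  f_base_large : ∀ t x l k, 1 ≤ t → 1 ≤ l → ω < x + l → T.f t x l k = 0
  f_base_one : ∀ x l k, 1 ≤ l → x + l ≤ ω → T.f 1 x l k = if k = 0 then 1 else 0
  f_base_zero : ∀ t x l, 2 ≤ t → 1 ≤ l → x + l ≤ ω → T.f t x l 0 = 0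
  f_rec : ∀ t x l k, 2 ≤ t → 1 ≤ l → 1 ≤ k → x + l ≤ ω →
    T.f t x l k = ∑ k' ∈ Finset.Icc 1 k,
      k.choose k' * T.fTilde t x l k' * T.g (t - 2) (x + l) (k - k') x
  fTilde_base : ∀ t x l k, 1 ≤ t → 1 ≤ l → t = 1 ∨ k = 0 → T.fTilde t x l k = 0
  fTilde_rec : ∀ t x l k, 2 ≤ t → 1 ≤ l → 1 ≤ k →
    T.fTilde t x l k = T.fTildeP t x l k +
      ∑ k' ∈ Finset.Icc 1 k,
        k.choose k' * T.gTildeOne (t - 1) (x + l) k' * T.fTildeP t x l (k - k') +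
      ∑ k' ∈ Finset.Icc 1 k,
        k.choose k' * T.gTildeTwo (t - 1) (x + l) k' * T.gTildeP (t - 1) (x + l) (k - k') x
  fTildeP_eq : ∀ t x l k, 2 ≤ t → 1 ≤ l → T.fTildeP t x l k = T.fTildePZ t x l k x
  fTildePZ_base : ∀ t x l k z, 1 ≤ t → 1 ≤ l → z ≤ x → t = 1 ∨ k = 0 →
    T.fTildePZ t x l k z = 0
  fTildePZ_rec : ∀ t x l k z, 2 ≤ t → 1 ≤ l → 1 ≤ k → z ≤ x →
    T.fTildePZ t x l k z =
      ∑ k' ∈ Finset.Icc 1 k, ∑ x' ∈ Finset.Icc 0 x, ∑ l' ∈ Finset.Icc 0 l,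
        if 0 < x' + l' ∧ x' + l' < x + l then
          (k - 1).choose (k' - 1) * l.choose l' * T.gTildeOne (t - 1) (x' + l') k' *
            (if 0 < l' then x.choose x' else x.choose x' - z.choose x') *
            (if l' < l then T.fTildePZ t (x + l') (l - l') (k - k') z
              else T.gTildeP (t - 1) (x + l) (k - k') z)
        else 0

/-! ### The model of computation

Programs for a random access machine with unit cost, in structured form. The machine has variables
and a memory, both indexed by natural numbers and holding natural numbers. The elementary steps are
the evaluation of a constant, the access to a variable or to a memory cell, the arithmetic
operations (addition, truncated subtraction and multiplication; comparisons are tests whether a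
difference is zero), assignments and branches. Each of them costs one unit. -/

/-- A state of the machine. -/
structure State where
  var : ℕ → ℕ
  mem : ℕ → ℕ

/-- Expressions; `mem a` is the content of the memory cell whose address is the value of `a`. -/
inductive Expr : Type
  | const (c : ℕ)
  | var (i : ℕ)
  | mem (a : Expr)
  | add (a b : Expr)
  | sub (a b : Expr)
  | mul (a b : Expr)

/-- The value of an expression in a state. -/
def Expr.eval (s : State) : Expr → ℕ
  | .const c => c
  | .var i => s.var i
  | .mem a => s.mem (a.eval s)
  | .add a b => a.eval s + b.eval s
  | .sub a b => a.eval s - b.eval s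
  | .mul a b => a.eval s * b.eval s

/-- The number of elementary steps for the evaluation of an expression. -/
def Expr.cost : Expr → ℕ
  | .const _ => 1
  | .var _ => 1
  | .mem a => a.cost + 1
  | .add a b => a.cost + b.cost + 1
  | .sub a b => a.cost + b.cost + 1
  | .mul a b => a.cost + b.cost + 1

/-- Programs: the empty program, assignment to a variable, assignment to the memory cell with a
computed address, composition, branching (on whether an expression is nonzero), and repetition
(while an expression is nonzero). -/
inductive Prog : Type
  | skip
  | assign (i : ℕ) (e : Expr)
  | store (a e : Expr)
  | seq (p q : Prog)
  | branch (e : Expr) (p q : Prog)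
  | loop (e : Expr) (p : Prog)

/-- `Runs p s s' k`: started in the state `s`, the program `p` halts in the state `s'` after exactly
`k` elementary steps. -/
inductive Runs : Prog → State → State → ℕ → Prop
  | skip (s : State) : Runs .skip s s 1
  | assign (i : ℕ) (e : Expr) (s : State) :
      Runs (.assign i e) s ⟨Function.update s.var i (e.eval s), s.mem⟩ (e.cost + 1)
  | store (a e : Expr) (s : State) :
      Runs (.store a e) s ⟨s.var, Function.update s.mem (a.eval s) (e.eval s)⟩
        (a.cost + e.cost + 1)
  | seq {p q : Prog} {s s' s'' : State} {k k' : ℕ} :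
      Runs p s s' k → Runs q s' s'' k' → Runs (.seq p q) s s'' (k + k')
  | branch_pos {e : Expr} {p q : Prog} {s s' : State} {k : ℕ} :
      e.eval s ≠ 0 → Runs p s s' k → Runs (.branch e p q) s s' (e.cost + 1 + k)
  | branch_zero {e : Expr} {p q : Prog} {s s' : State} {k : ℕ} :
      e.eval s = 0 → Runs q s s' k → Runs (.branch e p q) s s' (e.cost + 1 + k)
  | loop_pos {e : Expr} {p : Prog} {s s' s'' : State} {k k' : ℕ} :
      e.eval s ≠ 0 → Runs p s s' k → Runs (.loop e p) s' s'' k' →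
        Runs (.loop e p) s s'' (e.cost + 1 + k + k')
  | loop_zero {e : Expr} {p : Prog} {s : State} :
      e.eval s = 0 → Runs (.loop e p) s s (e.cost + 1)

/-- The initial state for the input `(n, ω)`: the variables `0` and `1` hold `n` and `ω`, and
everything else is zero. -/
def inputState (n ω : ℕ) : State where
  var i := if i = 0 then n else if i = 1 then ω else 0
  mem _ := 0

/-- On the input `(n, ω)` the program halts after at most `B` elementary steps, with `v` in the
variable `0`. -/
def ComputesWithin (p : Prog) (n ω v B : ℕ) : Prop :=
  ∃ s k, Runs p (inputState n ω) s k ∧ s.var 0 = v ∧ k ≤ B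

end ChordalCount

/-! The proof rests on one decomposition. If `Y` is a clique of a chordal graph, the components of
`G \ Y` do not interact: `G` arises by gluing, along `Y`, one graph for each component together with
its neighborhood. Chordality survives the gluing (`Parts.isChordal_sup`, by Dirac's theorem
`IsChordal.exists_simplicial`), so does colorability (`Parts.colorable_sup`), and the evaporation
with exception set `Y` runs separately in each component (`Agree.mem_alive_iff`). A component is
therefore recorded as a `Piece`: its vertices, its neighborhood in `Y`, and the times at which it is
dead. Graphs live on an ambient type in which vertices outside `Y ∪ K` are isolated, and `Fam`
collects those whose set of pieces satisfies a given condition. `Parts.ncard_glue` turns gluing into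
a product of counts. Two counting principles follow: separating the pieces with a given property
(`ncard_fam_split`), and removing the piece that contains a marked vertex (`ncard_fam_peel`), which
is the source of the binomials `(k-1).choose (k'-1)`.

It remains to express the counted families by conditions on pieces. For the `g` functions this is
direct. For the `f` functions the exception set is `X`, but the natural base is the clique `Y = X ∪
L`. The set `L` is the last layer exactly when everything outside `Y` is gone at time `s = t - 1`
and no vertex of `L` is simplicial one step earlier (`evaporatesAt_layer_iff`). Just before it dies,
a component is a clique complete to its neighborhood (`last_layer`). Hence a vertex of `Y` is
non-simplicial at that time exactly when it is seen by a late component that misses part of `Y`, or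
by two late components (`notMem_simplicialIn_iff`). For all of `L` at once this is `LateCovers`:
either the late components that do not see all of `Y` cover `L`, or two late components see all of
`Y`. The three summands in the recurrence for `f̃` are the cases of zero, one, or at least two
components seeing all of `Y`. The recurrence for `g̃_1` sorts by the last layer, a clique complete
to `X` (`mem_single_and_layer_iff`).

For the total, the exception set is empty. Each step removes a simplicial vertex by Dirac's theorem,
so a graph on `n` vertices evaporates at a unique time between `1` and `n`.

Each recurrence refers only to entries that are smaller in the lexicographic order of time, table
number and `k`. After the addition of two auxiliary tables, `sum_term` writes every entry as one
double sum over earlier entries. This gives uniqueness by induction (`tableVal_unique`) and also the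
program, which fills the memory in exactly this order. With five table indices and two summation
indices, all below `N = n + 1`, the cost is `O(N ^ 7)`. The recurrence for `f̃_p` has a triple sum,
but its inner sum over `x'` depends on neither `l` nor `z` and is tabulated in advance. Replacing
`ω` by `min n ω` keeps all clique sizes below `N`. -/

namespace ChordalCount

/-! ### Simplicial vertices and Dirac's theorem -/

section Chordal

variable {V : Type*}

/-- The edges of `G` with both ends in `A`. -/
def restr (G : SimpleGraph V) (A : Set V) : SimpleGraph V where
  Adj a b := G.Adj a b ∧ a ∈ A ∧ b ∈ A
  symm := ⟨fun _ _ h => ⟨h.1.symm, h.2.2, h.2.1⟩⟩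
  loopless := ⟨fun _ h => G.loopless.irrefl _ h.1⟩

theorem restr_adj {G : SimpleGraph V} {A : Set V} {a b : V} :
    (restr G A).Adj a b ↔ G.Adj a b ∧ a ∈ A ∧ b ∈ A := Iff.rfl

theorem restr_le (G : SimpleGraph V) (A : Set V) : restr G A ≤ G := fun _ _ h => h.1

theorem restr_mono (G : SimpleGraph V) {A B : Set V} (h : A ⊆ B) : restr G A ≤ restr G B :=
  fun _ _ hab => ⟨hab.1, h hab.2.1, h hab.2.2⟩

theorem mem_of_reachable_restr {G : SimpleGraph V} {A : Set V} {a b : V} (ha : a ∈ A)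
    (h : (restr G A).Reachable a b) : b ∈ A := by
  obtain ⟨w⟩ := h
  induction w with
  | nil => exact ha
  | cons h _ ih => exact ih h.2.2

/-- Puts cyclic adjacency into linear arithmetic over the natural numbers, so that `omega` decides
all later questions about it. -/
theorem cycleGraph_adj_val {m : ℕ} {a b : Fin m} (hm : 2 ≤ m) :
    (SimpleGraph.cycleGraph m).Adj a b ↔
      (a.val + 1 = b.val ∨ b.val + 1 = a.val ∨ (a.val = 0 ∧ b.val + 1 = m) ∨
        (b.val = 0 ∧ a.val + 1 = m)) := by
  have key : ∀ a b : Fin m, ((a - b : Fin m) : ℕ) = if b.val ≤ a.val then a.val - b.val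
      else m + a.val - b.val := by
    intro a b
    split_ifs with h
    · exact Fin.sub_val_of_le h
    · exact Fin.coe_sub_iff_lt.2 (by simpa using h)
  rw [SimpleGraph.cycleGraph_adj', key, key]
  have := a.2
  have := b.2
  split_ifs <;> omega

/-- A vertex together with an induced path between two of its neighbors, the inner vertices of
which are no neighbors of it, is an induced cycle. -/
theorem not_isChordal_of_induced_path {G : SimpleGraph V} {u : V} {d : ℕ} (hd : 2 ≤ d) (p : ℕ → V)
    (hp : ∀ i ≤ d, ∀ j ≤ d, p i = p j → i = j)
    (hadj : ∀ i ≤ d, ∀ j ≤ d, G.Adj (p i) (p j) ↔ i + 1 = j ∨ j + 1 = i)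
    (hu : ∀ i ≤ d, p i ≠ u) (hup : ∀ i ≤ d, G.Adj u (p i) ↔ i = 0 ∨ i = d) :
    ¬ IsChordal G := by
  intro h
  -- The path occupies the positions `0, …, d` of the cycle and `u` the remaining position `d + 1`.
  have hinj : Function.Injective fun i : Fin (d + 2) => if i.val ≤ d then p i.val else u := by
    intro i j hij
    have := i.2
    have := j.2
    simp only at hij
    ext
    split_ifs at hij with h1 h2 h2
    · exact hp _ h1 _ h2 hij
    · exact absurd hij (hu _ h1)
    · exact absurd hij.symm (hu _ h2)
    · omega
  refine (h (d + 2) (by omega)).false ⟨⟨_, hinj⟩, ?_⟩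
  · intro i j
    have := i.2
    have := j.2
    rw [cycleGraph_adj_val (by omega)]
    simp only [Function.Embedding.coeFn_mk]
    split_ifs with h1 h2 h2
    · rw [hadj _ h1 _ h2]; omega
    · rw [G.adj_comm, hup _ h1]; omega
    · rw [hup _ h2]; omega
    · simp only [SimpleGraph.irrefl, false_iff]; omega

/-- Otherwise a shortest path from `s` to `s'` with inner vertices in `M` has length at least two,
and closing it up through `u` gives an induced cycle: `u` has no neighbors in `M`. -/
theorem adj_of_chordal {G : SimpleGraph V} (h : IsChordal G) {u s s' : V} {M : Set V}
    (hM : ∀ v ∈ M, v ≠ u ∧ ¬ G.Adj u v) (hs : G.Adj u s) (hs' : G.Adj u s') (hne : s ≠ s')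
    {v v' : V} (hv : v ∈ M) (hsv : G.Adj v s) (hsv' : G.Adj v' s')
    (hr : (restr G M).Reachable v v') : G.Adj s s' := by
  by_contra hna
  have hv' : v' ∈ M := mem_of_reachable_restr hv hr
  set H := restr G (M ∪ {s, s'}) with hH
  have hreach : H.Reachable s s' := by
    have h1 : H.Adj s v := ⟨hsv.symm, by simp, Or.inl hv⟩
    have h2 : H.Adj v' s' := ⟨hsv', Or.inl hv', by simp⟩
    exact (h1.reachable.trans (hr.mono (restr_mono G Set.subset_union_left))).trans h2.reachable
  obtain ⟨w, hw⟩ := hreach.exists_walk_length_eq_dist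
  set d := H.dist s s' with hd
  have hd2 : 1 < d := hreach.one_lt_dist_of_ne_of_not_adj hne (fun h' => hna h'.1)
  have hstep : ∀ i < d, H.Adj (w.getVert i) (w.getVert (i + 1)) := fun i hi =>
    w.adj_getVert_succ (hw ▸ hi)
  have hdiff : ∀ a b, H.Adj a b → H.dist s b ≤ H.dist s a + 1 := by
    intro a b hab
    have := hab.diff_dist_adj (u := s)
    omega
  -- With `hlow` this shows that the `i`-th vertex of a shortest walk is at distance `i` from `s`,
  -- so the walk has neither repetitions nor chords.
  have hup : ∀ i ≤ d, H.dist s (w.getVert i) ≤ i := by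
    intro i
    induction i with
    | zero => simp
    | succ i ih =>
      intro hi
      have h1 := hdiff _ _ (hstep i (by omega))
      have h2 := ih (by omega)
      omega
  have hlow : ∀ j ≤ d, d ≤ H.dist s (w.getVert (d - j)) + j := by
    intro j
    induction j with
    | zero =>
      intro _
      have : w.getVert d = s' := by rw [← hw]; exact w.getVert_length
      rw [Nat.sub_zero, this]
      exact le_of_eq hd
    | succ j ih =>
      intro hj
      have h1 := hdiff _ _ (hstep (d - (j + 1)) (by omega))
      have h2 := ih (by omega)
      rw [show d - (j + 1) + 1 = d - j by omega] at h1
      omega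
  have hdist : ∀ i ≤ d, H.dist s (w.getVert i) = i := by
    intro i hi
    have h1 := hup i hi
    have h2 := hlow (d - i) (by omega)
    rw [show d - (d - i) = i by omega] at h2
    omega
  have hmem : ∀ i ≤ d, w.getVert i ∈ M ∪ {s, s'} := by
    intro i hi
    rcases Nat.lt_or_ge i d with h' | h'
    · exact (hstep i h').2.1
    · rw [w.getVert_of_length_le (by omega)]; simp
  have hinj : ∀ i ≤ d, ∀ j ≤ d, w.getVert i = w.getVert j → i = j := by
    intro i hi j hj hij
    rw [← hdist i hi, ← hdist j hj, hij]
  have h0 : w.getVert 0 = s := w.getVert_zero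
  have hdd : w.getVert d = s' := by rw [← hw]; exact w.getVert_length
  have hin : ∀ i ≤ d, i ≠ 0 → i ≠ d → w.getVert i ∈ M := by
    intro i hi hi0 hid
    rcases hmem i hi with h' | h' | h'
    · exact h'
    · exact absurd (hinj i hi 0 (by omega) (h'.trans h0.symm)) hi0
    · exact absurd (hinj i hi d le_rfl ((Set.mem_singleton_iff.1 h').trans hdd.symm)) hid
  refine not_isChordal_of_induced_path hd2 w.getVert hinj ?_ ?_ ?_ (u := u) h
  · intro i hi j hj
    constructor
    · intro hij
      have h1 : H.Adj (w.getVert i) (w.getVert j) := ⟨hij, hmem i hi, hmem j hj⟩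
      have h2 := hdiff _ _ h1
      have h3 := hdiff _ _ h1.symm
      rw [hdist i hi, hdist j hj] at h2 h3
      have : i ≠ j := by rintro rfl; exact G.loopless.irrefl _ hij
      omega
    · rintro (rfl | rfl)
      · exact (hstep i (by omega)).1
      · exact (hstep j (by omega)).1.symm
  · intro i hi
    by_cases hi0 : i = 0
    · rw [hi0, h0]; exact hs.ne'
    by_cases hid : i = d
    · rw [hid, hdd]; exact hs'.ne'
    exact (hM _ (hin i hi hi0 hid)).1
  · intro i hi
    constructor
    · intro hui
      by_contra hcon
      push Not at hcon
      exact (hM _ (hin i hi hcon.1 hcon.2)).2 hui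
    · rintro (rfl | rfl)
      · rwa [h0]
      · rwa [hdd]

/-- Dirac: a chordal graph has a simplicial vertex outside any given clique. -/
theorem IsChordal.exists_simplicial [Finite V] {G : SimpleGraph V} (h : IsChordal G) :
    ∀ R Q : Set V, G.IsClique Q → ¬ R ⊆ Q → ∃ v ∈ simplicialIn G R, v ∉ Q := by
  suffices H : ∀ n : ℕ, ∀ R Q : Set V, R.ncard ≤ n → G.IsClique Q → ¬ R ⊆ Q →
      ∃ v ∈ simplicialIn G R, v ∉ Q from fun R Q => H _ R Q le_rfl
  intro n
  induction n with
  | zero =>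
    intro R Q hR _ hRQ
    rw [Nat.le_zero, Set.ncard_eq_zero] at hR
    exact absurd (hR ▸ Set.empty_subset Q) hRQ
  | succ n ih =>
    intro R Q hR hQ hRQ
    -- If `Q` meets `R`, then `u` is taken in `Q`. Either way the vertices of `R` that are different
    -- from `u` and not adjacent to it lie outside `Q`, and it is among them that a simplicial
    -- vertex is sought.
    obtain ⟨u, huR, huQ⟩ : ∃ u ∈ R, ∀ q ∈ Q, q ∈ R → q = u ∨ G.Adj u q := by
      by_cases hne : (Q ∩ R).Nonempty
      · obtain ⟨u, hu, huR⟩ := hne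
        refine ⟨u, huR, fun q hq _ => ?_⟩
        by_cases hqu : q = u
        · exact Or.inl hqu
        · exact Or.inr (hQ hu hq (Ne.symm hqu))
      · obtain ⟨u, hu, -⟩ := Set.not_subset.1 hRQ
        exact ⟨u, hu, fun q hq hqR => absurd ⟨q, hq, hqR⟩ hne⟩
    have hlt : ∀ R' : Set V, R' ⊆ R → u ∉ R' → R'.ncard ≤ n := by
      intro R' h1 h2
      have := Set.ncard_lt_ncard (s := R') (t := R) ⟨h1, fun h3 => h2 (h3 huR)⟩
      omega
    by_cases huniv : ∀ r ∈ R, r ≠ u → G.Adj u r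
    · by_cases hsub : R \ {u} ⊆ Q
      · refine ⟨u, ⟨huR, hQ.subset fun x hx => hsub ⟨hx.2, hx.1.ne'⟩⟩, fun hu => hRQ ?_⟩
        intro x hx
        by_cases hxu : x = u
        · exact hxu ▸ hu
        · exact hsub ⟨hx, hxu⟩
      · obtain ⟨v, ⟨hv, hvc⟩, hvQ⟩ := ih (R \ {u}) Q (hlt _ Set.sdiff_subset (by simp)) hQ hsub
        refine ⟨v, ⟨hv.1, ?_⟩, hvQ⟩
        intro x hx y hy hxy
        by_cases hxu : x = u
        · subst hxu; exact huniv y hy.2 hxy.symm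
        by_cases hyu : y = u
        · subst hyu; exact (huniv x hx.2 hxy).symm
        exact hvc ⟨hx.1, hx.2, hxu⟩ ⟨hy.1, hy.2, hyu⟩ hxy
    · push Not at huniv
      obtain ⟨b, hbR, hbu, hub⟩ := huniv
      -- `B` is a component of the non-neighbors of `u`, and its boundary `S` consists of neighbors
      -- of `u`. Since `B` is connected, `adj_of_chordal` makes `S` a clique, and the induction
      -- hypothesis applies to `B ∪ S`, which misses `u`.
      set M : Set V := {v | v ∈ R ∧ v ≠ u ∧ ¬ G.Adj u v} with hMdef
      have hbM : b ∈ M := ⟨hbR, hbu, hub⟩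
      set B : Set V := {v | (restr G M).Reachable b v} with hB
      have hBM : B ⊆ M := fun v hv => mem_of_reachable_restr hbM hv
      set S : Set V := {s | s ∈ R ∧ s ∉ B ∧ ∃ v ∈ B, G.Adj v s} with hS
      have hSu : ∀ s ∈ S, G.Adj u s := by
        rintro s ⟨hsR, hsB, v, hvB, hvs⟩
        by_contra hus
        by_cases hsu : s = u
        · subst hsu; exact (hBM hvB).2.2 hvs.symm
        · have hsM : s ∈ M := ⟨hsR, hsu, hus⟩
          have : (restr G M).Adj v s := ⟨hvs, hBM hvB, hsM⟩
          exact hsB (SimpleGraph.Reachable.trans hvB this.reachable)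
      have hSc : G.IsClique S := by
        intro s hs s' hs' hne
        obtain ⟨-, -, v, hv, hvs⟩ := id hs
        obtain ⟨-, -, v', hv', hvs'⟩ := id hs'
        exact adj_of_chordal h (M := M) (fun x hx => hx.2) (hSu s hs) (hSu s' hs') hne (hBM hv)
          hvs hvs' ((SimpleGraph.Reachable.symm hv).trans hv')
      have huBS : u ∉ B ∪ S := by
        rintro (hu | hu)
        · exact (hBM hu).2.1 rfl
        · exact G.loopless.irrefl _ (hSu u hu)
      have hsub : B ∪ S ⊆ R := Set.union_subset (fun x hx => (hBM hx).1) fun x hx => hx.1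
      have hbB : b ∈ B := SimpleGraph.Reachable.refl b
      -- All neighbors in `R` of a vertex of `B` lie in `B ∪ S`, so a vertex of `B` that is
      -- simplicial there is simplicial in `R`.
      obtain ⟨v, ⟨hv, hvc⟩, hvS⟩ := ih (B ∪ S) S (hlt _ hsub huBS) hSc
        fun hc => (hc (Or.inl hbB)).2.1 hbB
      have hvB : v ∈ B := hv.resolve_right hvS
      refine ⟨v, ⟨hsub hv, hvc.subset ?_⟩, fun hvQ => ?_⟩
      · rintro x ⟨hvx, hxR⟩
        refine ⟨hvx, ?_⟩
        by_cases hxB : x ∈ B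
        · exact Or.inl hxB
        · exact Or.inr ⟨hxR, hxB, v, hvB, hvx⟩
      · have := hBM hvB
        rcases huQ v hvQ this.1 with h' | h'
        · exact this.2.1 h'
        · exact this.2.2 h'

/-- The two cycle neighbors of a vertex on an induced cycle of length at least four are not
adjacent, so the vertex set of such a cycle has no simplicial vertex. This converse of Dirac's
theorem is how glued graphs are shown to be chordal. -/
theorem isChordal_of_simplicial {G : SimpleGraph V}
    (h : ∀ R : Set V, R.Nonempty → (simplicialIn G R).Nonempty) : IsChordal G := by
  intro m hm
  refine ⟨fun e => ?_⟩
  obtain ⟨v, ⟨i, rfl⟩, hc⟩ := h (Set.range e) ⟨e ⟨0, by omega⟩, Set.mem_range_self _⟩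
  obtain ⟨a, b, ha, hb, hab, hnab⟩ : ∃ a b : Fin m, (SimpleGraph.cycleGraph m).Adj i a ∧
      (SimpleGraph.cycleGraph m).Adj i b ∧ a ≠ b ∧ ¬ (SimpleGraph.cycleGraph m).Adj a b := by
    have hi := i.2
    have key : ∀ a b : ℕ, ∀ (ha : a < m) (hb : b < m),
        (i.val + 1 = a ∨ (a = 0 ∧ i.val + 1 = m)) → (b + 1 = i.val ∨ (i.val = 0 ∧ b + 1 = m)) →
        ∃ a b : Fin m, (SimpleGraph.cycleGraph m).Adj i a ∧
          (SimpleGraph.cycleGraph m).Adj i b ∧ a ≠ b ∧ ¬ (SimpleGraph.cycleGraph m).Adj a b := by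
      intro a b ha hb h1 h2
      refine ⟨⟨a, ha⟩, ⟨b, hb⟩, ?_⟩
      simp only [cycleGraph_adj_val (show 2 ≤ m by omega), ne_eq, Fin.mk.injEq]
      omega
    by_cases h1 : i.val + 1 = m
    · exact key 0 (i.val - 1) (by omega) (by omega) (by omega) (by omega)
    by_cases h2 : i.val = 0
    · exact key 1 (m - 1) (by omega) (by omega) (by omega) (by omega)
    · exact key (i.val + 1) (i.val - 1) (by omega) (by omega) (by omega) (by omega)
  refine hnab (e.map_adj_iff.1 (hc ⟨e.map_adj_iff.2 ha, Set.mem_range_self _⟩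
    ⟨e.map_adj_iff.2 hb, Set.mem_range_self _⟩ fun h' => hab (e.injective h')))

theorem IsChordal.restr {G : SimpleGraph V} (h : IsChordal G) (A : Set V) :
    IsChordal (restr G A) := by
  intro m hm
  refine ⟨fun e => (h m hm).false ⟨e.toEmbedding, ?_⟩⟩
  -- Every vertex of a cycle has a neighbor, while the vertices outside `A` have become isolated.
  have hA : ∀ i, e i ∈ A := by
    intro i
    obtain ⟨j, hj⟩ : ∃ j, (SimpleGraph.cycleGraph m).Adj i j := by
      have hi := i.2
      refine ⟨⟨if i.val + 1 = m then 0 else i.val + 1, by split_ifs <;> omega⟩, ?_⟩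
      simp only [cycleGraph_adj_val (show 2 ≤ m by omega)]
      split_ifs <;> omega
    exact (e.map_adj_iff.2 hj).2.1
  intro a b
  rw [← e.map_adj_iff]
  exact ⟨fun h' => ⟨h', hA a, hA b⟩, fun h' => h'.1⟩

theorem IsChordal.map {W : Type*} {G : SimpleGraph V} (h : IsChordal G) (φ : V ↪ W) :
    IsChordal (G.map φ) := by
  intro m hm
  refine ⟨fun e => ?_⟩
  have hA : ∀ i, ∃ v, φ v = e i := by
    intro i
    obtain ⟨j, hj⟩ : ∃ j, (SimpleGraph.cycleGraph m).Adj i j := by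
      have hi := i.2
      refine ⟨⟨if i.val + 1 = m then 0 else i.val + 1, by split_ifs <;> omega⟩, ?_⟩
      simp only [cycleGraph_adj_val (show 2 ≤ m by omega)]
      split_ifs <;> omega
    obtain ⟨a, b, -, ha, -⟩ := (SimpleGraph.map_adj _ _ _ _).1 (e.map_adj_iff.2 hj)
    exact ⟨a, ha⟩
  choose f hf using hA
  refine (h m hm).false ⟨⟨f, fun i j hij => e.injective (by rw [← hf, ← hf, hij])⟩, ?_⟩
  intro a b
  rw [← e.map_adj_iff, ← hf, ← hf]
  exact (SimpleGraph.map_adj_apply (G := G) (f := φ)).symm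

theorem IsChordal.of_map {W : Type*} {G : SimpleGraph V} (φ : V ↪ W) (h : IsChordal (G.map φ)) :
    IsChordal G := fun m hm =>
  ⟨fun e => (h m hm).false (e.trans (SimpleGraph.Embedding.map φ G))⟩

end Chordal

end ChordalCount

namespace ChordalCount

/-! ### Components outside a clique, gluing along a clique, and the two counting principles -/

section Pieces

variable {V : Type*}

/-- The vertex set of the component of `v` in `G \ Y`. -/
def comp (G : SimpleGraph V) (Y : Set V) (v : V) : Set V :=
  {w | (restr G Yᶜ).Reachable v w}

theorem mem_comp_self (G : SimpleGraph V) (Y : Set V) (v : V) : v ∈ comp G Y v :=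
  SimpleGraph.Reachable.refl v

theorem comp_eq_of_mem {G : SimpleGraph V} {Y : Set V} {v w : V} (h : w ∈ comp G Y v) :
    comp G Y w = comp G Y v := by
  ext x
  exact ⟨fun hx => SimpleGraph.Reachable.trans h hx,
    fun hx => SimpleGraph.Reachable.trans (SimpleGraph.Reachable.symm h) hx⟩

theorem mem_comp_of_adj {G : SimpleGraph V} {Y : Set V} {v a b : V} (ha : a ∈ comp G Y v)
    (h : G.Adj a b) (haY : a ∉ Y) (hbY : b ∉ Y) : b ∈ comp G Y v :=
  SimpleGraph.Reachable.trans ha (SimpleGraph.Adj.reachable (G := restr G Yᶜ) ⟨h, haY, hbY⟩)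

theorem notMem_of_mem_comp {G : SimpleGraph V} {Y : Set V} {v w : V} (hv : v ∉ Y)
    (h : w ∈ comp G Y v) : w ∉ Y :=
  mem_of_reachable_restr (A := Yᶜ) hv h

/-- A set that is closed under adjacency outside `Y` contains the components of its elements. -/
theorem comp_subset {G : SimpleGraph V} {Y S : Set V} {v : V} (hv : v ∈ S)
    (h : ∀ a ∈ S, ∀ b, G.Adj a b → a ∉ Y → b ∉ Y → b ∈ S) : comp G Y v ⊆ S := by
  rintro w ⟨p⟩
  induction p with
  | nil => exact hv
  | cons e _ ih => exact ih (h _ hv _ e.1 e.2.1 e.2.2)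

theorem nbhd_comp_subset {G : SimpleGraph V} {Y : Set V} {v : V} (hv : v ∉ Y) :
    nbhd G (comp G Y v) ⊆ Y := by
  rintro w ⟨hw, u, hu, huw⟩
  by_contra hwY
  exact hw (mem_comp_of_adj hu huw (notMem_of_mem_comp hv hu) hwY)

theorem subset_alive (G : SimpleGraph V) (Y : Set V) : ∀ i, Y ⊆ alive G Y i
  | 0 => Set.subset_univ _
  | i + 1 => fun _ hv => ⟨subset_alive G Y i hv, fun h => h.2 hv⟩

theorem alive_succ_subset (G : SimpleGraph V) (Y : Set V) (i : ℕ) :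
    alive G Y (i + 1) ⊆ alive G Y i := Set.sdiff_subset

theorem alive_antitone (G : SimpleGraph V) (Y : Set V) : Antitone (alive G Y) :=
  antitone_nat_of_succ_le (alive_succ_subset G Y)

/-- A component of `G \ Y` together with its neighborhood and the times at which it is dead in the
evaporation with exception set `Y`. -/
@[ext]
structure Piece (V : Type*) where
  verts : Set V
  nbrs : Set V
  dead : ℕ → Prop

/-- The component of `v` in `G \ Y`. -/
def piece (G : SimpleGraph V) (Y : Set V) (v : V) : Piece V :=
  ⟨comp G Y v, nbhd G (comp G Y v), fun i => ∀ u ∈ comp G Y v, u ∉ alive G Y i⟩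

theorem piece_eq_of_mem {G : SimpleGraph V} {Y : Set V} {v w : V} (h : w ∈ comp G Y v) :
    piece G Y w = piece G Y v := by
  simp only [piece, comp_eq_of_mem h]

/-- The components of `G \ Y` that meet `K`. -/
def prof (G : SimpleGraph V) (Y K : Set V) : Set (Piece V) := piece G Y '' K

theorem prof_union (G : SimpleGraph V) (Y K K' : Set V) :
    prof G Y (K ∪ K') = prof G Y K ∪ prof G Y K' := Set.image_union ..

/-- `G` with exception set `Y` and `H` with exception set `Y'` look the same around `C`. -/
structure Agree (G H : SimpleGraph V) (Y Y' C : Set V) : Prop where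
  adj : ∀ v ∈ C, ∀ w, G.Adj v w ↔ H.Adj v w
  closed : ∀ v ∈ C, ∀ w, G.Adj v w → w ∈ C ∨ (w ∈ Y ∧ w ∈ Y')
  clique : G.IsClique Y
  clique' : H.IsClique Y'
  notMem : ∀ v ∈ C, v ∉ Y
  notMem' : ∀ v ∈ C, v ∉ Y'

namespace Agree

variable {G H : SimpleGraph V} {Y Y' C : Set V}

theorem symm (h : Agree G H Y Y' C) : Agree H G Y' Y C where
  adj v hv w := (h.adj v hv w).symm
  closed v hv w hvw := (h.closed v hv w ((h.adj v hv w).2 hvw)).imp_right And.symm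
  clique := h.clique'
  clique' := h.clique
  notMem := h.notMem'
  notMem' := h.notMem

/-- A neighbor of `v` lies in `C` or in both bases. Adjacency of two neighbors is the same in both
graphs if one of them is in `C`, and holds automatically if both are in the cliques. -/
theorem simplicialIn_of (h : Agree G H Y Y' C) {R R' : Set V} (hY : Y ⊆ R)
    (hR : ∀ v ∈ C, v ∈ R ↔ v ∈ R') {v : V} (hv : v ∈ C) (hs : v ∈ simplicialIn G R) :
    v ∈ simplicialIn H R' := by
  refine ⟨(hR v hv).1 hs.1, ?_⟩
  rintro a ⟨ha, haR⟩ b ⟨hb, hbR⟩ hab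
  have ha' := (h.adj v hv a).2 ha
  have hb' := (h.adj v hv b).2 hb
  have key : ∀ x, G.Adj v x → x ∈ R' → x ∈ G.neighborSet v ∩ R := by
    intro x hx hxR
    refine ⟨hx, ?_⟩
    rcases h.closed v hv x hx with h' | h'
    · exact (hR x h').2 hxR
    · exact hY h'.1
  have hG := hs.2 (key a ha' haR) (key b hb' hbR) hab
  rcases h.closed v hv a ha' with h1 | h1
  · exact (h.adj a h1 b).1 hG
  rcases h.closed v hv b hb' with h2 | h2
  · exact ((h.adj b h2 a).1 hG.symm).symm
  exact h.clique' h1.2 h2.2 hab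

/-- Evaporation is local: the status of a vertex of `C` depends only on `C` and on base vertices,
which never disappear. -/
theorem mem_alive_iff (h : Agree G H Y Y' C) (i : ℕ) :
    ∀ v ∈ C, v ∈ alive G Y i ↔ v ∈ alive H Y' i := by
  induction i with
  | zero => exact fun v _ => Iff.rfl
  | succ i ih =>
    intro v hv
    have h1 : v ∈ simplicialIn G (alive G Y i) ↔ v ∈ simplicialIn H (alive H Y' i) :=
      ⟨h.simplicialIn_of (subset_alive G Y i) ih hv,
        h.symm.simplicialIn_of (subset_alive H Y' i) (fun v hv => (ih v hv).symm) hv⟩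
    simp only [alive, Set.mem_sdiff, ih v hv, h1, h.notMem v hv, h.notMem' v hv]

theorem comp_subset_comp (h : Agree G H Y Y' C) {v : V} (hv : v ∈ C) :
    comp G Y v ⊆ C ∩ comp H Y' v := by
  refine comp_subset ⟨hv, mem_comp_self _ _ _⟩ ?_
  intro a ha b hab _ hbY
  have hb : b ∈ C := (h.closed a ha.1 b hab).resolve_right fun h' => hbY h'.1
  exact ⟨hb, mem_comp_of_adj ha.2 ((h.adj a ha.1 b).1 hab) (h.notMem' a ha.1) (h.notMem' b hb)⟩

theorem comp_eq (h : Agree G H Y Y' C) {v : V} (hv : v ∈ C) : comp G Y v = comp H Y' v :=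
  Set.Subset.antisymm (fun _ hx => (h.comp_subset_comp hv hx).2)
    fun _ hx => (h.symm.comp_subset_comp hv hx).2

theorem piece_eq (h : Agree G H Y Y' C) {v : V} (hv : v ∈ C) : piece G Y v = piece H Y' v := by
  have hC : ∀ u ∈ comp G Y v, u ∈ C := fun u hu => (h.comp_subset_comp hv hu).1
  ext u
  · exact iff_of_eq (congrArg (u ∈ ·) (h.comp_eq hv))
  · simp only [piece, nbhd, Set.mem_ofPred_eq, ← h.comp_eq hv]
    refine and_congr_right fun _ => exists_congr fun x => and_congr_right fun hx => ?_
    exact h.adj x (hC x hx) u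
  · simp only [piece, ← h.comp_eq hv]
    refine forall_congr' fun x => forall_congr' fun hx => not_congr ?_
    exact h.mem_alive_iff u x (hC x hx)

theorem prof_eq (h : Agree G H Y Y' C) : prof G Y C = prof H Y' C :=
  Set.image_congr fun _ hv => h.piece_eq hv

end Agree

/-- `G` is an `ω`-colorable chordal graph with vertices in `Y ∪ K` and `Y` is a clique. -/
structure Base (ω : ℕ) (G : SimpleGraph V) (Y K : Set V) : Prop where
  within : ∀ a b, G.Adj a b → a ∈ Y ∪ K
  clique : G.IsClique Y
  chordal : IsChordal G
  colorable : G.Colorable ω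

/-- The graphs with base `Y`, remaining vertices `K`, and a condition on the components. -/
def Fam (ω : ℕ) (Y K : Set V) (P : Set (Piece V) → Prop) : Set (SimpleGraph V) :=
  {G | Base ω G Y K ∧ P (prof G Y K)}

theorem Base.restr {ω : ℕ} {G : SimpleGraph V} {Y K Y' K' : Set V} (h : Base ω G Y K)
    (hY : Y' ⊆ Y) : Base ω (restr G (Y' ∪ K')) Y' K' where
  within _ _ hab := hab.2.1
  clique _ ha _ hb hab := ⟨h.clique (hY ha) (hY hb) hab, Or.inl ha, Or.inl hb⟩
  chordal := h.chordal.restr _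
  colorable := h.colorable.mono_left (restr_le _ _)

/-- A coloring is injective on a clique, so the colors of one graph can be permuted to match another
coloring on the common clique. -/
theorem exists_perm_eqOn {ι : Type*} [Finite ι] {Y : Set V} (c d : V → ι) (hc : Set.InjOn c Y)
    (hd : Set.InjOn d Y) : ∃ σ : Equiv.Perm ι, ∀ y ∈ Y, σ (c y) = d y := by
  have : Finite Y := Finite.of_injective (fun y : Y => c y) fun a b hab =>
    Subtype.ext (hc a.2 b.2 hab)
  obtain ⟨σ, hσ⟩ := Equiv.Perm.exists_extending_pair (fun y : Y => c y) (fun y : Y => d y)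
    (fun a b hab => Subtype.ext (hc a.2 b.2 hab)) (fun a b hab => Subtype.ext (hd a.2 b.2 hab))
  exact ⟨σ, fun y hy => hσ ⟨y, hy⟩⟩

/-- The vertex sets along which graphs are glued. -/
structure Parts (Y Y₁ K₁ K₂ : Set V) : Prop where
  sub : Y₁ ⊆ Y
  left : ∀ v ∈ K₁, v ∉ Y
  right : ∀ v ∈ K₂, v ∉ Y
  disj : ∀ v ∈ K₁, v ∉ K₂

namespace Parts

variable {Y Y₁ K₁ K₂ : Set V} {ω : ℕ} {G₁ G₂ : SimpleGraph V}

theorem not_adj_right (h : Parts Y Y₁ K₁ K₂) (h₂ : Base ω G₂ Y K₂) {v w : V} (hv : v ∈ K₁) :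
    ¬ G₂.Adj v w := fun hvw =>
  (h₂.within v w hvw).elim (h.left v hv) (h.disj v hv)

theorem not_adj_left (h : Parts Y Y₁ K₁ K₂) (h₁ : Base ω G₁ Y₁ K₁) {v w : V} (hv : v ∈ K₂) :
    ¬ G₁.Adj v w := fun hvw =>
  (h₁.within v w hvw).elim (fun h' => h.right v hv (h.sub h')) fun h' => h.disj v h' hv

theorem clique_sup (h₂ : Base ω G₂ Y K₂) : (G₁ ⊔ G₂).IsClique Y :=
  h₂.clique.mono le_sup_right

theorem agree_left (h : Parts Y Y₁ K₁ K₂) (h₁ : Base ω G₁ Y₁ K₁) (h₂ : Base ω G₂ Y K₂) :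
    Agree (G₁ ⊔ G₂) G₁ Y Y₁ K₁ where
  adj v hv w := by simp [h.not_adj_right h₂ hv]
  closed v hv w hvw := by
    rcases hvw with hvw | hvw
    · rcases h₁.within w v hvw.symm with h' | h'
      · exact Or.inr ⟨h.sub h', h'⟩
      · exact Or.inl h'
    · exact absurd hvw (h.not_adj_right h₂ hv)
  clique := clique_sup h₂
  clique' := h₁.clique
  notMem := h.left
  notMem' v hv hv' := h.left v hv (h.sub hv')

theorem agree_right (h : Parts Y Y₁ K₁ K₂) (h₁ : Base ω G₁ Y₁ K₁) (h₂ : Base ω G₂ Y K₂) :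
    Agree (G₁ ⊔ G₂) G₂ Y Y K₂ where
  adj v hv w := by simp [h.not_adj_left h₁ hv]
  closed v hv w hvw := by
    rcases hvw with hvw | hvw
    · exact absurd hvw (h.not_adj_left h₁ hv)
    · rcases h₂.within w v hvw.symm with h' | h'
      · exact Or.inr ⟨h', h'⟩
      · exact Or.inl h'
  clique := clique_sup h₂
  clique' := h₂.clique
  notMem := h.right
  notMem' := h.right

/-- Edges of the first graph between vertices outside `K₁` are edges of the second graph. -/
theorem adj_right_of_left (h : Parts Y Y₁ K₁ K₂) (h₁ : Base ω G₁ Y₁ K₁) (h₂ : Base ω G₂ Y K₂)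
    {a b : V} (hab : G₁.Adj a b) (ha : a ∉ K₁) (hb : b ∉ K₁) : G₂.Adj a b :=
  h₂.clique (h.sub ((h₁.within a b hab).resolve_right ha))
    (h.sub ((h₁.within b a hab.symm).resolve_right hb)) hab.ne

/-- If `R` meets `K₁`, Dirac's theorem in the first graph gives a simplicial vertex outside the
clique `Y₁`; it lies in `K₁` and has no neighbors beyond those in the first graph. Otherwise all
edges inside `R` come from the second graph. -/
theorem isChordal_sup [Finite V] (h : Parts Y Y₁ K₁ K₂) (h₁ : Base ω G₁ Y₁ K₁)
    (h₂ : Base ω G₂ Y K₂) : IsChordal (G₁ ⊔ G₂) := by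
  refine isChordal_of_simplicial fun R hR => ?_
  by_cases hRK : (R ∩ K₁).Nonempty
  · obtain ⟨u, huR, huK⟩ := hRK
    obtain ⟨v, ⟨⟨hvR, hvA⟩, hvc⟩, hvY⟩ := h₁.chordal.exists_simplicial (R ∩ (Y₁ ∪ K₁)) Y₁ h₁.clique
      fun hc => h.left u huK (h.sub (hc ⟨huR, Or.inr huK⟩))
    have hvK : v ∈ K₁ := hvA.resolve_left hvY
    have key : ∀ x, (G₁ ⊔ G₂).Adj v x → G₁.Adj v x ∧ x ∈ Y₁ ∪ K₁ := by
      intro x hx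
      have h' := ((h.agree_left h₁ h₂).adj v hvK x).1 hx
      exact ⟨h', h₁.within x v h'.symm⟩
    refine ⟨v, hvR, ?_⟩
    rintro a ⟨ha, haR⟩ b ⟨hb, hbR⟩ hab
    exact Or.inl (hvc ⟨(key a ha).1, haR, (key a ha).2⟩ ⟨(key b hb).1, hbR, (key b hb).2⟩ hab)
  · obtain ⟨u, huR⟩ := hR
    obtain ⟨v, ⟨hvR, hvc⟩, -⟩ := h₂.chordal.exists_simplicial R ∅ (by simp)
      fun hc => hc huR
    have hK : ∀ x ∈ R, x ∉ K₁ := fun x hx hxK => hRK ⟨x, hx, hxK⟩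
    have key : ∀ x ∈ R, (G₁ ⊔ G₂).Adj v x → G₂.Adj v x := by
      rintro x hx (h' | h')
      · exact h.adj_right_of_left h₁ h₂ h' (hK v hvR) (hK x hx)
      · exact h'
    refine ⟨v, hvR, ?_⟩
    rintro a ⟨ha, haR⟩ b ⟨hb, hbR⟩ hab
    exact Or.inr (hvc ⟨key a haR ha, haR⟩ ⟨key b hbR hb, hbR⟩ hab)

theorem colorable_sup (h : Parts Y Y₁ K₁ K₂) (h₁ : Base ω G₁ Y₁ K₁) (h₂ : Base ω G₂ Y K₂) :
    (G₁ ⊔ G₂).Colorable ω := by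
  classical
  obtain ⟨c⟩ := h₁.colorable
  obtain ⟨d⟩ := h₂.colorable
  obtain ⟨σ, hσ⟩ := exists_perm_eqOn (Y := Y₁) c d
    (fun a ha b hb hab => by_contra fun hne => c.valid (h₁.clique ha hb hne) hab)
    (fun a ha b hb hab => by_contra fun hne =>
      d.valid (h₂.clique (h.sub ha) (h.sub hb) hne) hab)
  have key : ∀ a b, a ∈ K₁ → (G₁ ⊔ G₂).Adj a b → σ (c a) ≠ if b ∈ K₁ then σ (c b) else d b := by
    intro a b ha hab
    have hab' := ((h.agree_left h₁ h₂).adj a ha b).1 hab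
    split_ifs with hb
    · exact fun h' => c.valid hab' (σ.injective h')
    · rw [← hσ b ((h₁.within b a hab'.symm).resolve_right hb)]
      exact fun h' => c.valid hab' (σ.injective h')
  refine ⟨SimpleGraph.Coloring.mk (fun v => if v ∈ K₁ then σ (c v) else d v) ?_⟩
  intro a b hab
  by_cases ha : a ∈ K₁
  · simpa only [if_pos ha] using key a b ha hab
  by_cases hb : b ∈ K₁
  · simpa only [if_pos hb] using (key b a hb hab.symm).symm
  simp only [if_neg ha, if_neg hb]
  rcases hab with hab | hab
  · exact d.valid (h.adj_right_of_left h₁ h₂ hab ha hb)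
  · exact d.valid hab

theorem base_sup [Finite V] (h : Parts Y Y₁ K₁ K₂) (h₁ : Base ω G₁ Y₁ K₁)
    (h₂ : Base ω G₂ Y K₂) : Base ω (G₁ ⊔ G₂) Y (K₁ ∪ K₂) where
  within a b hab := by
    rcases hab with hab | hab
    · rcases h₁.within a b hab with h' | h'
      · exact Or.inl (h.sub h')
      · exact Or.inr (Or.inl h')
    · rcases h₂.within a b hab with h' | h'
      · exact Or.inl h'
      · exact Or.inr (Or.inr h')
  clique := clique_sup h₂
  chordal := h.isChordal_sup h₁ h₂
  colorable := h.colorable_sup h₁ h₂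

/-- The only edges that the second graph could add lie inside `Y₁`, which is already a clique in the
first one. So gluing loses no information. -/
theorem restr_sup_left (h : Parts Y Y₁ K₁ K₂) (h₁ : Base ω G₁ Y₁ K₁) (h₂ : Base ω G₂ Y K₂) :
    restr (G₁ ⊔ G₂) (Y₁ ∪ K₁) = G₁ := by
  ext a b
  refine ⟨?_, fun hab => ⟨Or.inl hab, h₁.within a b hab, h₁.within b a hab.symm⟩⟩
  rintro ⟨hab | hab, ha, hb⟩
  · exact hab
  · have ha' := ha.resolve_right fun h' => h.not_adj_right h₂ h' hab
    have hb' := hb.resolve_right fun h' => h.not_adj_right h₂ h' hab.symm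
    exact h₁.clique ha' hb' hab.ne

theorem restr_sup_right (h : Parts Y Y₁ K₁ K₂) (h₁ : Base ω G₁ Y₁ K₁) (h₂ : Base ω G₂ Y K₂) :
    restr (G₁ ⊔ G₂) (Y ∪ K₂) = G₂ := by
  ext a b
  refine ⟨?_, fun hab => ⟨Or.inr hab, h₂.within a b hab, h₂.within b a hab.symm⟩⟩
  rintro ⟨hab | hab, ha, hb⟩
  · have key : ∀ x ∈ Y ∪ K₂, x ∉ K₁ := fun x hx hxK => hx.elim (h.left x hxK) (h.disj x hxK)
    exact h.adj_right_of_left h₁ h₂ hab (key a ha) (key b hb)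
  · exact hab

theorem restr_sup_restr (_h : Parts Y Y₁ K₁ K₂) {G : SimpleGraph V} (hG : Base ω G Y (K₁ ∪ K₂))
    (hc : ∀ v ∈ K₁, ∀ w, G.Adj v w → w ∈ Y₁ ∪ K₁) :
    restr G (Y₁ ∪ K₁) ⊔ restr G (Y ∪ K₂) = G := by
  ext a b
  refine ⟨fun hab => hab.elim And.left And.left, fun hab => ?_⟩
  by_cases ha : a ∈ K₁
  · exact Or.inl ⟨hab, Or.inr ha, hc a ha b hab⟩
  by_cases hb : b ∈ K₁
  · exact Or.inl ⟨hab, hc b hb a hab.symm, Or.inr hb⟩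
  have key : ∀ x y, G.Adj x y → x ∉ K₁ → x ∈ Y ∪ K₂ := by
    intro x y hxy hx
    rcases hG.within x y hxy with h' | h' | h'
    · exact Or.inl h'
    · exact absurd h' hx
    · exact Or.inr h'
  exact Or.inr ⟨hab, key a b hab ha, key b a hab.symm hb⟩

/-- Graphs that fall apart along a clique are pairs of graphs. -/
theorem ncard_glue [Finite V] (h : Parts Y Y₁ K₁ K₂) (P₁ P₂ : Set (Piece V) → Prop) :
    {G | Base ω G Y (K₁ ∪ K₂) ∧ (∀ v ∈ K₁, ∀ w, G.Adj v w → w ∈ Y₁ ∪ K₁) ∧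
      P₁ (prof G Y K₁) ∧ P₂ (prof G Y K₂)}.ncard =
    (Fam ω Y₁ K₁ P₁).ncard * (Fam ω Y K₂ P₂).ncard := by
  rw [← Set.ncard_prod]
  symm
  -- The two factors are recovered from the union by restriction.
  have hinj : Set.InjOn (fun p : SimpleGraph V × SimpleGraph V => p.1 ⊔ p.2)
      (Fam ω Y₁ K₁ P₁ ×ˢ Fam ω Y K₂ P₂) := by
    rintro ⟨G₁, G₂⟩ ⟨h₁, h₂⟩ ⟨H₁, H₂⟩ ⟨k₁, k₂⟩ heq
    simp only at heq h₁ h₂ k₁ k₂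
    refine Prod.ext ?_ ?_
    · exact ((h.restr_sup_left h₁.1 h₂.1).symm.trans (heq ▸ rfl)).trans (h.restr_sup_left k₁.1 k₂.1)
    · exact ((h.restr_sup_right h₁.1 h₂.1).symm.trans (heq ▸ rfl)).trans
        (h.restr_sup_right k₁.1 k₂.1)
  rw [← hinj.ncard_image]
  congr 1
  ext G
  constructor
  · rintro ⟨⟨G₁, G₂⟩, ⟨h₁, h₂⟩, rfl⟩
    simp only at h₁ h₂ ⊢
    have a₁ := h.agree_left h₁.1 h₂.1
    have a₂ := h.agree_right h₁.1 h₂.1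
    refine ⟨h.base_sup h₁.1 h₂.1, ?_, ?_, ?_⟩
    · intro v hv w hvw
      exact h₁.1.within w v ((a₁.adj v hv w).1 hvw).symm
    · rw [a₁.prof_eq]; exact h₁.2
    · rw [a₂.prof_eq]; exact h₂.2
  · rintro ⟨hG, hc, hP₁, hP₂⟩
    have b₁ : Base ω (restr G (Y₁ ∪ K₁)) Y₁ K₁ := hG.restr h.sub
    have b₂ : Base ω (restr G (Y ∪ K₂)) Y K₂ := hG.restr subset_rfl
    have e := h.restr_sup_restr hG hc
    have a₁ := h.agree_left b₁ b₂
    have a₂ := h.agree_right b₁ b₂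
    rw [e] at a₁ a₂
    refine ⟨(restr G (Y₁ ∪ K₁), restr G (Y ∪ K₂)), ⟨⟨b₁, ?_⟩, ⟨b₂, ?_⟩⟩, e⟩
    · rw [← a₁.prof_eq]; exact hP₁
    · rw [← a₂.prof_eq]; exact hP₂

end Parts

theorem ncard_eq_sum_fiber {α ι : Type*} [Finite α] [DecidableEq ι] (S : Set α) (f : α → ι)
    (T : Finset ι) (h : ∀ a ∈ S, f a ∈ T) : S.ncard = ∑ i ∈ T, {a | a ∈ S ∧ f a = i}.ncard := by
  classical
  have := Fintype.ofFinite α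
  rw [Set.ncard_eq_toFinset_card', Finset.card_eq_sum_card_fiberwise (f := f) (t := T)
    (fun a ha => h a (by simpa using ha))]
  refine Finset.sum_congr rfl fun i _ => ?_
  rw [Set.ncard_eq_toFinset_card']
  congr 1
  ext a
  simp

variable {ω : ℕ}

/-- Splitting off the components with a given property. -/
theorem ncard_fam_split [Finite V] [DecidableEq V] {Y : Set V} {K : Finset V}
    (hY : ∀ v ∈ K, v ∉ Y) {P P₁ P₂ : Set (Piece V) → Prop} (q : Piece V → Prop)
    (h : ∀ A B, (P (A ∪ B) ∧ (∀ c ∈ A, q c) ∧ ∀ c ∈ B, ¬ q c) ↔ P₁ A ∧ P₂ B) :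
    (Fam ω Y K P).ncard =
      ∑ W ∈ K.powerset, (Fam ω Y W P₁).ncard * (Fam ω Y ↑(K \ W) P₂).ncard := by
  classical
  -- The graphs are sorted by the set `W` of vertices whose piece has the property `q`. It is a
  -- union of components, so gluing applies.
  rw [ncard_eq_sum_fiber _ (fun G => K.filter fun v => q (piece G Y v)) K.powerset
    fun G _ => by simp]
  refine Finset.sum_congr rfl fun W hW => ?_
  rw [Finset.mem_powerset] at hW
  have hparts : Parts Y Y (W : Set V) (↑(K \ W) : Set V) :=
    ⟨subset_rfl, fun v hv => hY v (hW hv), fun v hv => hY v (Finset.mem_sdiff.1 hv).1,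
      fun v hv hv' => (Finset.mem_sdiff.1 hv').2 hv⟩
  have hK : (K : Set V) = ↑W ∪ ↑(K \ W) := by
    rw [← Finset.coe_union, Finset.union_sdiff_of_subset hW]
  rw [← hparts.ncard_glue]
  congr 1
  ext G
  simp only [Set.mem_ofPred_eq, Fam]
  rw [← hK]
  constructor
  · rintro ⟨⟨hG, hP⟩, rfl⟩
    rw [hK, prof_union] at hP
    have hq : (∀ c ∈ prof G Y ↑(K.filter fun v => q (piece G Y v)), q c) ∧
        ∀ c ∈ prof G Y ↑(K \ K.filter fun v => q (piece G Y v)), ¬ q c := by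
      constructor
      · rintro _ ⟨v, hv, rfl⟩
        exact (Finset.mem_filter.1 hv).2
      · rintro _ ⟨v, hv, rfl⟩ hqv
        have hv := Finset.mem_sdiff.1 hv
        exact hv.2 (Finset.mem_filter.2 ⟨hv.1, hqv⟩)
    obtain ⟨h₁, h₂⟩ := (h _ _).1 ⟨hP, hq⟩
    refine ⟨hG, ?_, h₁, h₂⟩
    intro v hv w hvw
    rcases hG.within w v hvw.symm with h' | h'
    · exact Or.inl h'
    · right
      rw [Finset.mem_coe, Finset.mem_filter] at hv ⊢
      refine ⟨h', ?_⟩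
      rw [piece_eq_of_mem (mem_comp_of_adj (mem_comp_self G Y v) hvw (hY v hv.1) (hY w h'))]
      exact hv.2
  · rintro ⟨hG, -, h₁, h₂⟩
    obtain ⟨hP, hq, hq'⟩ := (h _ _).2 ⟨h₁, h₂⟩
    refine ⟨⟨hG, ?_⟩, ?_⟩
    · rw [hK, prof_union]; exact hP
    · ext v
      rw [Finset.mem_filter]
      constructor
      · rintro ⟨hv, hqv⟩
        by_contra hvW
        exact hq' _ ⟨v, Finset.mem_coe.2 (Finset.mem_sdiff.2 ⟨hv, hvW⟩), rfl⟩ hqv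
      · intro hv
        exact ⟨hW hv, hq _ ⟨v, hv, rfl⟩⟩

/-- The graphs with a single component, the neighborhood of which is the whole base. -/
abbrev Single (W N : Set V) (E : (ℕ → Prop) → Prop) (A : Set (Piece V)) : Prop :=
  ∃ d, A = {⟨W, N, d⟩} ∧ E d

/-- Splitting off the component of a given vertex. -/
theorem ncard_fam_peel [Finite V] [DecidableEq V] {Y K : Finset V} (hY : ∀ v ∈ K, v ∉ Y) {v₀ : V}
    (hv₀ : v₀ ∈ K) {P : Set (Piece V) → Prop} (E : (ℕ → Prop) → Prop) (R : Finset V → Prop)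
    [DecidablePred R] (P' : Finset V → Set (Piece V) → Prop)
    (h : ∀ (W N : Finset V) d B, P (insert ⟨W, N, d⟩ B) ↔ (R N ∧ E d) ∧ P' N B) :
    (Fam ω (Y : Set V) K P).ncard =
      ∑ W ∈ K.powerset with v₀ ∈ W, ∑ N ∈ Y.powerset with R N,
        (Fam ω (N : Set V) W (Single W N E)).ncard * (Fam ω (Y : Set V) ↑(K \ W) (P' N)).ncard := by
  classical
  have hcompK : ∀ G, Base ω G (Y : Set V) K → ∀ v ∈ K, comp G Y v ⊆ K := by
    intro G hG v hv
    refine comp_subset hv fun a _ b hab _ hb => ?_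
    exact (hG.within b a hab.symm).resolve_left hb
  have hlab : ∀ G, Base ω G (Y : Set V) K →
      ((K.filter (· ∈ comp G Y v₀) : Finset V) : Set V) = comp G Y v₀ ∧
      ((Y.filter (· ∈ nbhd G (comp G Y v₀)) : Finset V) : Set V) = nbhd G (comp G Y v₀) := by
    intro G hG
    constructor
    · ext x
      simp only [Finset.coe_filter, Set.mem_ofPred_eq, and_iff_right_iff_imp]
      exact fun hx => hcompK G hG v₀ hv₀ hx
    · ext x
      simp only [Finset.coe_filter, Set.mem_ofPred_eq, and_iff_right_iff_imp]
      exact fun hx => nbhd_comp_subset (hY v₀ hv₀) hx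
  have hprof : ∀ (G : SimpleGraph V) (W : Finset V), (W : Set V) = comp G Y v₀ →
      prof G Y W = {piece G Y v₀} := by
    intro G W hW
    rw [hW]
    ext c
    constructor
    · rintro ⟨v, hv, rfl⟩
      exact piece_eq_of_mem hv
    · rintro rfl
      exact ⟨v₀, mem_comp_self _ _ _, rfl⟩
  rw [← Finset.sum_product']
  -- The graphs are sorted by the component of `v₀` together with its neighborhood.
  rw [ncard_eq_sum_fiber _ (fun G => (K.filter (· ∈ comp G Y v₀),
    Y.filter (· ∈ nbhd G (comp G Y v₀)))) ((K.powerset.filter (v₀ ∈ ·)) ×ˢ (Y.powerset.filter R))]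
  · refine Finset.sum_congr rfl ?_
    rintro ⟨W, N⟩ hWN
    simp only [Finset.mem_product, Finset.mem_filter, Finset.mem_powerset] at hWN
    obtain ⟨⟨hW, hv₀W⟩, hN, hR⟩ := hWN
    have hparts : Parts (Y : Set V) (N : Set V) (W : Set V) (↑(K \ W) : Set V) :=
      ⟨hN, fun v hv => hY v (hW hv), fun v hv => hY v (Finset.mem_sdiff.1 hv).1,
        fun v hv hv' => (Finset.mem_sdiff.1 hv').2 hv⟩
    have hK : (K : Set V) = ↑W ∪ ↑(K \ W) := by
      rw [← Finset.coe_union, Finset.union_sdiff_of_subset hW]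
    rw [← hparts.ncard_glue]
    congr 1
    ext G
    simp only [Set.mem_ofPred_eq, Fam, Prod.mk.injEq]
    rw [← hK]
    constructor
    · rintro ⟨⟨hG, hP⟩, hW', hN'⟩
      have hl := hlab G hG
      rw [hW', hN'] at hl
      have hp := hprof G W hl.1
      have hpiece : piece G Y v₀ = ⟨W, N, (piece G Y v₀).dead⟩ := by
        rw [hl.1, hl.2]; rfl
      rw [hK, prof_union, hp, hpiece, ← Set.insert_eq, h] at hP
      refine ⟨hG, ?_, ⟨_, hp.trans (by rw [← hpiece]), hP.1.2⟩, hP.2⟩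
      intro v hv w hvw
      rw [hl.1] at hv ⊢
      rw [hl.2]
      by_cases hw : w ∈ comp G Y v₀
      · exact Or.inr hw
      · exact Or.inl ⟨hw, v, hv, hvw⟩
    · rintro ⟨hG, -, ⟨d, hd, hE⟩, hP'⟩
      have hv : piece G Y v₀ = ⟨W, N, d⟩ := by
        have : piece G Y v₀ ∈ prof G Y W := ⟨v₀, hv₀W, rfl⟩
        rwa [hd] at this
      have hl := hlab G hG
      have e1 : comp G Y v₀ = W := congrArg Piece.verts hv
      have e2 : nbhd G (comp G Y v₀) = N := congrArg Piece.nbrs hv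
      rw [e2, e1] at hl
      refine ⟨⟨hG, ?_⟩, ?_⟩
      · rw [hK, prof_union, hd, ← Set.insert_eq, h]
        exact ⟨⟨hR, hE⟩, hP'⟩
      · rw [e2, e1]
        exact ⟨Finset.coe_injective hl.1, Finset.coe_injective hl.2⟩
  · rintro G ⟨hG, hP⟩
    have hl := hlab G hG
    simp only [Finset.mem_product, Finset.mem_filter, Finset.mem_powerset, Finset.filter_subset,
      true_and]
    refine ⟨⟨hv₀, mem_comp_self _ _ _⟩, ?_⟩
    -- Inserting the piece of `v₀` into the full set of pieces changes nothing, but it gives `P` the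
    -- shape in which `h` yields `R` for the neighborhood.
    have hK : (K : Set V) = ↑(K.filter (· ∈ comp G Y v₀)) ∪ (K : Set V) :=
      (Set.union_eq_right.2 (Finset.coe_subset.2 (Finset.filter_subset _ _))).symm
    have hpiece : piece G Y v₀ = ⟨↑(K.filter (· ∈ comp G Y v₀)),
        ↑(Y.filter (· ∈ nbhd G (comp G Y v₀))), (piece G Y v₀).dead⟩ := by
      rw [hl.1, hl.2]; rfl
    rw [hK, prof_union, hprof G _ hl.1, hpiece, ← Set.insert_eq, h] at hP
    exact hP.1.1

end Pieces

end ChordalCount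

namespace ChordalCount

/-! ### The evaporation near its end -/

section Evaporation

variable {V : Type*} {G : SimpleGraph V} {X Y : Set V}

theorem mem_of_reachable {H : SimpleGraph V} {S : Set V} (h : ∀ a ∈ S, ∀ b, H.Adj a b → b ∈ S)
    {a b : V} (ha : a ∈ S) (hab : H.Reachable a b) : b ∈ S := by
  obtain ⟨w⟩ := hab
  induction w with
  | nil => exact ha
  | cons e _ ih => exact ih (h _ ha _ e)

theorem simplicialIn_mono {R R' : Set V} (h : R' ⊆ R) {v : V} (hv : v ∈ R')
    (hs : v ∈ simplicialIn G R) : v ∈ simplicialIn G R' :=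
  ⟨hv, hs.2.subset (Set.inter_subset_inter_right _ h)⟩

theorem mem_alive_succ {i : ℕ} {v : V} (hv : v ∉ X) :
    v ∈ alive G X (i + 1) ↔ v ∈ alive G X i ∧ v ∉ simplicialIn G (alive G X i) := by
  simp [alive, hv]

/-- What is left of a component during the evaporation is connected and has the same neighbors in
the exception set. -/
theorem comp_inter_alive {v : V} (hv : v ∉ Y) (i : ℕ) :
    (∀ a ∈ comp G Y v ∩ alive G Y i, ∀ b ∈ comp G Y v ∩ alive G Y i,
      (restr G (comp G Y v ∩ alive G Y i)).Reachable a b) ∧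
    ((comp G Y v ∩ alive G Y i).Nonempty → ∀ y ∈ nbhd G (comp G Y v),
      ∃ w ∈ comp G Y v ∩ alive G Y i, G.Adj w y) := by
  have hCY : ∀ w ∈ comp G Y v, w ∉ Y := fun w hw => notMem_of_mem_comp hv hw
  induction i with
  | zero =>
    simp only [alive, Set.inter_univ]
    refine ⟨fun a ha b hb => ?_, fun _ y hy => hy.2⟩
    have hab : (restr G Yᶜ).Reachable a b := (SimpleGraph.Reachable.symm ha).trans hb
    refine (mem_of_reachable (S := {x | x ∈ comp G Y v ∧ (restr G (comp G Y v)).Reachable a x})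
      ?_ ⟨ha, SimpleGraph.Reachable.refl _⟩ hab).2
    rintro x ⟨hx, hax⟩ y hxy
    have hy := mem_comp_of_adj hx hxy.1 hxy.2.1 hxy.2.2
    exact ⟨hy, hax.trans
      (SimpleGraph.Adj.reachable (G := restr G (comp G Y v)) ⟨hxy.1, hx, hy⟩)⟩
  | succ i ih =>
    obtain ⟨ih₁, ih₂⟩ := ih
    set D := comp G Y v ∩ alive G Y i with hD
    set D' := comp G Y v ∩ alive G Y (i + 1) with hD'
    have hDD' : D' ⊆ D := fun x hx => ⟨hx.1, alive_succ_subset _ _ _ hx.2⟩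
    have hsimp : ∀ x ∈ D, x ∉ D' → x ∈ simplicialIn G (alive G Y i) := by
      intro x hx hx'
      by_contra hs
      exact hx' ⟨hx.1, (mem_alive_succ (hCY x hx.1)).2 ⟨hx.2, hs⟩⟩
    -- A vertex removed in this step is simplicial, so on a walk it can be bypassed: its surviving
    -- neighbor is adjacent or equal to the next vertex of the walk. The invariant says that each
    -- visited vertex is reachable itself or, if removed, has a reachable surviving neighbor.
    have key : ∀ a ∈ D', ∀ b ∈ D, (b ∈ D' ∧ (restr G D').Reachable a b) ∨
        (b ∉ D' ∧ ∃ u ∈ D', (restr G D').Reachable a u ∧ G.Adj b u) := by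
      intro a ha b hb
      refine mem_of_reachable (H := restr G D) (S := {b | (b ∈ D' ∧ (restr G D').Reachable a b) ∨
        (b ∉ D' ∧ ∃ u ∈ D', (restr G D').Reachable a u ∧ G.Adj b u)}) ?_
        (Or.inl ⟨ha, SimpleGraph.Reachable.refl _⟩) (ih₁ a (hDD' ha) b hb)
      rintro x hx y ⟨hxy, hxD, hyD⟩
      have hstep : ∀ u ∈ D', (restr G D').Reachable a u → G.Adj u y → y ∈ D' →
          (restr G D').Reachable a y := fun u hu hau huy hy =>
        hau.trans (SimpleGraph.Adj.reachable (G := restr G D') ⟨huy, hu, hy⟩)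
      rcases hx with ⟨hxD', hax⟩ | ⟨hxD', u, hu, hau, hxu⟩
      · by_cases hy : y ∈ D'
        · exact Or.inl ⟨hy, hstep x hxD' hax hxy hy⟩
        · exact Or.inr ⟨hy, x, hxD', hax, hxy.symm⟩
      · by_cases huy : u = y
        · subst huy
          exact Or.inl ⟨hu, hau⟩
        have huy' : G.Adj u y := (hsimp x hxD hxD').2 ⟨hxu, (hDD' hu).2⟩ ⟨hxy, hyD.2⟩ huy
        by_cases hy : y ∈ D'
        · exact Or.inl ⟨hy, hstep u hu hau huy' hy⟩
        · exact Or.inr ⟨hy, u, hu, hau, huy'.symm⟩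
    constructor
    · intro a ha b hb
      rcases key a ha b (hDD' hb) with h' | h'
      · exact h'.2
      · exact absurd hb h'.1
    · rintro ⟨a, ha⟩ y hy
      obtain ⟨w, hw, hwy⟩ := ih₂ ⟨a, hDD' ha⟩ y hy
      by_cases hw' : w ∈ D'
      · exact ⟨w, hw', hwy⟩
      · rcases key a ha w hw with h' | ⟨-, u, hu, -, hwu⟩
        · exact absurd h'.1 hw'
        · have hyY := nbhd_comp_subset hv hy
          refine ⟨u, hu, (hsimp w hw hw').2 ⟨hwu, (hDD' hu).2⟩ ⟨hwy, subset_alive _ _ _ hyY⟩ ?_⟩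
          rintro rfl
          exact hCY u hu.1 hyY

/-- The last part of a component that evaporates is a clique and complete to the neighborhood of the
component. -/
theorem last_layer {v : V} (hv : v ∉ Y) {i : ℕ} (hd : ∀ u ∈ comp G Y v, u ∉ alive G Y (i + 1)) :
    G.IsClique (comp G Y v ∩ alive G Y i) ∧
      ∀ w ∈ comp G Y v ∩ alive G Y i, ∀ y ∈ nbhd G (comp G Y v), G.Adj w y := by
  obtain ⟨h₁, h₂⟩ := comp_inter_alive (G := G) hv i
  set D := comp G Y v ∩ alive G Y i with hD
  have hCY : ∀ w ∈ comp G Y v, w ∉ Y := fun w hw => notMem_of_mem_comp hv hw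
  have hsimp : ∀ x ∈ D, x ∈ simplicialIn G (alive G Y i) := by
    intro x hx
    by_contra hs
    exact hd x hx.1 ((mem_alive_succ (hCY x hx.1)).2 ⟨hx.2, hs⟩)
  -- All of `D` is removed in the next step, hence is simplicial, and `D` is connected. So the
  -- closed neighborhood of `a` cannot be left by walking inside `D`.
  have hcl : G.IsClique D := by
    intro a ha b hb hab
    refine (mem_of_reachable (H := restr G D) (S := {b | b = a ∨ G.Adj a b}) ?_
      (Or.inl rfl) (h₁ a ha b hb)).resolve_left hab.symm
    rintro x hx y ⟨hxy, hxD, hyD⟩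
    rcases hx with rfl | hx
    · exact Or.inr hxy
    · by_cases hya : y = a
      · exact Or.inl hya
      · exact Or.inr ((hsimp x hxD).2 ⟨hx.symm, ha.2⟩ ⟨hxy, hyD.2⟩ (Ne.symm hya))
  refine ⟨hcl, fun w hw y hy => ?_⟩
  obtain ⟨u, hu, huy⟩ := h₂ ⟨w, hw⟩ y hy
  by_cases huw : u = w
  · exact huw ▸ huy
  have hyY := nbhd_comp_subset hv hy
  refine (hsimp u hu).2 ⟨hcl hu hw huw, hw.2⟩ ⟨huy, subset_alive _ _ _ hyY⟩ ?_
  rintro rfl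
  exact hCY w hw.1 hyY

/-- A vertex of the base is not simplicial shortly before the end of the evaporation if and only if
it has neighbors in late components of sufficient variety. -/
theorem notMem_simplicialIn_iff (hY : G.IsClique Y) {s : ℕ} (hs : 1 ≤ s) (hd : alive G Y s = Y)
    {u : V} (hu : u ∈ Y) :
    u ∉ simplicialIn G (alive G Y (s - 1)) ↔
      (∃ v ∉ Y, (∃ w ∈ comp G Y v, w ∈ alive G Y (s - 1)) ∧ u ∈ nbhd G (comp G Y v) ∧
        nbhd G (comp G Y v) ≠ Y) ∨
      (∃ v ∉ Y, ∃ v' ∉ Y, comp G Y v ≠ comp G Y v' ∧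
        (∃ w ∈ comp G Y v, w ∈ alive G Y (s - 1)) ∧ u ∈ nbhd G (comp G Y v) ∧
        (∃ w ∈ comp G Y v', w ∈ alive G Y (s - 1)) ∧ u ∈ nbhd G (comp G Y v')) := by
  obtain ⟨i, rfl⟩ : ∃ i, s = i + 1 := ⟨s - 1, by omega⟩
  simp only [Nat.add_sub_cancel]
  have hlast : ∀ v ∉ Y, G.IsClique (comp G Y v ∩ alive G Y i) ∧
      ∀ w ∈ comp G Y v ∩ alive G Y i, ∀ y ∈ nbhd G (comp G Y v), G.Adj w y :=
    fun v hv => last_layer hv fun w hw => by rw [hd]; exact notMem_of_mem_comp hv hw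
  have huR : u ∈ alive G Y i := subset_alive _ _ _ hu
  constructor
  · intro hns
    have : ¬ G.IsClique (G.neighborSet u ∩ alive G Y i) := fun h => hns ⟨huR, h⟩
    simp only [SimpleGraph.IsClique, Set.Pairwise, not_forall] at this
    have hN : ∀ c, c ∉ Y → G.Adj u c → u ∈ nbhd G (comp G Y c) := fun c hc huc =>
      ⟨fun h => notMem_of_mem_comp hc h hu, c, mem_comp_self _ _ _, huc.symm⟩
    -- If the component of `a` sees all of `Y`, then `a` is complete to `Y` and to what is left of
    -- its component, so its non-neighbor `b` lies in another component.
    have main : ∀ a b, G.Adj u a → a ∈ alive G Y i → G.Adj u b → b ∈ alive G Y i → a ≠ b →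
        ¬ G.Adj a b → a ∉ Y → (∃ v ∉ Y, (∃ w ∈ comp G Y v, w ∈ alive G Y i) ∧
          u ∈ nbhd G (comp G Y v) ∧ nbhd G (comp G Y v) ≠ Y) ∨
        (∃ v ∉ Y, ∃ v' ∉ Y, comp G Y v ≠ comp G Y v' ∧
          (∃ w ∈ comp G Y v, w ∈ alive G Y i) ∧ u ∈ nbhd G (comp G Y v) ∧
          (∃ w ∈ comp G Y v', w ∈ alive G Y i) ∧ u ∈ nbhd G (comp G Y v')) := by
      intro a b hua haR hub hbR hab hnab haY
      by_cases hNa : nbhd G (comp G Y a) = Y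
      · right
        have hbY : b ∉ Y := fun hbY =>
          hnab ((hlast a haY).2 a ⟨mem_comp_self _ _ _, haR⟩ b (hNa.symm ▸ hbY))
        refine ⟨a, haY, b, hbY, fun he => hnab ?_, ⟨a, mem_comp_self _ _ _, haR⟩, hN a haY hua,
          ⟨b, mem_comp_self _ _ _, hbR⟩, hN b hbY hub⟩
        exact (hlast a haY).1 ⟨mem_comp_self _ _ _, haR⟩ ⟨he ▸ mem_comp_self _ _ _, hbR⟩ hab
      · exact Or.inl ⟨a, haY, ⟨a, mem_comp_self _ _ _, haR⟩, hN a haY hua, hNa⟩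
    obtain ⟨a, ⟨hua, haR⟩, b, ⟨hub, hbR⟩, hab, hnab⟩ := this
    by_cases haY : a ∈ Y
    · have hbY : b ∉ Y := fun hbY => hnab (hY haY hbY hab)
      exact main b a hub hbR hua haR hab.symm (fun h => hnab h.symm) hbY
    · exact main a b hua haR hub hbR hab hnab haY
  · rintro (⟨v, hv, ⟨w, hw, hwR⟩, hun, hne⟩ | ⟨v, hv, v', hv', hne, ⟨w, hw, hwR⟩, hun,
      ⟨w', hw', hwR'⟩, hun'⟩) hsimp
    -- A surviving vertex `w` of the component and a vertex `y` of `Y` not seen by it are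
    -- non-adjacent neighbors of `u`.
    · obtain ⟨y, hyY, hyn⟩ : ∃ y ∈ Y, y ∉ nbhd G (comp G Y v) := by
        by_contra hcon
        push Not at hcon
        exact hne (Set.Subset.antisymm (nbhd_comp_subset hv) hcon)
      have hwu := (hlast v hv).2 w ⟨hw, hwR⟩ u hun
      have huy : G.Adj u y := hY hu hyY (by rintro rfl; exact hyn hun)
      have hwy : w ≠ y := by rintro rfl; exact notMem_of_mem_comp hv hw hyY
      have := hsimp.2 ⟨hwu.symm, hwR⟩ ⟨huy, subset_alive _ _ _ hyY⟩ hwy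
      exact hyn ⟨fun h => notMem_of_mem_comp hv h hyY, w, hw, this⟩
    · have hwu := (hlast v hv).2 w ⟨hw, hwR⟩ u hun
      have hwu' := (hlast v' hv').2 w' ⟨hw', hwR'⟩ u hun'
      have hdisj : w' ∉ comp G Y v := fun h =>
        hne ((comp_eq_of_mem h).symm.trans (comp_eq_of_mem hw'))
      have := hsimp.2 ⟨hwu.symm, hwR⟩ ⟨hwu'.symm, hwR'⟩ (by rintro rfl; exact hdisj hw)
      exact hdisj (mem_comp_of_adj hw this (notMem_of_mem_comp hv hw)
        (notMem_of_mem_comp hv' hw'))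

/-- The surviving sets decrease and always contain `Y`, so once equal to `Y` they stay equal, and
there is a first such time. -/
theorem evaporatesWithin_iff {t : ℕ} : EvaporatesWithin G Y t ↔ alive G Y t = Y := by
  classical
  constructor
  · rintro ⟨s, hst, hs, -⟩
    exact Set.Subset.antisymm ((alive_antitone G Y hst).trans hs.le) (subset_alive _ _ _)
  · intro h
    have hex : ∃ s, alive G Y s = Y := ⟨t, h⟩
    exact ⟨Nat.find hex, Nat.find_le h, Nat.find_spec hex, fun s hs => Nat.find_min hex hs⟩

theorem alive_eq_iff {t : ℕ} : alive G Y t = Y ↔ ∀ c ∈ prof G Y Yᶜ, c.dead t := by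
  constructor
  · rintro h _ ⟨v, hv, rfl⟩ u hu
    rw [h]
    exact notMem_of_mem_comp hv hu
  · intro h
    refine Set.Subset.antisymm (fun v hv => ?_) (subset_alive _ _ _)
    by_contra hvY
    exact h _ ⟨v, hvY, rfl⟩ v (mem_comp_self _ _ _) hv

/-- A set is dead at time `t`, but not before. -/
abbrev Exactly (t : ℕ) (d : ℕ → Prop) : Prop := d t ∧ ¬ d (t - 1)

/-- If no later layer meets `C`, a vertex of `C` that survives time `t` survives forever, contrary
to `hT`. Thus a statement about layers becomes one about two consecutive surviving sets. -/
theorem setEvaporatesAt_iff {C : Set V} {t T : ℕ} (hT : ∀ u ∈ C, u ∉ alive G X T) :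
    SetEvaporatesAt G X C t ↔ Exactly t fun i => ∀ u ∈ C, u ∉ alive G X i := by
  constructor
  · rintro ⟨⟨u, ⟨hu, -⟩, huC⟩, h⟩
    refine ⟨fun w hw hwt => ?_, fun hd => hd u huC hu⟩
    have : ∀ j, w ∈ alive G X (t + j) := by
      intro j
      induction j with
      | zero => exact hwt
      | succ j ih =>
        by_contra hcon
        have : w ∈ layer G X (t + j + 1) ∩ C := ⟨⟨ih, hcon⟩, hw⟩
        rw [h _ (by omega)] at this
        exact this
    exact hT w hw (alive_antitone G X (Nat.le_add_left T t) (this T))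
  · rintro ⟨h₁, h₂⟩
    push Not at h₂
    obtain ⟨u, hu, hut⟩ := h₂
    refine ⟨⟨u, ⟨hut, h₁ u hu⟩, hu⟩, fun i hi => Set.eq_empty_of_forall_notMem ?_⟩
    rintro w ⟨⟨hw, -⟩, hwC⟩
    exact h₁ w hwC (alive_antitone G X (by omega) hw)

/-- Links the components of the induced subgraph on a subtype with the sets `comp`, which live on
the ambient type. -/
theorem val_image_supp (v : V) (hv : v ∉ Y) :
    Subtype.val '' ((G.induce Yᶜ).connectedComponentMk ⟨v, hv⟩).supp = comp G Y v := by
  ext w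
  constructor
  · rintro ⟨⟨w, hw⟩, hc, rfl⟩
    have hr : (G.induce Yᶜ).Reachable ⟨v, hv⟩ ⟨w, hw⟩ :=
      (SimpleGraph.ConnectedComponent.exact hc).symm
    exact mem_of_reachable (S := {x : (Yᶜ : Set V) | x.val ∈ comp G Y v})
      (fun a ha b hab => mem_comp_of_adj ha hab a.2 b.2) (mem_comp_self G Y v) hr
  · intro hw
    refine comp_subset (S := Subtype.val '' ((G.induce Yᶜ).connectedComponentMk ⟨v, hv⟩).supp)
      ⟨⟨v, hv⟩, rfl, rfl⟩ ?_ hw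
    rintro _ ⟨a, ha, rfl⟩ b hab _ hb
    refine ⟨⟨b, hb⟩, ?_, rfl⟩
    have hadj : (G.induce Yᶜ).Adj a ⟨b, hb⟩ := hab
    exact (SimpleGraph.ConnectedComponent.sound hadj.reachable.symm).trans ha

theorem compsOff_eq : compsOff G Y = comp G Y '' Yᶜ := by
  ext C
  constructor
  · rintro ⟨c, rfl⟩
    obtain ⟨⟨v, hv⟩, rfl⟩ := c.exists_rep
    exact ⟨v, hv, (val_image_supp v hv).symm⟩
  · rintro ⟨v, hv, rfl⟩
    exact ⟨_, (val_image_supp v hv).symm⟩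

theorem connectedOff_iff {S : Set V} :
    ConnectedOff G S ↔ (∃ v, v ∉ S) ∧ ∀ v ∉ S, ∀ w ∉ S, w ∈ comp G S v := by
  rw [ConnectedOff, SimpleGraph.connected_iff]
  constructor
  · rintro ⟨h, ⟨v⟩⟩
    refine ⟨⟨v, v.2⟩, fun a ha b hb => ?_⟩
    rw [← val_image_supp a ha]
    exact ⟨⟨b, hb⟩, SimpleGraph.ConnectedComponent.sound (h _ _), rfl⟩
  · rintro ⟨⟨v, hv⟩, h⟩
    refine ⟨fun a b => ?_, ⟨⟨v, hv⟩⟩⟩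
    have := h a a.2 b b.2
    rw [← val_image_supp a.val a.2] at this
    obtain ⟨c, hc, hcb⟩ := this
    rw [← Subtype.ext hcb]
    exact (SimpleGraph.ConnectedComponent.exact hc).symm

theorem connected_iff_comp_empty :
    G.Connected ↔ (∃ v : V, v ∉ (∅ : Set V)) ∧
      ∀ v ∉ (∅ : Set V), ∀ w ∉ (∅ : Set V), w ∈ comp G ∅ v := by
  have : restr G ∅ᶜ = G := by
    ext a b
    simp [restr_adj]
  simp only [SimpleGraph.connected_iff, comp, this, Set.mem_ofPred_eq, Set.mem_empty_iff_false,
    not_false_eq_true, forall_const]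
  exact ⟨fun h => ⟨h.2.elim fun v => ⟨v, trivial⟩, h.1⟩, fun h => ⟨h.2, h.1.elim fun v _ => ⟨v⟩⟩⟩

/-- Connectedness of `G \ S` for a set `S` that is properly contained in a clique `Y`. -/
theorem comp_connected_iff {S : Set V} (hY : G.IsClique Y) (hS : S ⊆ Y) {y : V} (hy : y ∈ Y)
    (hyS : y ∉ S) :
    ((∃ v, v ∉ S) ∧ ∀ v ∉ S, ∀ w ∉ S, w ∈ comp G S v) ↔
      ∀ v ∉ Y, ¬ nbhd G (comp G Y v) ⊆ S := by
  constructor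
  · rintro ⟨-, h⟩ v hv hsub
    -- A component of `G \ Y` whose neighborhood lies in `S` cannot be left in `G \ S`, so it never
    -- reaches `y`.
    have : comp G S v ⊆ comp G Y v := by
      refine comp_subset (mem_comp_self _ _ _) fun a ha b hab _ hb => ?_
      by_contra hbc
      exact hb (hsub ⟨hbc, a, ha, hab⟩)
    exact notMem_of_mem_comp hv (this (h v (fun hvS => hv (hS hvS)) y hyS)) hy
  · intro h
    have key : ∀ v ∉ S, y ∈ comp G S v := by
      have hYS : ∀ v ∈ Y, v ∉ S → y ∈ comp G S v := by
        intro v hv hvS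
        by_cases hvy : v = y
        · subst hvy; exact mem_comp_self _ _ _
        · exact mem_comp_of_adj (mem_comp_self _ _ _) (hY hv hy hvy) hvS hyS
      intro v hvS
      by_cases hv : v ∈ Y
      · exact hYS v hv hvS
      · obtain ⟨b, ⟨hbn, u, hu, hub⟩, hbS⟩ := Set.not_subset.1 (h v hv)
        have huS : u ∈ comp G S v :=
          SimpleGraph.Reachable.mono (restr_mono G (Set.compl_subset_compl.2 hS)) hu
        have hbY := nbhd_comp_subset hv ⟨hbn, u, hu, hub⟩
        have hb : b ∈ comp G S v := mem_comp_of_adj huS hub (notMem_of_mem_comp hvS huS) hbS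
        rw [← comp_eq_of_mem hb]
        exact hYS b hbY hbS
    refine ⟨⟨y, hyS⟩, fun v hv w hw => ?_⟩
    rw [← comp_eq_of_mem (key v hv), comp_eq_of_mem (key w hw)]
    exact mem_comp_self _ _ _

/-- As long as no vertex of `Y` evaporates, the exception set `X` can be replaced by `Y`. -/
theorem alive_eq_alive (hXY : X ⊆ Y) {s : ℕ} (h : Y ⊆ alive G X s) :
    ∀ i ≤ s, alive G X i = alive G Y i := by
  intro i
  induction i with
  | zero => exact fun _ => rfl
  | succ i ih =>
    intro hi
    have hY : Y ⊆ alive G X (i + 1) := h.trans (alive_antitone G X hi)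
    have hi' := ih (by omega)
    ext v
    by_cases hv : v ∈ Y
    · exact ⟨fun _ => subset_alive _ _ _ hv, fun _ => hY hv⟩
    · rw [mem_alive_succ hv, mem_alive_succ fun hvX => hv (hXY hvX), hi']

/-- A vertex that is simplicial in a larger set remains simplicial in smaller ones that contain it.
So not being simplicial at time `s - 1` excludes removal at every earlier step as well. -/
theorem subset_alive_of_notMem (hXY : X ⊆ Y) {s : ℕ}
    (h : ∀ u ∈ Y, u ∉ X → u ∉ simplicialIn G (alive G Y (s - 1))) : Y ⊆ alive G X s := by
  suffices H : ∀ i ≤ s, Y ⊆ alive G X i from H s le_rfl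
  intro i
  induction i with
  | zero => exact fun _ => Set.subset_univ _
  | succ i ih =>
    intro hi u hu
    have hsub := ih (by omega)
    have he := alive_eq_alive hXY hsub i le_rfl
    by_cases huX : u ∈ X
    · exact subset_alive _ _ _ huX
    · rw [mem_alive_succ huX, he]
      refine ⟨subset_alive _ _ _ hu, fun hs => h u hu huX ?_⟩
      exact simplicialIn_mono (alive_antitone G Y (by omega)) (subset_alive _ _ _ hu) hs

/-- The set `Y \ X` is the last layer. -/
theorem evaporatesAt_layer_iff (hY : G.IsClique Y) (hXY : X ⊆ Y) (hne : (Y \ X).Nonempty) {s : ℕ}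
    (hs : 1 ≤ s) :
    (EvaporatesAt G X (s + 1) ∧ layer G X (s + 1) = Y \ X) ↔
      (alive G Y s = Y ∧ ∀ u ∈ Y, u ∉ X → u ∉ simplicialIn G (alive G Y (s - 1))) := by
  constructor
  · rintro ⟨⟨hX, -⟩, hL⟩
    have hYs : alive G X s = Y := by
      have hL' : alive G X s \ alive G X (s + 1) = Y \ X := hL
      rw [hX] at hL'
      rw [← Set.sdiff_union_of_subset (subset_alive G X s), hL', Set.sdiff_union_of_subset hXY]
    have he := alive_eq_alive hXY hYs.ge
    refine ⟨(he s le_rfl).symm.trans hYs, fun u hu huX hsimp => ?_⟩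
    rw [← he _ (Nat.sub_le _ _)] at hsimp
    obtain ⟨i, rfl⟩ : ∃ i, s = i + 1 := ⟨s - 1, by omega⟩
    have : u ∈ alive G X (i + 1) := hYs.ge hu
    rw [mem_alive_succ huX] at this
    exact this.2 hsimp
  · rintro ⟨hYs, h⟩
    have hsub := subset_alive_of_notMem hXY h
    have he := alive_eq_alive hXY hsub
    have hXs : alive G X s = Y := (he s le_rfl).trans hYs
    -- Once only the clique `Y` is left, all its vertices are simplicial and `Y \ X` disappears in a
    -- single step.
    have hX : alive G X (s + 1) = X := by
      refine Set.Subset.antisymm (fun u hu => ?_) (subset_alive _ _ _)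
      by_contra huX
      rw [mem_alive_succ huX, hXs] at hu
      exact hu.2 ⟨hu.1, hY.subset Set.inter_subset_right⟩
    refine ⟨⟨hX, fun i hi hiX => ?_⟩, ?_⟩
    · obtain ⟨u, huY, huX⟩ := hne
      exact huX (hiX ▸ hsub.trans (alive_antitone G X (by omega)) huY)
    · change alive G X s \ alive G X (s + 1) = Y \ X
      rw [hX, hXs]

end Evaporation

end ChordalCount

namespace ChordalCount

/-! ### Relabeling along embeddings -/

section Transport

variable {V W : Type*} {G : SimpleGraph V} {Y : Set V} (φ : V ↪ W)

theorem map_adj_image {v : V} {w : W} :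
    (G.map φ).Adj (φ v) w ↔ ∃ u, φ u = w ∧ G.Adj v u := by
  rw [SimpleGraph.map_adj]
  constructor
  · rintro ⟨a, b, hab, ha, hb⟩
    exact ⟨b, hb, φ.injective ha ▸ hab⟩
  · rintro ⟨u, hu, hvu⟩
    exact ⟨v, u, hvu, rfl, hu⟩

theorem map_isClique_iff {S : Set V} : (G.map φ).IsClique (φ '' S) ↔ G.IsClique S := by
  constructor
  · intro h a ha b hb hab
    exact SimpleGraph.map_adj_apply.1
      (h (Set.mem_image_of_mem _ ha) (Set.mem_image_of_mem _ hb) (φ.injective.ne hab))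
  · rintro h _ ⟨a, ha, rfl⟩ _ ⟨b, hb, rfl⟩ hab
    exact SimpleGraph.map_adj_apply.2 (h ha hb fun h' => hab (h' ▸ rfl))

/-- Vertices outside the image are isolated after the embedding and have no influence on those
inside. -/
theorem mem_alive_map (i : ℕ) : ∀ v, φ v ∈ alive (G.map φ) (φ '' Y) i ↔ v ∈ alive G Y i := by
  induction i with
  | zero => exact fun v => by simp [alive]
  | succ i ih =>
    intro v
    by_cases hv : v ∈ Y
    · exact ⟨fun _ => subset_alive _ _ _ hv,
        fun _ => subset_alive _ _ _ (Set.mem_image_of_mem _ hv)⟩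
    · rw [mem_alive_succ hv, mem_alive_succ fun h => hv ((φ.injective.mem_set_image).1 h), ih]
      have : (G.map φ).neighborSet (φ v) ∩ alive (G.map φ) (φ '' Y) i =
          φ '' (G.neighborSet v ∩ alive G Y i) := by
        ext w
        constructor
        · rintro ⟨hw, hwa⟩
          obtain ⟨u, rfl, hu⟩ := (map_adj_image φ).1 hw
          exact ⟨u, ⟨hu, (ih u).1 hwa⟩, rfl⟩
        · rintro ⟨u, ⟨hu, hua⟩, rfl⟩
          exact ⟨SimpleGraph.map_adj_apply.2 hu, (ih u).2 hua⟩
      simp only [simplicialIn, Set.mem_ofPred_eq, this, map_isClique_iff, ih]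

theorem comp_map (v : V) : comp (G.map φ) (φ '' Y) (φ v) = φ '' comp G Y v := by
  refine Set.Subset.antisymm ?_ ?_
  · refine comp_subset ⟨v, mem_comp_self _ _ _, rfl⟩ ?_
    rintro _ ⟨a, ha, rfl⟩ b hab haY hbY
    obtain ⟨u, rfl, hu⟩ := (map_adj_image φ).1 hab
    exact ⟨u, mem_comp_of_adj ha hu (fun h => haY ⟨_, h, rfl⟩) fun h => hbY ⟨_, h, rfl⟩, rfl⟩
  · rw [Set.image_subset_iff]
    refine comp_subset (mem_comp_self _ _ _) fun a ha b hab haY hbY => ?_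
    exact mem_comp_of_adj (Set.mem_preimage.1 ha) (SimpleGraph.map_adj_apply.2 hab)
      (fun h => haY (φ.injective.mem_set_image.1 h)) fun h => hbY (φ.injective.mem_set_image.1 h)

theorem nbhd_map (S : Set V) : nbhd (G.map φ) (φ '' S) = φ '' nbhd G S := by
  ext w
  constructor
  · rintro ⟨hw, _, ⟨u, hu, rfl⟩, huw⟩
    obtain ⟨x, rfl, hx⟩ := (map_adj_image φ).1 huw
    exact ⟨x, ⟨fun h => hw ⟨x, h, rfl⟩, u, hu, hx⟩, rfl⟩
  · rintro ⟨x, ⟨hx, u, hu, hux⟩, rfl⟩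
    exact ⟨fun h => hx (φ.injective.mem_set_image.1 h), φ u, ⟨u, hu, rfl⟩,
      SimpleGraph.map_adj_apply.2 hux⟩

/-- The image of a component under an embedding. -/
def Piece.map (c : Piece V) : Piece W := ⟨φ '' c.verts, φ '' c.nbrs, c.dead⟩

theorem Piece.map_injective : Function.Injective (Piece.map φ) := by
  intro c c' h
  obtain ⟨h1, h2, h3⟩ := (Piece.mk.injEq ..).mp h
  exact Piece.ext (φ.injective.image_injective h1) (φ.injective.image_injective h2) h3

theorem piece_map (v : V) : piece (G.map φ) (φ '' Y) (φ v) = (piece G Y v).map φ := by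
  simp only [piece, Piece.map, comp_map, nbhd_map, Set.forall_mem_image, mem_alive_map]

theorem prof_map (K : Set V) :
    prof (G.map φ) (φ '' Y) (φ '' K) = Piece.map φ '' prof G Y K := by
  simp only [prof, Set.image_image, piece_map]

theorem base_map_iff {ω : ℕ} (hω : 1 ≤ ω) {K : Set V} :
    Base ω (G.map φ) (φ '' Y) (φ '' K) ↔ Base ω G Y K := by
  classical
  constructor
  · rintro ⟨h1, h2, h3, h4⟩
    refine ⟨fun a b hab => ?_, (map_isClique_iff φ).1 h2, h3.of_map, ?_⟩
    · have := h1 (φ a) (φ b) (SimpleGraph.map_adj_apply.2 hab)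
      rwa [← Set.image_union, φ.injective.mem_set_image] at this
    · obtain ⟨c⟩ := h4
      exact ⟨SimpleGraph.Coloring.mk (fun v => c (φ v)) fun hab =>
        c.valid (SimpleGraph.map_adj_apply.2 hab)⟩
  · rintro ⟨h1, h2, h3, h4⟩
    refine ⟨?_, (map_isClique_iff φ).2 h2, h3.map φ, ?_⟩
    · intro a b hab
      obtain ⟨u, v, huv, rfl, rfl⟩ := (SimpleGraph.map_adj _ _ _ _).1 hab
      rw [← Set.image_union]
      exact ⟨u, h1 u v huv, rfl⟩
    · obtain ⟨c⟩ := h4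
      -- Vertices outside the image are isolated but still need a color; `0` is available because `1
      -- ≤ ω`.
      refine ⟨SimpleGraph.Coloring.mk
        (fun w => if h : ∃ v, φ v = w then c h.choose else ⟨0, hω⟩) ?_⟩
      intro a b hab
      obtain ⟨u, v, huv, rfl, rfl⟩ := (SimpleGraph.map_adj _ _ _ _).1 hab
      have hex : ∀ x, ∃ v, φ v = φ x := fun x => ⟨x, rfl⟩
      have hch : ∀ x, (hex x).choose = x := fun x => φ.injective (hex x).choose_spec
      simp only [hex, dif_pos, hch]
      exact c.valid huv

/-- All edges of a graph in the family lie inside `Y' ∪ K'`, the image of the embedding on `Y ∪ K`.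
So pulling back inverts pushing forward, and the count depends only on the sets up to relabeling. -/
theorem ncard_fam_transport {ω : ℕ} (hω : 1 ≤ ω) {K : Set V} {Y' K' : Set W}
    (hY : φ '' Y = Y') (hK : φ '' K = K') {P : Set (Piece W) → Prop}
    {P₀ : Set (Piece V) → Prop} (hP : ∀ A, P (Piece.map φ '' A) ↔ P₀ A) :
    (Fam ω Y' K' P).ncard = (Fam ω Y K P₀).ncard := by
  subst hY hK
  rw [← (SimpleGraph.map_injective φ).injOn.ncard_image (s := Fam ω Y K P₀)]
  congr 1
  ext H
  constructor
  · rintro ⟨hB, hH⟩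
    have hmap : (H.comap φ).map φ = H := by
      ext a b
      rw [SimpleGraph.map_adj]
      constructor
      · rintro ⟨u, v, huv, rfl, rfl⟩
        exact huv
      · intro hab
        have ha := hB.within a b hab
        have hb := hB.within b a hab.symm
        rw [← Set.image_union] at ha hb
        obtain ⟨u, -, rfl⟩ := ha
        obtain ⟨v, -, rfl⟩ := hb
        exact ⟨u, v, hab, rfl, rfl⟩
    refine ⟨H.comap φ, ⟨?_, ?_⟩, hmap⟩
    · rwa [← base_map_iff φ hω, hmap]
    · rwa [← hP, ← prof_map, hmap]
  · rintro ⟨G, ⟨hB, hG⟩, rfl⟩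
    refine ⟨(base_map_iff φ hω).2 hB, ?_⟩
    rw [prof_map, hP]
    exact hG

theorem image_block_of_list [DecidableEq V] (l : List V) (hl : l.Nodup) (m : ℕ)
    (hm : l.length = m) : ∃ φ : Fin m ↪ V, ∀ a, φ '' block m 0 a = {v | v ∈ l.take a} := by
  subst hm
  refine ⟨⟨l.get, List.nodup_iff_injective_get.1 hl⟩, fun a => ?_⟩
  ext v
  simp only [block, Function.Embedding.coeFn_mk, Set.mem_image, Set.mem_ofPred_eq, Nat.zero_le,
    true_and, List.mem_take_iff_getElem, List.get_eq_getElem]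
  constructor
  · rintro ⟨i, hi, rfl⟩
    exact ⟨i.val, by have := i.2; omega, rfl⟩
  · rintro ⟨i, hi, rfl⟩
    exact ⟨⟨i, by omega⟩, by simp; omega, rfl⟩

/-- Blocks can be mapped to any chain of sets with the right sizes. -/
theorem exists_block_embedding [DecidableEq V] {Z X Y K : Finset V} (hZX : Z ⊆ X) (hXY : X ⊆ Y)
    (hYK : ∀ v ∈ K, v ∉ Y) {m : ℕ} (hm : Y.card + K.card = m) :
    ∃ φ : Fin m ↪ V, φ '' block m 0 Z.card = Z ∧ φ '' block m 0 X.card = X ∧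
      φ '' block m 0 Y.card = Y ∧ φ '' (block m 0 Y.card)ᶜ = K := by
  -- `Z`, `X \ Z`, `Y \ X` and `K` are listed one after the other, so that `Z`, `X` and `Y` become
  -- prefixes of the list.
  set l₁ := Z.toList with h₁
  set l₂ := (X \ Z).toList with h₂
  set l₃ := (Y \ X).toList with h₃
  set l₄ := K.toList with h₄
  have c₁ : l₁.length = Z.card := by simp [h₁]
  have c₂ : (l₁ ++ l₂).length = X.card := by
    simp only [h₁, h₂, List.length_append, Finset.length_toList]
    have := Finset.card_sdiff_add_card_eq_card hZX
    omega
  have c₃ : (l₁ ++ l₂ ++ l₃).length = Y.card := by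
    rw [List.length_append, c₂]
    simp only [h₃, Finset.length_toList]
    have := Finset.card_sdiff_add_card_eq_card hXY
    omega
  have hnd : (l₁ ++ l₂ ++ l₃ ++ l₄).Nodup := by
    simp only [List.nodup_append', h₁, h₂, h₃, h₄, Finset.nodup_toList, true_and]
    refine ⟨⟨?_, ?_⟩, ?_⟩ <;> intro v <;>
      simp only [List.mem_append, Finset.mem_toList, Finset.mem_sdiff]
    · exact fun h h' => h'.2 h
    · rintro (h | h) h'
      · exact h'.2 (hZX h)
      · exact h'.2 h.1
    · rintro ((h | h) | h) h'
      · exact hYK v h' (hXY (hZX h))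
      · exact hYK v h' (hXY h.1)
      · exact hYK v h' h.1
  obtain ⟨φ, hφ⟩ := image_block_of_list (l₁ ++ l₂ ++ l₃ ++ l₄) hnd m (by
    rw [List.length_append, c₃]; simp [h₄, hm])
  have e₁ : φ '' block m 0 Z.card = Z := by
    rw [hφ, List.append_assoc, List.append_assoc, ← c₁, List.take_left]
    ext v; simp [h₁]
  have e₂ : φ '' block m 0 X.card = X := by
    rw [hφ, List.append_assoc, ← c₂, List.take_left]
    ext v
    simp only [Set.mem_ofPred_eq, List.mem_append, h₁, h₂, Finset.mem_toList, Finset.mem_sdiff,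
      Finset.mem_coe]
    have := @hZX v
    tauto
  have e₃ : φ '' block m 0 Y.card = Y := by
    rw [hφ, ← c₃, List.take_left]
    ext v
    simp only [Set.mem_ofPred_eq, List.mem_append, h₁, h₂, h₃, Finset.mem_toList,
      Finset.mem_sdiff, Finset.mem_coe]
    have := @hZX v
    have := @hXY v
    tauto
  refine ⟨φ, e₁, e₂, e₃, ?_⟩
  have e₄ : φ '' Set.univ = ↑Y ∪ ↑K := by
    have : block m 0 m = Set.univ := by ext v; simp [block]
    rw [← this, hφ, List.take_of_length_le (by rw [List.length_append, c₃]; simp [h₄, hm])]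
    ext v
    simp only [Set.mem_ofPred_eq, List.mem_append, h₁, h₂, h₃, h₄, Finset.mem_toList,
      Finset.mem_sdiff, Set.mem_union, Finset.mem_coe]
    have := @hZX v
    have := @hXY v
    tauto
  rw [Set.compl_eq_univ_sdiff, Set.image_sdiff φ.injective, e₄, e₃]
  ext v
  simp only [Set.mem_sdiff, Set.mem_union, Finset.mem_coe]
  have := hYK v
  tauto

end Transport

end ChordalCount

namespace ChordalCount

/-! ### Admissibility, layers and connectedness as conditions on pieces -/

section Predicates

variable {V : Type*}

/-- All components have a neighborhood in `R` and evaporate as specified by `E`. -/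
abbrev AllPieces (R : Set V → Prop) (E : (ℕ → Prop) → Prop) (A : Set (Piece V)) : Prop :=
  ∀ c ∈ A, R c.nbrs ∧ E c.dead

/-- Every vertex of `L` has a neighbor in some component. -/
abbrev Covers (L : Set V) (A : Set (Piece V)) : Prop := ∀ u ∈ L, ∃ c ∈ A, u ∈ c.nbrs

/-- A component is alive at time `s - 1`. -/
abbrev Piece.Late (s : ℕ) (c : Piece V) : Prop := ¬ c.dead (s - 1)

/-- No vertex of `L` is simplicial at time `s - 1`, see `notMem_simplicialIn_iff`. -/
abbrev LateCovers (Y L : Set V) (s : ℕ) (A : Set (Piece V)) : Prop :=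
  (∀ u ∈ L, ∃ c ∈ A, c.Late s ∧ u ∈ c.nbrs ∧ c.nbrs ≠ Y) ∨
    ∃ c ∈ A, ∃ c' ∈ A, c ≠ c' ∧ (c.Late s ∧ c.nbrs = Y) ∧ c'.Late s ∧ c'.nbrs = Y

variable {G : SimpleGraph V} {X Y Z : Set V} {ω : ℕ}

/-- For a nonempty clique `Y`, connectedness of the graph just says that no component of `G \ Y` has
an empty neighborhood. -/
theorem admissible_iff (hY : G.IsClique Y) {y : V} (hyY : y ∈ Y) :
    Admissible ω G ↔ Base ω G Y Yᶜ ∧ ∀ v ∉ Y, ¬ nbhd G (comp G Y v) ⊆ ∅ := by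
  rw [← comp_connected_iff hY (Set.empty_subset Y) hyY (Set.notMem_empty y),
    ← connected_iff_comp_empty]
  exact ⟨fun h => ⟨⟨fun a _ _ => by simp, hY, h.chordal, h.colorable⟩, h.connected⟩,
    fun h => ⟨h.1.colorable, h.2, h.1.chordal⟩⟩

theorem forall_compsOff {Q : Set V → Prop} :
    (∀ C ∈ compsOff G Y, Q C) ↔ ∀ v ∉ Y, Q (comp G Y v) := by
  rw [compsOff_eq, Set.forall_mem_image]
  rfl

theorem forall_prof {K : Set V} {Q : Piece V → Prop} :
    (∀ c ∈ prof G Y K, Q c) ↔ ∀ v ∈ K, Q (piece G Y v) := Set.forall_mem_image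

theorem exists_prof {K : Set V} {Q : Piece V → Prop} :
    (∃ c ∈ prof G Y K, Q c) ↔ ∃ v ∈ K, Q (piece G Y v) := Set.exists_mem_image

theorem piece_ne_iff {v w : V} : piece G Y v ≠ piece G Y w ↔ comp G Y v ≠ comp G Y w := by
  refine not_congr ⟨fun h => congrArg Piece.verts h, fun h => ?_⟩
  simp only [piece, h]

theorem setEvaporatesAt_comp_iff {t T : ℕ} (h : alive G Y T = Y) {v : V} (hv : v ∉ Y) :
    SetEvaporatesAt G Y (comp G Y v) t ↔ Exactly t (piece G Y v).dead :=
  setEvaporatesAt_iff (T := T) fun _ hu => h.symm ▸ notMem_of_mem_comp hv hu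

/-- A neighborhood that is not inside `Z` is in particular nonempty, so connectedness comes for free
from the condition on the pieces. -/
theorem mem_base_iff {y : V} (hy : y ∈ Y) {t : ℕ} :
    (Admissible ω G ∧ G.IsClique Y ∧ EvaporatesWithin G Y t ∧
      ∀ C ∈ compsOff G Y, (nbhd G C ∩ (Y \ Z)).Nonempty) ↔
    G ∈ Fam ω Y Yᶜ (AllPieces (fun N => ¬ N ⊆ Z) (· t)) := by
  have hN : (∀ C ∈ compsOff G Y, (nbhd G C ∩ (Y \ Z)).Nonempty) ↔
      ∀ v ∉ Y, ¬ nbhd G (comp G Y v) ⊆ Z := by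
    rw [forall_compsOff]
    refine forall₂_congr fun v hv => ?_
    rw [Set.not_subset]
    exact ⟨fun ⟨u, hu, hu'⟩ => ⟨u, hu, hu'.2⟩,
      fun ⟨u, hu, hu'⟩ => ⟨u, hu, nbhd_comp_subset hv hu, hu'⟩⟩
  rw [hN, evaporatesWithin_iff, alive_eq_iff]
  constructor
  · rintro ⟨h1, h2, h3, h4⟩
    exact ⟨((admissible_iff h2 hy).1 h1).1, forall_prof.2 fun v hv => ⟨h4 v hv,
      forall_prof.1 h3 v hv⟩⟩
  · rintro ⟨h1, h2⟩
    rw [AllPieces, forall_prof] at h2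
    refine ⟨(admissible_iff h1.clique hy).2 ⟨h1, fun v hv hs => ?_⟩, h1.clique,
      forall_prof.2 fun v hv => (h2 v hv).2, fun v hv => (h2 v hv).1⟩
    exact (h2 v hv).1 (hs.trans (Set.empty_subset _))

theorem mem_full_iff {y : V} (hy : y ∈ Y) {t : ℕ} :
    (Admissible ω G ∧ G.IsClique Y ∧ EvaporatesWithin G Y t ∧
      ∀ C ∈ compsOff G Y, SetEvaporatesAt G Y C t ∧ SeesAll G C Y) ↔
    G ∈ Fam ω Y Yᶜ (AllPieces (fun N => N = Y) (Exactly t)) := by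
  rw [evaporatesWithin_iff]
  constructor
  · rintro ⟨h1, h2, h3, h4⟩
    rw [forall_compsOff] at h4
    refine ⟨((admissible_iff h2 hy).1 h1).1, forall_prof.2 fun v hv => ⟨?_, ?_⟩⟩
    · exact Set.Subset.antisymm (nbhd_comp_subset hv) (h4 v hv).2
    · exact (setEvaporatesAt_comp_iff h3 hv).1 (h4 v hv).1
  · rintro ⟨h1, h2⟩
    rw [AllPieces, forall_prof] at h2
    have h3 : alive G Y t = Y := alive_eq_iff.2 (forall_prof.2 fun v hv => (h2 v hv).2.1)
    refine ⟨(admissible_iff h1.clique hy).2 ⟨h1, fun v hv hs => ?_⟩, h1.clique, h3, ?_⟩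
    · exact hs ((h2 v hv).1.ge hy)
    · rw [forall_compsOff]
      exact fun v hv => ⟨(setEvaporatesAt_comp_iff h3 hv).2 (h2 v hv).2, (h2 v hv).1.ge⟩

theorem compsOff_eq_verts : compsOff G Y = Piece.verts '' prof G Y Yᶜ := by
  rw [compsOff_eq, prof, Set.image_image]
  rfl

theorem prof_verts_injOn : Set.InjOn Piece.verts (prof G Y Yᶜ) := by
  rintro _ ⟨v, -, rfl⟩ _ ⟨w, -, rfl⟩ h
  by_contra hne
  exact piece_ne_iff.1 hne h

/-- Here `Y` may be empty, as needed for `g̃_1(t, 0, n)`. In that case connectedness holds because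
the only piece has all vertices. -/
theorem mem_single_iff {t : ℕ} :
    ((Admissible ω G ∧ G.IsClique Y ∧ EvaporatesWithin G Y t ∧
      ∀ C ∈ compsOff G Y, SetEvaporatesAt G Y C t ∧ SeesAll G C Y) ∧ (compsOff G Y).ncard = 1) ↔
    G ∈ Fam ω Y Yᶜ (Single Yᶜ Y (Exactly t)) := by
  rw [evaporatesWithin_iff, forall_compsOff]
  constructor
  · rintro ⟨⟨h1, h2, h3, h4⟩, h5⟩
    rw [compsOff_eq_verts, prof_verts_injOn.ncard_image] at h5
    obtain ⟨c, hc⟩ := Set.ncard_eq_one.1 h5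
    have hpc : ∀ v ∉ Y, piece G Y v = c := by
      intro v hv
      have : piece G Y v ∈ prof G Y Yᶜ := ⟨v, hv, rfl⟩
      rwa [hc] at this
    obtain ⟨v, hv, hvc⟩ : c ∈ prof G Y Yᶜ := hc ▸ rfl
    refine ⟨⟨fun a _ _ => by simp, h2, h1.chordal, h1.colorable⟩, c.dead, ?_, ?_⟩
    · rw [hc, ← hvc]
      congr 1
      refine Piece.ext ?_ ?_ rfl
      · refine Set.Subset.antisymm (fun w hw => notMem_of_mem_comp hv hw) fun w hw => ?_
        rw [hvc, ← hpc w hw]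
        exact mem_comp_self _ _ _
      · exact Set.Subset.antisymm (nbhd_comp_subset hv) (h4 v hv).2
    · rw [← hvc]
      exact (setEvaporatesAt_comp_iff h3 hv).1 (h4 v hv).1
  · rintro ⟨h1, d, hd, hE⟩
    have hpc : ∀ v ∉ Y, piece G Y v = ⟨Yᶜ, Y, d⟩ := by
      intro v hv
      have : piece G Y v ∈ prof G Y Yᶜ := ⟨v, hv, rfl⟩
      rwa [hd] at this
    have h3 : alive G Y t = Y := alive_eq_iff.2 (by rw [hd]; rintro _ rfl; exact hE.1)
    have hnb : ∀ v ∉ Y, nbhd G (comp G Y v) = Y := fun v hv => congrArg Piece.nbrs (hpc v hv)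
    refine ⟨⟨⟨h1.colorable, ?_, h1.chordal⟩, h1.clique, h3, fun v hv => ⟨?_, (hnb v hv).ge⟩⟩, ?_⟩
    · rw [connected_iff_comp_empty]
      obtain ⟨v, hv, hvc⟩ : (⟨Yᶜ, Y, d⟩ : Piece V) ∈ prof G Y Yᶜ := hd ▸ rfl
      rcases Y.eq_empty_or_nonempty with rfl | ⟨y, hy⟩
      · refine ⟨⟨v, hv⟩, fun v hv w hw => ?_⟩
        have : comp G ∅ v = ∅ᶜ := congrArg Piece.verts (hpc v hv)
        rw [this]
        exact hw
      · refine (comp_connected_iff h1.clique (Set.empty_subset Y) hy (Set.notMem_empty y)).2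
          fun v hv hs => ?_
        rw [hnb v hv] at hs
        exact hs hy
    · rw [setEvaporatesAt_comp_iff h3 hv, hpc v hv]
      exact hE
    · rw [compsOff_eq_verts, hd, Set.image_singleton, Set.ncard_singleton]

/-- Two late components that see all of `Y` serve every vertex of `L` at once. If there are no such
two, then of two late components at a vertex at least one misses part of `Y`. -/
theorem lateCovers_iff (hY : G.IsClique Y) {s : ℕ} (hs : 1 ≤ s) (hd : alive G Y s = Y)
    {L : Set V} (hL : L ⊆ Y) :
    (∀ u ∈ L, u ∉ simplicialIn G (alive G Y (s - 1))) ↔ LateCovers Y L s (prof G Y Yᶜ) := by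
  have hlate : ∀ v, (piece G Y v).Late s ↔ ∃ w ∈ comp G Y v, w ∈ alive G Y (s - 1) := by
    intro v
    simp [Piece.Late, piece]
  have hlate' : ∀ v, (∃ w ∈ comp G Y v, w ∈ alive G Y (s - 1)) → (piece G Y v).Late s :=
    fun v => (hlate v).2
  constructor
  · intro h
    by_cases htwo : ∃ c ∈ prof G Y Yᶜ, ∃ c' ∈ prof G Y Yᶜ, c ≠ c' ∧
        (c.Late s ∧ c.nbrs = Y) ∧ c'.Late s ∧ c'.nbrs = Y
    · exact Or.inr htwo
    refine Or.inl fun u hu => ?_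
    rw [exists_prof]
    rcases (notMem_simplicialIn_iff hY hs hd (hL hu)).1 (h u hu) with ⟨v, hv, h1, h2, h3⟩ |
      ⟨v, hv, v', hv', hne, h1, h2, h1', h2'⟩
    · exact ⟨v, hv, hlate' v h1, h2, h3⟩
    · by_cases e : nbhd G (comp G Y v) = Y
      · by_cases e' : nbhd G (comp G Y v') = Y
        · exact absurd ⟨_, ⟨v, hv, rfl⟩, _, ⟨v', hv', rfl⟩, piece_ne_iff.2 hne,
            ⟨hlate' v h1, e⟩, hlate' v' h1', e'⟩ htwo
        · exact ⟨v', hv', hlate' v' h1', h2', e'⟩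
      · exact ⟨v, hv, hlate' v h1, h2, e⟩
  · rintro (h | ⟨_, ⟨v, hv, rfl⟩, _, ⟨v', hv', rfl⟩, hne, ⟨h1, h2⟩, h1', h2'⟩) u hu
    · obtain ⟨_, ⟨v, hv, rfl⟩, h1, h2, h3⟩ := h u hu
      exact (notMem_simplicialIn_iff hY hs hd (hL hu)).2 (Or.inl ⟨v, hv, (hlate v).1 h1, h2, h3⟩)
    · refine (notMem_simplicialIn_iff hY hs hd (hL hu)).2 (Or.inr ⟨v, hv, v', hv',
        piece_ne_iff.1 hne, (hlate v).1 h1, ?_, (hlate v').1 h1', ?_⟩)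
      · exact h2.ge (hL hu)
      · exact h2'.ge (hL hu)

/-- Exchanges the exception set `X` for the larger clique `Y`, which costs the one extra step in
which `Y \ X` evaporates. Afterwards all conditions concern the pieces relative to `Y`. -/
theorem core_iff (hXY : X ⊆ Y) (hZX : Z ⊆ X) {y : V} (hy : y ∈ Y) (hyX : y ∉ X) {s : ℕ}
    (hs : 1 ≤ s) :
    ((Admissible ω G ∧ EvaporatesAt G X (s + 1) ∧ layer G X (s + 1) = Y \ X ∧ G.IsClique Y) ∧
      ConnectedOff G Z) ↔
    G ∈ Fam ω Y Yᶜ fun A => AllPieces (fun N => ¬ N ⊆ Z) (· s) A ∧ LateCovers Y (Y \ X) s A := by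
  have hne : (Y \ X).Nonempty := ⟨y, hy, hyX⟩
  have hZY := hZX.trans hXY
  have hyZ : y ∉ Z := fun h => hyX (hZX h)
  constructor
  · rintro ⟨⟨h1, h2, h3, h4⟩, h5⟩
    obtain ⟨e1, e2⟩ := (evaporatesAt_layer_iff h4 hXY hne hs).1 ⟨h2, h3⟩
    rw [connectedOff_iff, comp_connected_iff h4 hZY hy hyZ] at h5
    exact ⟨((admissible_iff h4 hy).1 h1).1, forall_prof.2 fun v hv => ⟨h5 v hv,
      forall_prof.1 (alive_eq_iff.1 e1) v hv⟩, (lateCovers_iff h4 hs e1 Set.sdiff_subset).1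
      fun u hu => e2 u hu.1 hu.2⟩
  · rintro ⟨h1, h2, h3⟩
    have e1 : alive G Y s = Y := alive_eq_iff.2 fun c hc => (h2 c hc).2
    have e2 := (lateCovers_iff h1.clique hs e1 Set.sdiff_subset).2 h3
    obtain ⟨e3, e4⟩ := (evaporatesAt_layer_iff h1.clique hXY hne hs).2
      ⟨e1, fun u hu huX => e2 u ⟨hu, huX⟩⟩
    have h4 : ∀ v ∉ Y, ¬ nbhd G (comp G Y v) ⊆ Z := fun v hv => (forall_prof.1 h2 v hv).1
    refine ⟨⟨(admissible_iff h1.clique hy).2 ⟨h1, fun v hv hs => ?_⟩, e3, e4, h1.clique⟩, ?_⟩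
    · exact h4 v hv (hs.trans (Set.empty_subset _))
    · rw [connectedOff_iff, comp_connected_iff h1.clique hZY hy hyZ]
      exact h4

/-- The evaporations with exception sets `X` and `Y` coincide up to time `s`, so the time of a
component of `G \ Y` may be read off from either. -/
theorem core_setEvaporatesAt_iff (hXY : X ⊆ Y) (hY : G.IsClique Y) (hne : (Y \ X).Nonempty)
    {s : ℕ} (hs : 1 ≤ s) (h : EvaporatesAt G X (s + 1) ∧ layer G X (s + 1) = Y \ X) {v : V}
    (hv : v ∉ Y) :
    SetEvaporatesAt G X (comp G Y v) s ↔ Exactly s (piece G Y v).dead := by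
  obtain ⟨e1, e2⟩ := (evaporatesAt_layer_iff hY hXY hne hs).1 h
  have he := alive_eq_alive hXY (subset_alive_of_notMem hXY e2)
  rw [setEvaporatesAt_iff (T := s + 1)]
  · rw [Exactly, Exactly, he s le_rfl, he (s - 1) (Nat.sub_le _ _)]
    rfl
  · intro u hu huX
    rw [h.1.1] at huX
    exact notMem_of_mem_comp hv hu (hXY huX)

end Predicates

/-! ### The counted sets of graphs as families with conditions on pieces -/

section Frozen

variable {ω t x l k z : ℕ}

theorem block_mono {m a b : ℕ} (h : a ≤ b) : block m 0 a ⊆ block m 0 b :=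
  fun _ hv => ⟨hv.1, hv.2.trans_le h⟩

theorem block_sdiff {m a b : ℕ} : block m 0 b \ block m 0 a = block m a b := by
  ext v
  simp only [block, Set.mem_sdiff, Set.mem_ofPred_eq]
  omega

theorem exists_mem_block {m a b : ℕ} (h : a < b) (hb : b ≤ m) :
    ∃ v : Fin m, v ∈ block m 0 b ∧ v ∉ block m 0 a :=
  ⟨⟨a, by omega⟩, ⟨Nat.zero_le _, h⟩, fun h' => lt_irrefl _ h'.2⟩

theorem gSet_eq (hz : z < x) : gSet ω t x k z =
    Fam ω (block (x + k) 0 x) (block (x + k) 0 x)ᶜ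
      (AllPieces (fun N => ¬ N ⊆ block (x + k) 0 z) (· t)) := by
  obtain ⟨y, hy, -⟩ := exists_mem_block hz (Nat.le_add_right x k)
  ext G
  exact mem_base_iff hy

theorem gTildeSet_eq (hz : z < x) : gTildeSet ω t x k z =
    Fam ω (block (x + k) 0 x) (block (x + k) 0 x)ᶜ
      (AllPieces (fun N => ¬ N ⊆ block (x + k) 0 z) (Exactly t)) := by
  ext G
  rw [gTildeSet, gSet_eq hz, Set.mem_ofPred_eq, forall_compsOff]
  constructor
  · rintro ⟨⟨h1, h2⟩, h3⟩
    have e : alive G _ t = _ := alive_eq_iff.2 fun c hc => (h2 c hc).2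
    exact ⟨h1, forall_prof.2 fun v hv => ⟨(forall_prof.1 h2 v hv).1,
      (setEvaporatesAt_comp_iff e hv).1 (h3 v hv)⟩⟩
  · rintro ⟨h1, h2⟩
    have e : alive G _ t = _ := alive_eq_iff.2 fun c hc => (h2 c hc).2.1
    exact ⟨⟨h1, fun c hc => ⟨(h2 c hc).1, (h2 c hc).2.1⟩⟩, fun v hv =>
      (setEvaporatesAt_comp_iff e hv).2 (forall_prof.1 h2 v hv).2⟩

theorem gTildePSet_eq (hz : z < x) : gTildePSet ω t x k z =
    Fam ω (block (x + k) 0 x) (block (x + k) 0 x)ᶜ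
      (AllPieces (fun N => ¬ N ⊆ block (x + k) 0 z ∧ N ≠ block (x + k) 0 x) (Exactly t)) := by
  ext G
  rw [gTildePSet, gTildeSet_eq hz, Set.mem_ofPred_eq, forall_compsOff]
  constructor
  · rintro ⟨⟨h1, h2⟩, h3⟩
    exact ⟨h1, forall_prof.2 fun v hv => ⟨⟨(forall_prof.1 h2 v hv).1, fun h => h3 v hv h.ge⟩,
      (forall_prof.1 h2 v hv).2⟩⟩
  · rintro ⟨h1, h2⟩
    exact ⟨⟨h1, fun c hc => ⟨(h2 c hc).1.1, (h2 c hc).2⟩⟩, fun v hv h =>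
      (forall_prof.1 h2 v hv).1.2 (Set.Subset.antisymm (nbhd_comp_subset hv) h)⟩

theorem gTildeOneSet_eq : gTildeOneSet ω t x k =
    Fam ω (block (x + k) 0 x) (block (x + k) 0 x)ᶜ
      (Single (block (x + k) 0 x)ᶜ (block (x + k) 0 x) (Exactly t)) := by
  ext G
  exact mem_single_iff

theorem gTildeTwoSet_eq (hx : 1 ≤ x) : gTildeTwoSet ω t x k =
    Fam ω (block (x + k) 0 x) (block (x + k) 0 x)ᶜ fun A =>
      AllPieces (fun N => N = block (x + k) 0 x) (Exactly t) A ∧ A.Nontrivial := by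
  obtain ⟨y, hy, -⟩ := exists_mem_block (a := 0) hx (Nat.le_add_right x k)
  ext G
  have h2 : 2 ≤ (compsOff G (block (x + k) 0 x)).ncard ↔
      (prof G (block (x + k) 0 x) (block (x + k) 0 x)ᶜ).Nontrivial := by
    have : Finite (prof G (block (x + k) 0 x) (block (x + k) 0 x)ᶜ) :=
      ((Set.toFinite _).image _).to_subtype
    rw [compsOff_eq_verts, prof_verts_injOn.ncard_image]
    exact Set.one_lt_ncard_iff_nontrivial
  exact (and_congr (mem_full_iff hy) h2).trans and_assoc

theorem fSet_eq (ht : 2 ≤ t) (hl : 1 ≤ l) : fSet ω t x l k =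
    Fam ω (block (x + l + k) 0 (x + l)) (block (x + l + k) 0 (x + l))ᶜ fun A =>
      AllPieces (fun N => ¬ N ⊆ block (x + l + k) 0 x) (· (t - 1)) A ∧
      LateCovers (block (x + l + k) 0 (x + l)) (block (x + l + k) x (x + l)) (t - 1) A := by
  obtain ⟨y, hy, hyX⟩ := exists_mem_block (show x < x + l by omega) (Nat.le_add_right (x + l) k)
  ext G
  have := core_iff (G := G) (ω := ω) (block_mono (m := x + l + k) (Nat.le_add_right x l)) subset_rfl
    hy hyX (s := t - 1) (by omega)
  rwa [block_sdiff, show t - 1 + 1 = t by omega] at this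

/-- The required existence of a component is absorbed by `LateCovers`: the last layer is nonempty,
and each alternative provides a piece. -/
theorem fTildeSet_eq (ht : 2 ≤ t) (hl : 1 ≤ l) : fTildeSet ω t x l k =
    Fam ω (block (x + l + k) 0 (x + l)) (block (x + l + k) 0 (x + l))ᶜ fun A =>
      AllPieces (fun N => ¬ N ⊆ block (x + l + k) 0 x) (Exactly (t - 1)) A ∧
      LateCovers (block (x + l + k) 0 (x + l)) (block (x + l + k) x (x + l)) (t - 1) A := by
  have hXY := block_mono (m := x + l + k) (Nat.le_add_right x l)
  obtain ⟨y, hy, hyX⟩ := exists_mem_block (show x < x + l by omega) (Nat.le_add_right (x + l) k)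
  ext G
  have key : G ∈ fSet ω t x l k → ∀ v ∉ block (x + l + k) 0 (x + l),
      (SetEvaporatesAt G (block (x + l + k) 0 x) (comp G (block (x + l + k) 0 (x + l)) v) (t - 1) ↔
      Exactly (t - 1) (piece G (block (x + l + k) 0 (x + l)) v).dead) := by
    rintro ⟨⟨-, h2, h3, h4⟩, -⟩ v hv
    refine core_setEvaporatesAt_iff hXY h4 ⟨y, hy, hyX⟩ (by omega) ?_ hv
    rw [show t - 1 + 1 = t by omega, block_sdiff]
    exact ⟨h2, h3⟩
  constructor
  · rintro ⟨h1, -, h2⟩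
    rw [forall_compsOff] at h2
    have h1' := fSet_eq ht hl ▸ h1
    exact ⟨h1'.1, forall_prof.2 fun v hv => ⟨(forall_prof.1 h1'.2.1 v hv).1,
      (key h1 v hv).1 (h2 v hv)⟩, h1'.2.2⟩
  · rintro ⟨h1, h2, h3⟩
    have h4 : G ∈ fSet ω t x l k := by
      rw [fSet_eq ht hl]
      exact ⟨h1, fun c hc => ⟨(h2 c hc).1, (h2 c hc).2.1⟩, h3⟩
    refine ⟨h4, ?_, forall_compsOff.2 fun v hv => (key h4 v hv).2 (forall_prof.1 h2 v hv).2⟩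
    rw [compsOff_eq_verts]
    rcases h3 with h3 | ⟨c, hc, -⟩
    · obtain ⟨c, hc, -⟩ := h3 y (block_sdiff ▸ ⟨hy, hyX⟩)
      exact ⟨_, c, hc, rfl⟩
    · exact ⟨_, c, hc, rfl⟩

/-- No piece sees all of the base and all pieces are late, so the second alternative of `LateCovers`
is void and the first reduces to `Covers`. -/
theorem fTildePZSet_eq (ht : 2 ≤ t) (hl : 1 ≤ l) (hz : z ≤ x) : fTildePZSet ω t x l k z =
    Fam ω (block (x + l + k) 0 (x + l)) (block (x + l + k) 0 (x + l))ᶜ fun A =>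
      AllPieces (fun N => ¬ N ⊆ block (x + l + k) 0 z ∧ N ≠ block (x + l + k) 0 (x + l))
        (Exactly (t - 1)) A ∧ Covers (block (x + l + k) x (x + l)) A := by
  have hXY := block_mono (m := x + l + k) (Nat.le_add_right x l)
  obtain ⟨y, hy, hyX⟩ := exists_mem_block (show x < x + l by omega) (Nat.le_add_right (x + l) k)
  ext G
  have hcore := core_iff (G := G) (ω := ω) hXY (block_mono hz) hy hyX (s := t - 1) (by omega)
  rw [block_sdiff, show t - 1 + 1 = t by omega] at hcore
  have key : G ∈ fCoreSet ω t x l k → ∀ v ∉ block (x + l + k) 0 (x + l),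
      (SetEvaporatesAt G (block (x + l + k) 0 x) (comp G (block (x + l + k) 0 (x + l)) v) (t - 1) ↔
      Exactly (t - 1) (piece G (block (x + l + k) 0 (x + l)) v).dead) := by
    rintro ⟨-, h2, h3, h4⟩ v hv
    refine core_setEvaporatesAt_iff hXY h4 ⟨y, hy, hyX⟩ (by omega) ?_ hv
    rw [show t - 1 + 1 = t by omega, block_sdiff]
    exact ⟨h2, h3⟩
  constructor
  · rintro ⟨h1, h2, ⟨-, h3⟩, h4⟩
    rw [forall_compsOff] at h3
    rw [ProperComps, forall_compsOff] at h4
    obtain ⟨hB, hA, hL⟩ := hcore.1 ⟨h1, h2⟩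
    have hne : ∀ v ∉ block (x + l + k) 0 (x + l),
        (piece G (block (x + l + k) 0 (x + l)) v).nbrs ≠ block (x + l + k) 0 (x + l) :=
      fun v hv h => h4 v hv h.ge
    refine ⟨hB, forall_prof.2 fun v hv => ⟨⟨(forall_prof.1 hA v hv).1, hne v hv⟩,
      (key h1 v hv).1 (h3 v hv)⟩, ?_⟩
    rcases hL with hL | ⟨_, ⟨v, hv, rfl⟩, _, _, -, ⟨-, h⟩, -⟩
    · intro u hu
      obtain ⟨c, hc, -, h, -⟩ := hL u hu
      exact ⟨c, hc, h⟩
    · exact absurd h (hne v hv)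
  · rintro ⟨h1, h2, h3⟩
    obtain ⟨h4, h5⟩ := hcore.2 ⟨h1, fun c hc => ⟨(h2 c hc).1.1, (h2 c hc).2.1⟩, Or.inl fun u hu => by
      obtain ⟨c, hc, huc⟩ := h3 u hu
      exact ⟨c, hc, (h2 c hc).2.2, huc, (h2 c hc).1.2⟩⟩
    refine ⟨h4, h5, ⟨?_, forall_compsOff.2 fun v hv => (key h4 v hv).2 (forall_prof.1 h2 v hv).2⟩,
      forall_compsOff.2 fun v hv h => (forall_prof.1 h2 v hv).1.2
        (Set.Subset.antisymm (nbhd_comp_subset hv) h)⟩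
    obtain ⟨c, hc, -⟩ := h3 y (block_sdiff ▸ ⟨hy, hyX⟩)
    rw [compsOff_eq_verts]
    exact ⟨_, c, hc, rfl⟩

theorem fTildePSet_eq : fTildePSet ω t x l k = fTildePZSet ω t x l k x := by
  ext G
  simp only [fTildePSet, fTildeSet, fSet, fTildePZSet, Set.mem_ofPred_eq, and_assoc]

end Frozen

end ChordalCount

namespace ChordalCount

/-! ### Sums over subsets as sums over cardinalities -/

section Sums

variable {α : Type*}

theorem sum_powerset_card (K : Finset α) (F : ℕ → ℕ) :
    ∑ W ∈ K.powerset, F W.card = ∑ i ∈ Finset.Icc 0 K.card, K.card.choose i * F i := by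
  rw [Finset.sum_powerset_apply_card, ← Nat.range_succ_eq_Icc_zero]
  simp only [smul_eq_mul]

variable [DecidableEq α]

/-- Removing `v` gives a bijection with the subsets of `K.erase v`, hence the shifted binomial
coefficients. -/
theorem sum_powerset_mem_card {K : Finset α} {v : α} (hv : v ∈ K) (F : ℕ → ℕ) :
    ∑ W ∈ K.powerset with v ∈ W, F W.card =
      ∑ i ∈ Finset.Icc 1 K.card, (K.card - 1).choose (i - 1) * F i := by
  have h1 : ∑ W ∈ K.powerset with v ∈ W, F W.card =
      ∑ W ∈ (K.erase v).powerset, F (W.card + 1) := by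
    refine Finset.sum_nbij' (fun W => W.erase v) (fun W => insert v W) ?_ ?_ ?_ ?_ ?_
    · intro W hW
      simp only [Finset.mem_filter, Finset.mem_powerset] at hW ⊢
      exact Finset.erase_subset_erase v hW.1
    · intro W hW
      simp only [Finset.mem_filter, Finset.mem_powerset] at hW ⊢
      exact ⟨Finset.insert_subset hv (hW.trans (Finset.erase_subset _ _)),
        Finset.mem_insert_self _ _⟩
    · intro W hW
      exact Finset.insert_erase (Finset.mem_filter.1 hW).2
    · intro W hW
      exact Finset.erase_insert fun h => Finset.notMem_erase v K (Finset.mem_powerset.1 hW h)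
    · intro W hW
      rw [Finset.card_erase_add_one (Finset.mem_filter.1 hW).2]
  have hc := Finset.card_erase_add_one hv
  rw [h1, sum_powerset_card (K.erase v) fun i => F (i + 1), ← hc]
  refine Finset.sum_nbij' (· + 1) (· - 1) ?_ ?_ ?_ ?_ ?_ <;> intro i hi <;>
    simp only [Finset.mem_Icc, Nat.add_sub_cancel] at hi ⊢ <;> omega

theorem sum_powerset_not_subset {Y Z : Finset α} (hZ : Z ⊆ Y) (F : ℕ → ℕ) :
    ∑ N ∈ Y.powerset with ¬ N ⊆ Z, F N.card =
      ∑ i ∈ Finset.Icc 0 Y.card, (Y.card.choose i - Z.card.choose i) * F i := by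
  have h1 : ∑ N ∈ Y.powerset with N ⊆ Z, F N.card =
      ∑ i ∈ Finset.Icc 0 Y.card, Z.card.choose i * F i := by
    have : (Y.powerset.filter fun N => N ⊆ Z) = Z.powerset := by
      ext N
      simp only [Finset.mem_filter, Finset.mem_powerset]
      exact ⟨And.right, fun h => ⟨h.trans hZ, h⟩⟩
    rw [this, sum_powerset_card]
    refine Finset.sum_subset (Finset.Icc_subset_Icc le_rfl (Finset.card_le_card hZ)) ?_
    intro i _ hi
    rw [Finset.mem_Icc, not_and, not_le] at hi
    rw [Nat.choose_eq_zero_of_lt (hi (Nat.zero_le _)), zero_mul]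
  have h2 := Finset.sum_filter_add_sum_filter_not Y.powerset (fun N => N ⊆ Z) fun N => F N.card
  rw [h1, sum_powerset_card] at h2
  refine Nat.add_left_cancel (h2.trans ?_)
  rw [← Finset.sum_add_distrib]
  refine Finset.sum_congr rfl fun i _ => ?_
  rw [← add_mul, Nat.add_sub_cancel' (Nat.choose_le_choose i (Finset.card_le_card hZ))]

theorem sum_Icc_zero_eq {n : ℕ} {F : ℕ → ℕ} (h : F 0 = 0) :
    ∑ i ∈ Finset.Icc 0 n, F i = ∑ i ∈ Finset.Icc 1 n, F i := by
  refine (Finset.sum_subset (Finset.Icc_subset_Icc (Nat.zero_le _) le_rfl) fun i hi hi' => ?_).symm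
  rw [Finset.mem_Icc] at hi hi'
  rw [show i = 0 by omega, h]

theorem sum_Icc_pred_eq {n : ℕ} {F : ℕ → ℕ} (h : F n = 0) :
    ∑ i ∈ Finset.Icc 1 n, F i = ∑ i ∈ Finset.Icc 1 (n - 1), F i := by
  refine (Finset.sum_subset (Finset.Icc_subset_Icc le_rfl (Nat.sub_le _ _)) fun i hi hi' => ?_).symm
  rw [Finset.mem_Icc] at hi hi'
  rw [show i = n by omega, h]

theorem sum_powerset_union {X L : Finset α} (h : Disjoint X L) (F : Finset α → ℕ) :
    ∑ N ∈ (X ∪ L).powerset, F N = ∑ B ∈ L.powerset, ∑ A ∈ X.powerset, F (A ∪ B) := by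
  rw [← Finset.sum_product']
  refine Finset.sum_nbij' (fun N => (N ∩ L, N ∩ X)) (fun p => p.2 ∪ p.1) ?_ ?_ ?_ ?_ ?_
  · intro N _
    simp
  · rintro ⟨B, A⟩ hp
    simp only [Finset.mem_product, Finset.mem_powerset] at hp ⊢
    exact Finset.union_subset_union hp.2 hp.1
  · intro N hN
    rw [Finset.mem_powerset] at hN
    simp only
    rw [← Finset.inter_union_distrib_left, Finset.inter_eq_left.2 hN]
  · rintro ⟨B, A⟩ hp
    simp only [Finset.mem_product, Finset.mem_powerset] at hp ⊢
    rw [Finset.disjoint_left] at h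
    ext v
    · have := @hp.1 v
      have := @hp.2 v
      have := @h v
      simp only [Finset.mem_inter, Finset.mem_union]
      tauto
    · have := @hp.1 v
      have := @hp.2 v
      have := @h v
      simp only [Finset.mem_inter, Finset.mem_union]
      tauto
  · intro N hN
    rw [Finset.mem_powerset] at hN
    simp only
    rw [← Finset.inter_union_distrib_left, Finset.inter_eq_left.2 hN]

/-- A set that meets `L` is automatically not contained in `Z`; one that misses `L` must be chosen
in `X` but not in `Z`. This is the case distinction for the factor `A`. -/
theorem sum_powerset_union_card {X L Z : Finset α} (hd : Disjoint X L) (hZ : Z ⊆ X)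
    (F : ℕ → ℕ → ℕ) :
    ∑ N ∈ (X ∪ L).powerset with ¬ N ⊆ Z ∧ N ≠ X ∪ L, F (N ∩ X).card (N ∩ L).card =
      ∑ i ∈ Finset.Icc 0 X.card, ∑ j ∈ Finset.Icc 0 L.card,
        if 0 < i + j ∧ i + j < X.card + L.card then
          L.card.choose j * (if 0 < j then X.card.choose i else X.card.choose i - Z.card.choose i) *
            F i j
        else 0 := by
  -- The excluded set `X ∪ L` is the only one with both cardinalities maximal, so `F'` removes it by
  -- cardinalities alone.
  set F' : ℕ → ℕ → ℕ := fun i j => if i = X.card ∧ j = L.card then 0 else F i j with hF'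
  have hXL := Finset.disjoint_left.1 hd
  have hcap : ∀ A B : Finset α, A ⊆ X → B ⊆ L → (A ∪ B) ∩ X = A ∧ (A ∪ B) ∩ L = B := by
    intro A B hA hB
    constructor <;> ext v <;> have := @hA v <;> have := @hB v <;> have := @hXL v <;>
      simp only [Finset.mem_inter, Finset.mem_union] <;> tauto
  have hterm : ∀ B ∈ L.powerset, ∀ A ∈ X.powerset,
      (if ¬ A ∪ B ⊆ Z ∧ A ∪ B ≠ X ∪ L then F ((A ∪ B) ∩ X).card ((A ∪ B) ∩ L).card else 0) =
      if 0 < B.card then F' A.card B.card else if ¬ A ⊆ Z then F' A.card B.card else 0 := by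
    intro B hB A hA
    rw [Finset.mem_powerset] at hA hB
    rw [(hcap A B hA hB).1, (hcap A B hA hB).2]
    have e1 : A ∪ B ≠ X ∪ L ↔ ¬ (A.card = X.card ∧ B.card = L.card) := by
      refine not_congr ⟨fun he => ?_, fun he => ?_⟩
      · have := hcap A B hA hB
        have h' := hcap X L subset_rfl subset_rfl
        rw [he] at this
        rw [this.1.symm.trans h'.1, this.2.symm.trans h'.2]
        exact ⟨rfl, rfl⟩
      · rw [Finset.eq_of_subset_of_card_le hA he.1.ge, Finset.eq_of_subset_of_card_le hB he.2.ge]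
    have e2 : ¬ A ∪ B ⊆ Z ↔ 0 < B.card ∨ ¬ A ⊆ Z := by
      rw [Finset.card_pos, Finset.nonempty_iff_ne_empty]
      constructor
      · intro h1
        by_cases hB0 : B = ∅
        · subst hB0
          rw [Finset.union_empty] at h1
          exact Or.inr h1
        · exact Or.inl hB0
      · rintro (h1 | h1) h2
        · obtain ⟨b, hb⟩ := Finset.nonempty_iff_ne_empty.2 h1
          exact hXL (hZ (h2 (Finset.mem_union_right _ hb))) (hB hb)
        · exact h1 (Finset.subset_union_left.trans h2)
    simp only [e1, e2, hF']
    split_ifs <;> tauto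
  rw [Finset.sum_filter, sum_powerset_union hd]
  set h : ℕ → ℕ := fun j => ∑ i ∈ Finset.Icc 0 X.card,
    (if 0 < j then X.card.choose i else X.card.choose i - Z.card.choose i) * F' i j with hh
  have hstep : ∀ B ∈ L.powerset, (∑ A ∈ X.powerset,
      if ¬ A ∪ B ⊆ Z ∧ A ∪ B ≠ X ∪ L then F ((A ∪ B) ∩ X).card ((A ∪ B) ∩ L).card else 0) =
      h B.card := by
    intro B hB
    rw [Finset.sum_congr rfl (hterm B hB), hh]
    simp only
    by_cases hB0 : 0 < B.card
    · simp only [if_pos hB0]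
      exact sum_powerset_card X fun i => F' i B.card
    · simp only [if_neg hB0]
      rw [← Finset.sum_filter]
      exact sum_powerset_not_subset hZ fun i => F' i B.card
  rw [Finset.sum_congr rfl hstep, sum_powerset_card, Finset.sum_comm]
  simp only [hh]
  refine Finset.sum_congr rfl fun j hj => ?_
  rw [Finset.mul_sum]
  refine Finset.sum_congr rfl fun i hi => ?_
  rw [Finset.mem_Icc] at hi hj
  by_cases h0 : i + j = 0
  · obtain ⟨rfl, rfl⟩ : i = 0 ∧ j = 0 := by omega
    simp
  by_cases h1 : i + j < X.card + L.card
  · have c : 0 < i + j ∧ i + j < X.card + L.card := ⟨by omega, h1⟩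
    have c' : ¬ (i = X.card ∧ j = L.card) := by omega
    simp only [hF', if_pos c, if_neg c', mul_assoc]
  · have c : ¬ (0 < i + j ∧ i + j < X.card + L.card) := fun h => h1 h.2
    have c' : i = X.card ∧ j = L.card := by omega
    simp only [hF', if_neg c, if_pos c', mul_zero]

end Sums

/-! ### Counts depend only on cardinalities -/

section Canonical

variable {V : Type*} {ω t : ℕ}

theorem allPieces_map {W : Type*} (φ : V ↪ W) {R : Set W → Prop} {R₀ : Set V → Prop}
    (E : (ℕ → Prop) → Prop) (h : ∀ N, R (φ '' N) ↔ R₀ N) (A : Set (Piece V)) :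
    AllPieces R E (Piece.map φ '' A) ↔ AllPieces R₀ E A := by
  rw [AllPieces, Set.forall_mem_image]
  exact forall₂_congr fun c _ => and_congr (h _) Iff.rfl

theorem covers_map {W : Type*} (φ : V ↪ W) (L : Set V) (A : Set (Piece V)) :
    Covers (φ '' L) (Piece.map φ '' A) ↔ Covers L A := by
  rw [Covers, Set.forall_mem_image]
  refine forall₂_congr fun u _ => ?_
  rw [Set.exists_mem_image]
  exact exists_congr fun c => and_congr_right fun _ => φ.injective.mem_set_image

theorem lateCovers_map {W : Type*} (φ : V ↪ W) (Y L : Set V) (s : ℕ) (A : Set (Piece V)) :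
    LateCovers (φ '' Y) (φ '' L) s (Piece.map φ '' A) ↔ LateCovers Y L s A := by
  have hY : ∀ c : Piece V, (c.map φ).nbrs = φ '' Y ↔ c.nbrs = Y := fun c =>
    φ.injective.image_injective.eq_iff
  refine or_congr ?_ ?_
  · rw [Set.forall_mem_image]
    refine forall₂_congr fun u _ => ?_
    rw [Set.exists_mem_image]
    exact exists_congr fun c => and_congr_right fun _ => and_congr Iff.rfl
      (and_congr φ.injective.mem_set_image (not_congr (hY c)))
  · rw [Set.exists_mem_image]
    refine exists_congr fun c => and_congr_right fun _ => ?_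
    rw [Set.exists_mem_image]
    refine exists_congr fun c' => and_congr_right fun _ => ?_
    exact and_congr (Piece.map_injective φ).ne_iff (and_congr (and_congr Iff.rfl (hY c))
      (and_congr Iff.rfl (hY c')))

variable [DecidableEq V] {Y K Z : Finset V}

/-- Like its analogues below, this identifies a family over arbitrary disjoint sets with the counter
at their cardinalities, so recurrences can be proved inside one ambient type. -/
theorem ncard_single (hω : 1 ≤ ω) (hK : ∀ v ∈ K, v ∉ Y) :
    (Fam ω (Y : Set V) K (Single K Y (Exactly t))).ncard =
      (counters ω).gTildeOne t Y.card K.card := by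
  obtain ⟨φ, -, -, h₁, h₂⟩ := exists_block_embedding (subset_refl Y) (subset_refl Y) hK rfl
  change _ = (gTildeOneSet ω t Y.card K.card).ncard
  rw [gTildeOneSet_eq]
  refine ncard_fam_transport φ hω h₁ h₂ fun A => ?_
  rw [← h₁, ← h₂]
  refine exists_congr fun d => and_congr_left fun _ => ?_
  rw [← (Piece.map_injective φ).image_injective.eq_iff, Set.image_singleton]
  rfl

theorem ncard_g (hω : 1 ≤ ω) (hK : ∀ v ∈ K, v ∉ Y) (hZ : Z ⊆ Y) (hlt : Z.card < Y.card) :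
    (Fam ω (Y : Set V) K (AllPieces (fun N => ¬ N ⊆ Z) (· t))).ncard =
      (counters ω).g t Y.card K.card Z.card := by
  obtain ⟨φ, h₀, -, h₁, h₂⟩ := exists_block_embedding hZ (subset_refl Y) hK rfl
  change _ = (gSet ω t Y.card K.card Z.card).ncard
  rw [gSet_eq hlt]
  refine ncard_fam_transport φ hω h₁ h₂ fun A => allPieces_map φ _ (fun N => ?_) A
  rw [← h₀, Set.image_subset_image_iff φ.injective]

theorem ncard_gTilde (hω : 1 ≤ ω) (hK : ∀ v ∈ K, v ∉ Y) (hZ : Z ⊆ Y) (hlt : Z.card < Y.card) :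
    (Fam ω (Y : Set V) K (AllPieces (fun N => ¬ N ⊆ Z) (Exactly t))).ncard =
      (counters ω).gTilde t Y.card K.card Z.card := by
  obtain ⟨φ, h₀, -, h₁, h₂⟩ := exists_block_embedding hZ (subset_refl Y) hK rfl
  change _ = (gTildeSet ω t Y.card K.card Z.card).ncard
  rw [gTildeSet_eq hlt]
  refine ncard_fam_transport φ hω h₁ h₂ fun A => allPieces_map φ _ (fun N => ?_) A
  rw [← h₀, Set.image_subset_image_iff φ.injective]

theorem ncard_gTildeP (hω : 1 ≤ ω) (hK : ∀ v ∈ K, v ∉ Y) (hZ : Z ⊆ Y) (hlt : Z.card < Y.card) :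
    (Fam ω (Y : Set V) K (AllPieces (fun N => ¬ N ⊆ Z ∧ N ≠ Y) (Exactly t))).ncard =
      (counters ω).gTildeP t Y.card K.card Z.card := by
  obtain ⟨φ, h₀, -, h₁, h₂⟩ := exists_block_embedding hZ (subset_refl Y) hK rfl
  change _ = (gTildePSet ω t Y.card K.card Z.card).ncard
  rw [gTildePSet_eq hlt]
  refine ncard_fam_transport φ hω h₁ h₂ fun A => allPieces_map φ _ (fun N => ?_) A
  rw [← h₀, ← h₁, Set.image_subset_image_iff φ.injective, φ.injective.image_injective.ne_iff]

theorem ncard_gTildeTwo (hω : 1 ≤ ω) (hK : ∀ v ∈ K, v ∉ Y) (hY : 1 ≤ Y.card) :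
    (Fam ω (Y : Set V) K fun A => AllPieces (fun N => N = Y) (Exactly t) A ∧ A.Nontrivial).ncard =
      (counters ω).gTildeTwo t Y.card K.card := by
  obtain ⟨φ, -, -, h₁, h₂⟩ := exists_block_embedding (subset_refl Y) (subset_refl Y) hK rfl
  change _ = (gTildeTwoSet ω t Y.card K.card).ncard
  rw [gTildeTwoSet_eq hY]
  refine ncard_fam_transport φ hω h₁ h₂ fun A => and_congr (allPieces_map φ _ (fun N => ?_) A) ?_
  · rw [← h₁, φ.injective.image_injective.eq_iff]
  · exact ⟨Set.nontrivial_of_image _ _, fun h => h.image (Piece.map_injective φ)⟩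

variable {X : Finset V}

theorem image_block_sdiff {m a b : ℕ} (φ : Fin m ↪ V) (h₀ : φ '' block m 0 a = X)
    (h₁ : φ '' block m 0 b = Y) : φ '' block m a b = ↑(Y \ X) := by
  rw [← block_sdiff, Set.image_sdiff φ.injective, h₀, h₁, Finset.coe_sdiff]

theorem card_add_card_sdiff (hX : X ⊆ Y) : X.card + (Y \ X).card = Y.card := by
  have := Finset.card_sdiff_add_card_eq_card hX
  omega

theorem ncard_fTildePZ (hω : 1 ≤ ω) (hK : ∀ v ∈ K, v ∉ Y) (hZ : Z ⊆ X) (hX : X ⊆ Y)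
    (ht : 2 ≤ t) (hl : 1 ≤ (Y \ X).card) :
    (Fam ω (Y : Set V) K fun A => AllPieces (fun N => ¬ N ⊆ Z ∧ N ≠ Y) (Exactly (t - 1)) A ∧
        Covers ↑(Y \ X) A).ncard =
      (counters ω).fTildePZ t X.card (Y \ X).card K.card Z.card := by
  have hc := card_add_card_sdiff hX
  obtain ⟨φ, h₀, h₁, h₂, h₃⟩ := exists_block_embedding hZ hX hK
    (m := X.card + (Y \ X).card + K.card) (by rw [hc])
  change _ = (fTildePZSet ω t X.card (Y \ X).card K.card Z.card).ncard
  rw [fTildePZSet_eq ht hl (Finset.card_le_card hZ)]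
  rw [← hc] at h₂ h₃
  refine ncard_fam_transport φ hω h₂ h₃ fun A =>
    and_congr (allPieces_map φ _ (fun N => ?_) A) ?_
  · rw [← h₀, ← h₂, Set.image_subset_image_iff φ.injective, φ.injective.image_injective.ne_iff]
  · rw [← image_block_sdiff φ h₁ h₂, covers_map]

theorem ncard_fTilde (hω : 1 ≤ ω) (hK : ∀ v ∈ K, v ∉ Y) (hX : X ⊆ Y)
    (ht : 2 ≤ t) (hl : 1 ≤ (Y \ X).card) :
    (Fam ω (Y : Set V) K fun A => AllPieces (fun N => ¬ N ⊆ X) (Exactly (t - 1)) A ∧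
        LateCovers Y ↑(Y \ X) (t - 1) A).ncard =
      (counters ω).fTilde t X.card (Y \ X).card K.card := by
  have hc := card_add_card_sdiff hX
  obtain ⟨φ, h₀, h₁, h₂, h₃⟩ := exists_block_embedding (subset_refl X) hX hK
    (m := X.card + (Y \ X).card + K.card) (by rw [hc])
  change _ = (fTildeSet ω t X.card (Y \ X).card K.card).ncard
  rw [fTildeSet_eq ht hl]
  rw [← hc] at h₂ h₃
  refine ncard_fam_transport φ hω h₂ h₃ fun A =>
    and_congr (allPieces_map φ _ (fun N => ?_) A) ?_
  · rw [← h₁, Set.image_subset_image_iff φ.injective]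
  · rw [← image_block_sdiff φ h₁ h₂, ← h₂, lateCovers_map]

end Canonical

end ChordalCount

namespace ChordalCount

/-! ### Recurrences for `g`, `g̃`, `g̃_p` and the five-argument `f̃_p` -/

section Recurrences

variable {V : Type*} {ω t : ℕ}

theorem dead_mono {G : SimpleGraph V} {Y K : Set V} {c : Piece V} (hc : c ∈ prof G Y K) {i j : ℕ}
    (hij : i ≤ j) (h : c.dead i) : c.dead j := by
  obtain ⟨v, -, rfl⟩ := hc
  exact fun u hu hu' => h u hu (alive_antitone G Y hij hu')

theorem fam_congr {Y K : Set V} {P P' : Set (Piece V) → Prop}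
    (h : ∀ G, Base ω G Y K → (P (prof G Y K) ↔ P' (prof G Y K))) :
    Fam ω Y K P = Fam ω Y K P' := by
  ext G
  exact and_congr_right (h G)

theorem allPieces_union {R : Set V → Prop} {E : (ℕ → Prop) → Prop} {A B : Set (Piece V)} :
    AllPieces R E (A ∪ B) ↔ AllPieces R E A ∧ AllPieces R E B := by
  exact ⟨fun h => ⟨fun c hc => h c (Or.inl hc), fun c hc => h c (Or.inr hc)⟩,
    fun h c hc => hc.elim (h.1 c) (h.2 c)⟩

theorem allPieces_insert {R : Set V → Prop} {E : (ℕ → Prop) → Prop} {c : Piece V}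
    {B : Set (Piece V)} : AllPieces R E (insert c B) ↔ (R c.nbrs ∧ E c.dead) ∧ AllPieces R E B :=
  Set.forall_mem_insert ..

variable {X Y K Z : Finset V}

theorem verts_eq_of_prof_eq {G : SimpleGraph V} (hG : Base ω G (Y : Set V) K)
    {c : Piece V} (h : prof G (Y : Set V) K = {c}) : c.verts = K := by
  have hc : ∀ w ∈ K, piece G (Y : Set V) w = c := by
    intro w hw
    have : piece G Y w ∈ prof G (Y : Set V) K := ⟨w, hw, rfl⟩
    rwa [h] at this
  obtain ⟨v, hv, -⟩ : c ∈ prof G (Y : Set V) K := h ▸ rfl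
  refine Set.Subset.antisymm ?_ fun w hw => ?_
  · rw [← hc v hv]
    refine comp_subset hv fun a _ b hab _ hb => ?_
    exact (hG.within b a hab.symm).resolve_left hb
  · rw [← hc w hw]
    exact mem_comp_self _ _ _

theorem disjoint_of_subset (hK : ∀ v ∈ K, v ∉ Y) {W : Finset V} (hW : W ∈ K.powerset) :
    ∀ v ∈ W, v ∉ Y := fun v hv => hK v (Finset.mem_powerset.1 hW hv)

theorem ncard_fam_colorable (hY : ω < Y.card) (P : Set (Piece V) → Prop) (K : Set V) :
    (Fam ω (Y : Set V) K P).ncard = 0 := by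
  have : Fam ω (Y : Set V) K P = ∅ := by
    refine Set.eq_empty_of_forall_notMem fun G hG => ?_
    have := SimpleGraph.IsClique.card_le_of_colorable hG.1.clique hG.1.colorable
    omega
  rw [this, Set.ncard_empty]

variable [DecidableEq V]

theorem disjoint_sdiff (hK : ∀ v ∈ K, v ∉ Y) (W : Finset V) : ∀ v ∈ K \ W, v ∉ Y :=
  fun v hv => hK v (Finset.mem_sdiff.1 hv).1

theorem card_sdiff_of_mem_powerset {W : Finset V} (hW : W ∈ K.powerset) :
    (K \ W).card = K.card - W.card :=
  Finset.card_sdiff_of_subset (Finset.mem_powerset.1 hW)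

variable [Finite V]

/-- The pieces that evaporate at time exactly `t` are split off. -/
theorem ncard_allPieces_split (hK : ∀ v ∈ K, v ∉ Y) (R : Set V → Prop)
    {Q : Set (Piece V) → Prop}
    (hQ : ∀ A B, (∀ c ∈ B, c.dead (t - 1)) → (Q (A ∪ B) ↔ Q A)) :
    (Fam ω (Y : Set V) K fun A => AllPieces R (· t) A ∧ Q A).ncard =
      ∑ W ∈ K.powerset, (Fam ω (Y : Set V) W fun A => AllPieces R (Exactly t) A ∧ Q A).ncard *
        (Fam ω (Y : Set V) ↑(K \ W) (AllPieces R (· (t - 1)))).ncard := by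
  rw [ncard_fam_split hK (P₁ := fun A => AllPieces R (Exactly t) A ∧ Q A)
    (P₂ := AllPieces R fun d => d t ∧ d (t - 1)) (fun c => ¬ c.dead (t - 1))]
  · refine Finset.sum_congr rfl fun W _ => ?_
    congr 2
    refine fam_congr fun G _ => ⟨fun h c hc => ⟨(h c hc).1, (h c hc).2.2⟩, fun h c hc => ?_⟩
    exact ⟨(h c hc).1, dead_mono hc (Nat.sub_le _ _) (h c hc).2, (h c hc).2⟩
  · intro A B
    rw [allPieces_union]
    constructor
    · rintro ⟨⟨⟨h1, h2⟩, h3⟩, h4, h5⟩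
      -- The pieces split off are those still alive at time `t - 1`. The remaining ones are the
      -- early pieces, which `Q` ignores by `hQ`.
      have h5' : ∀ c ∈ B, c.dead (t - 1) := fun c hc => not_not.1 (h5 c hc)
      exact ⟨⟨fun c hc => ⟨(h1 c hc).1, (h1 c hc).2, h4 c hc⟩, (hQ A B h5').1 h3⟩,
        fun c hc => ⟨(h2 c hc).1, (h2 c hc).2, h5' c hc⟩⟩
    · rintro ⟨⟨h1, h2⟩, h3⟩
      exact ⟨⟨⟨fun c hc => ⟨(h1 c hc).1, (h1 c hc).2.1⟩, fun c hc => ⟨(h3 c hc).1, (h3 c hc).2.1⟩⟩,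
        (hQ A B fun c hc => (h3 c hc).2.2).2 h2⟩, fun c hc => (h1 c hc).2.2,
        fun c hc => not_not.2 (h3 c hc).2.2⟩

theorem card_g_rec (hω : 1 ≤ ω) (hK : ∀ v ∈ K, v ∉ Y) (hZ : Z ⊆ Y) (hlt : Z.card < Y.card) :
    (counters ω).g t Y.card K.card Z.card = ∑ k' ∈ Finset.Icc 0 K.card,
      K.card.choose k' * (counters ω).gTilde t Y.card k' Z.card *
        (counters ω).g (t - 1) Y.card (K.card - k') Z.card := by
  have h := ncard_allPieces_split (ω := ω) (t := t) hK (fun N => ¬ N ⊆ (Z : Set V))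
    (Q := fun _ => True) fun _ _ _ => Iff.rfl
  simp only [and_true] at h
  rw [← ncard_g hω hK hZ hlt, h]
  simp only [mul_assoc]
  rw [← sum_powerset_card K fun i => (counters ω).gTilde t Y.card i Z.card *
    (counters ω).g (t - 1) Y.card (K.card - i) Z.card]
  refine Finset.sum_congr rfl fun W hW => ?_
  rw [ncard_gTilde hω (disjoint_of_subset hK hW) hZ hlt, ncard_g hω (disjoint_sdiff hK W) hZ hlt,
    card_sdiff_of_mem_powerset hW]

/-- The component of a vertex is split off. -/
theorem ncard_peel (hω : 1 ≤ ω) (hK : ∀ v ∈ K, v ∉ Y) {v₀ : V} (hv₀ : v₀ ∈ K)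
    {P : Set (Piece V) → Prop} (t : ℕ) (R : Finset V → Prop) [DecidablePred R]
    (P' : Finset V → Set (Piece V) → Prop)
    (h : ∀ (W N : Finset V) d B, P (insert ⟨W, N, d⟩ B) ↔ (R N ∧ Exactly t d) ∧ P' N B) :
    (Fam ω (Y : Set V) K P).ncard =
      ∑ W ∈ K.powerset with v₀ ∈ W, ∑ N ∈ Y.powerset with R N,
        (counters ω).gTildeOne t N.card W.card *
          (Fam ω (Y : Set V) ↑(K \ W) (P' N)).ncard := by
  rw [ncard_fam_peel hK hv₀ (Exactly t) R P' h]
  refine Finset.sum_congr rfl fun W hW => Finset.sum_congr rfl fun N hN => ?_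
  rw [ncard_single hω]
  intro v hv hvN
  exact hK v (Finset.mem_powerset.1 (Finset.mem_filter.1 hW).1 hv)
    (Finset.mem_powerset.1 (Finset.mem_filter.1 hN).1 hvN)

/-- The component of a fixed vertex `v₀` is removed; the sums run over its vertex set and its
neighborhood. The condition `¬ N ⊆ Z` gives the difference of binomials, which vanishes for `x' =
0`. -/
theorem card_gTilde_rec (hω : 1 ≤ ω) (hK : ∀ v ∈ K, v ∉ Y) (hZ : Z ⊆ Y) (hlt : Z.card < Y.card)
    (hk : 1 ≤ K.card) :
    (counters ω).gTilde t Y.card K.card Z.card =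
      ∑ k' ∈ Finset.Icc 1 K.card, ∑ x' ∈ Finset.Icc 1 Y.card,
        (Y.card.choose x' - Z.card.choose x') * (K.card - 1).choose (k' - 1) *
          (counters ω).gTildeOne t x' k' * (counters ω).gTilde t Y.card (K.card - k') Z.card := by
  obtain ⟨v₀, hv₀⟩ := Finset.card_pos.1 hk
  rw [← ncard_gTilde hω hK hZ hlt, ncard_peel hω hK hv₀ t (fun N => ¬ N ⊆ Z)
    (fun _ => AllPieces (fun N => ¬ N ⊆ (Z : Set V)) (Exactly t))
    fun W N d B => by rw [allPieces_insert, Finset.coe_subset]]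
  set S : ℕ → ℕ := fun k' => ∑ x' ∈ Finset.Icc 1 Y.card, (Y.card.choose x' - Z.card.choose x') *
    ((counters ω).gTildeOne t x' k' * (counters ω).gTilde t Y.card (K.card - k') Z.card) with hS
  have hW : ∀ W ∈ K.powerset.filter (v₀ ∈ ·), (∑ N ∈ Y.powerset with ¬ N ⊆ Z,
      (counters ω).gTildeOne t N.card W.card * (Fam ω (Y : Set V) ↑(K \ W)
        (AllPieces (fun N => ¬ N ⊆ (Z : Set V)) (Exactly t))).ncard) =
      S W.card := by
    intro W hW
    simp only [hS]
    rw [ncard_gTilde hω (disjoint_sdiff hK W) hZ hlt,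
      card_sdiff_of_mem_powerset (Finset.mem_filter.1 hW).1,
      sum_powerset_not_subset hZ fun x' => (counters ω).gTildeOne t x' W.card *
        (counters ω).gTilde t Y.card (K.card - W.card) Z.card, sum_Icc_zero_eq (by simp)]
  rw [Finset.sum_congr rfl hW, sum_powerset_mem_card hv₀ S]
  simp only [hS, Finset.mul_sum]
  exact Finset.sum_congr rfl fun k' _ => Finset.sum_congr rfl fun x' _ => by ring

theorem card_gTildeP_rec (hω : 1 ≤ ω) (hK : ∀ v ∈ K, v ∉ Y) (hZ : Z ⊆ Y) (hlt : Z.card < Y.card)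
    (hk : 1 ≤ K.card) :
    (counters ω).gTildeP t Y.card K.card Z.card =
      ∑ k' ∈ Finset.Icc 1 K.card, ∑ x' ∈ Finset.Icc 1 (Y.card - 1),
        (Y.card.choose x' - Z.card.choose x') * (K.card - 1).choose (k' - 1) *
          (counters ω).gTildeOne t x' k' * (counters ω).gTildeP t Y.card (K.card - k') Z.card := by
  obtain ⟨v₀, hv₀⟩ := Finset.card_pos.1 hk
  rw [← ncard_gTildeP hω hK hZ hlt, ncard_peel hω hK hv₀ t (fun N => ¬ N ⊆ Z ∧ N ≠ Y)
    (fun _ => AllPieces (fun N => ¬ N ⊆ (Z : Set V) ∧ N ≠ Y) (Exactly t))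
    fun W N d B => by rw [allPieces_insert, Finset.coe_subset, Ne, Finset.coe_inj]]
  set S : ℕ → ℕ := fun k' => ∑ x' ∈ Finset.Icc 1 (Y.card - 1), (Y.card.choose x' - Z.card.choose x') *
    ((counters ω).gTildeOne t x' k' * (counters ω).gTildeP t Y.card (K.card - k') Z.card) with hS
  have hW : ∀ W ∈ K.powerset.filter (v₀ ∈ ·), (∑ N ∈ Y.powerset with ¬ N ⊆ Z ∧ N ≠ Y,
      (counters ω).gTildeOne t N.card W.card * (Fam ω (Y : Set V) ↑(K \ W)
        (AllPieces (fun N => ¬ N ⊆ (Z : Set V) ∧ N ≠ Y) (Exactly t))).ncard) =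
      S W.card := by
    intro W hW
    simp only [hS]
    rw [ncard_gTildeP hω (disjoint_sdiff hK W) hZ hlt,
      card_sdiff_of_mem_powerset (Finset.mem_filter.1 hW).1]
    -- The neighborhood `Y` is now forbidden, which cuts off the last value `x' = Y.card`.
    set F : ℕ → ℕ := fun x' => if x' = Y.card then 0 else (counters ω).gTildeOne t x' W.card *
        (counters ω).gTildeP t Y.card (K.card - W.card) Z.card with hF
    have h1 : ∑ N ∈ Y.powerset with ¬ N ⊆ Z ∧ N ≠ Y, (counters ω).gTildeOne t N.card W.card *
        (counters ω).gTildeP t Y.card (K.card - W.card) Z.card =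
        ∑ N ∈ Y.powerset with ¬ N ⊆ Z, F N.card := by
      rw [← Finset.filter_filter, Finset.sum_filter]
      refine Finset.sum_congr rfl fun N hN => ?_
      have hNY := Finset.mem_powerset.1 (Finset.mem_filter.1 hN).1
      have : N ≠ Y ↔ ¬ N.card = Y.card :=
        not_congr ⟨fun h => h ▸ rfl, fun h => Finset.eq_of_subset_of_card_le hNY h.ge⟩
      simp only [hF, this, ite_not]
    rw [h1, sum_powerset_not_subset hZ F, sum_Icc_zero_eq (by simp), sum_Icc_pred_eq (by simp [hF])]
    refine Finset.sum_congr rfl fun x' hx' => ?_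
    rw [Finset.mem_Icc] at hx'
    simp only [hF]
    rw [if_neg (by omega)]
  rw [Finset.sum_congr rfl hW, sum_powerset_mem_card hv₀ S]
  simp only [hS, Finset.mul_sum]
  exact Finset.sum_congr rfl fun k' _ => Finset.sum_congr rfl fun x' _ => by ring

/-- Once a component with neighborhood `N` is removed, the others only have to cover the part of `L
= Y \ X` outside `N`. They are counted by the same function with `N ∩ L` moved from `L` to `X`. The
extra argument `z` is needed because the set to be avoided must not grow along with `X`. -/
theorem card_fTildePZ_rec (hω : 1 ≤ ω) (hK : ∀ v ∈ K, v ∉ Y) (hZ : Z ⊆ X) (hX : X ⊆ Y)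
    (ht : 2 ≤ t) (hl : 1 ≤ (Y \ X).card) (hk : 1 ≤ K.card) :
    (counters ω).fTildePZ t X.card (Y \ X).card K.card Z.card =
      ∑ k' ∈ Finset.Icc 1 K.card, ∑ x' ∈ Finset.Icc 0 X.card, ∑ l' ∈ Finset.Icc 0 (Y \ X).card,
        if 0 < x' + l' ∧ x' + l' < X.card + (Y \ X).card then
          (K.card - 1).choose (k' - 1) * (Y \ X).card.choose l' *
            (counters ω).gTildeOne (t - 1) (x' + l') k' *
            (if 0 < l' then X.card.choose x' else X.card.choose x' - Z.card.choose x') *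
            (if l' < (Y \ X).card then
              (counters ω).fTildePZ t (X.card + l') ((Y \ X).card - l') (K.card - k') Z.card
            else (counters ω).gTildeP (t - 1) (X.card + (Y \ X).card) (K.card - k') Z.card)
        else 0 := by
  obtain ⟨v₀, hv₀⟩ := Finset.card_pos.1 hk
  have hc := card_add_card_sdiff hX
  rw [← ncard_fTildePZ hω hK hZ hX ht hl]
  rw [ncard_peel hω hK hv₀ (t - 1) (fun N => ¬ N ⊆ Z ∧ N ≠ Y)
    (fun N A => AllPieces (fun N => ¬ N ⊆ (Z : Set V) ∧ N ≠ Y) (Exactly (t - 1)) A ∧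
      Covers ↑((Y \ X) \ N) A)]
  · set F : ℕ → ℕ → ℕ → ℕ := fun k' x' l' => (counters ω).gTildeOne (t - 1) (x' + l') k' *
      (if l' < (Y \ X).card then
        (counters ω).fTildePZ t (X.card + l') ((Y \ X).card - l') (K.card - k') Z.card
      else (counters ω).gTildeP (t - 1) (X.card + (Y \ X).card) (K.card - k') Z.card) with hF
    have hN : ∀ W ∈ K.powerset.filter (v₀ ∈ ·),
        ∀ N ∈ Y.powerset.filter (fun N => ¬ N ⊆ Z ∧ N ≠ Y),
        (counters ω).gTildeOne (t - 1) N.card W.card * (Fam ω (Y : Set V) ↑(K \ W) fun A =>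
          AllPieces (fun N => ¬ N ⊆ (Z : Set V) ∧ N ≠ Y) (Exactly (t - 1)) A ∧
            Covers ↑((Y \ X) \ N) A).ncard =
        F W.card (N ∩ X).card (N ∩ (Y \ X)).card := by
      intro W hW N hN
      have hKW := card_sdiff_of_mem_powerset (Finset.mem_filter.1 hW).1
      have hNY : N ⊆ Y := Finset.mem_powerset.1 (Finset.mem_filter.1 hN).1
      have hcard : (N ∩ X).card + (N ∩ (Y \ X)).card = N.card := by
        rw [← Finset.card_union_of_disjoint, ← Finset.inter_union_distrib_left,
          Finset.union_sdiff_of_subset hX, Finset.inter_eq_left.2 hNY]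
        exact Finset.disjoint_sdiff.mono Finset.inter_subset_right Finset.inter_subset_right
      simp only [hF, hcard]
      congr 1
      set X' := X ∪ (N ∩ (Y \ X)) with hX'
      have hX'Y : X' ⊆ Y :=
        Finset.union_subset hX (Finset.inter_subset_right.trans Finset.sdiff_subset)
      have hX'c : X'.card = X.card + (N ∩ (Y \ X)).card :=
        Finset.card_union_of_disjoint (Finset.disjoint_sdiff.mono_right Finset.inter_subset_right)
      have hL : (Y \ X) \ N = Y \ X' := by
        ext v
        simp only [hX', Finset.mem_sdiff, Finset.mem_union, Finset.mem_inter]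
        tauto
      have hLc : (Y \ X').card = (Y \ X).card - (N ∩ (Y \ X)).card := by
        have := card_add_card_sdiff hX'Y
        omega
      have hle : (N ∩ (Y \ X)).card ≤ (Y \ X).card := Finset.card_le_card Finset.inter_subset_right
      rw [hL]
      by_cases hlt : (N ∩ (Y \ X)).card < (Y \ X).card
      · have hpos : 1 ≤ (Y \ X').card := by omega
        rw [if_pos hlt, ncard_fTildePZ hω (disjoint_sdiff hK W)
          (hZ.trans Finset.subset_union_left) hX'Y ht hpos, hX'c, hLc, hKW]
      -- The removed component covers all of `L`. Nothing remains to be covered, which leaves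
      -- `g̃_p`.
      · have hemp : Y \ X' = ∅ := Finset.card_eq_zero.1 (by omega)
        have hZc := Finset.card_le_card hZ
        rw [if_neg hlt, hemp, hc, ← hKW, ← ncard_gTildeP hω (disjoint_sdiff hK W) (hZ.trans hX)
          (by omega)]
        simp [Covers]
    rw [Finset.sum_congr rfl fun W hW => Finset.sum_congr rfl (hN W hW)]
    have hXL : X ∪ Y \ X = Y := Finset.union_sdiff_of_subset hX
    have hsum := fun k' => sum_powerset_union_card (X := X) (L := Y \ X) Finset.disjoint_sdiff hZ
      (F k')
    rw [hXL] at hsum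
    obtain ⟨S, hS⟩ : ∃ S : ℕ → ℕ, S = fun k' => ∑ N ∈ Y.powerset with ¬ N ⊆ Z ∧ N ≠ Y,
      F k' (N ∩ X).card (N ∩ (Y \ X)).card := ⟨_, rfl⟩
    have hSW : ∀ W : Finset V, (∑ N ∈ Y.powerset with ¬ N ⊆ Z ∧ N ≠ Y,
      F W.card (N ∩ X).card (N ∩ (Y \ X)).card) = S W.card := fun W => by rw [hS]
    rw [Finset.sum_congr rfl fun W _ => hSW W, sum_powerset_mem_card hv₀ S]
    simp only [hS, hsum, Finset.mul_sum]
    refine Finset.sum_congr rfl fun k' _ => Finset.sum_congr rfl fun x' _ =>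
      Finset.sum_congr rfl fun l' _ => ?_
    rw [mul_ite, mul_zero]
    refine if_congr Iff.rfl ?_ rfl
    simp only [hF]
    ring
  · intro W N d B
    have hR : (¬ (N : Set V) ⊆ Z ∧ (N : Set V) ≠ Y) ↔ (¬ N ⊆ Z ∧ N ≠ Y) := by
      simp only [Finset.coe_subset, ne_eq, Finset.coe_inj]
    -- The new piece covers exactly `N`.
    have hC : Covers ↑(Y \ X) (insert ⟨W, N, d⟩ B) ↔ Covers ↑((Y \ X) \ N) B := by
      simp only [Covers, Set.exists_mem_insert, Finset.mem_coe, Finset.mem_sdiff]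
      refine forall_congr' fun u => ?_
      tauto
    rw [allPieces_insert, hR, hC, and_assoc]

/-- A nonempty set of pieces is a singleton or has two elements, and a single piece necessarily
comprises all of `K`. -/
theorem card_all_eq (hω : 1 ≤ ω) (hK : ∀ v ∈ K, v ∉ Y) (hY : 1 ≤ Y.card) (hk : 1 ≤ K.card) :
    (Fam ω (Y : Set V) K (AllPieces (fun N => N = Y) (Exactly t))).ncard =
      (counters ω).gTildeOne t Y.card K.card + (counters ω).gTildeTwo t Y.card K.card := by
  rw [← ncard_single hω hK, ← ncard_gTildeTwo hω hK hY, ← Set.ncard_union_eq]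
  · congr 1
    ext G
    constructor
    · rintro ⟨h1, h2⟩
      by_cases hn : (prof G (Y : Set V) K).Nontrivial
      · exact Or.inr ⟨h1, h2, hn⟩
      · left
        obtain ⟨v, hv⟩ := Finset.card_pos.1 hk
        have hvp : piece G Y v ∈ prof G (Y : Set V) K := ⟨v, hv, rfl⟩
        have hs := (Set.not_nontrivial_iff.1 hn).eq_singleton_of_mem hvp
        refine ⟨h1, (piece G Y v).dead, ?_, (h2 _ hvp).2⟩
        rw [hs]
        congr 1
        exact Piece.ext (verts_eq_of_prof_eq h1 hs) (h2 _ hvp).1 rfl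
    · rintro (⟨h1, d, hd, hE⟩ | ⟨h1, h2, -⟩)
      · refine ⟨h1, ?_⟩
        rw [hd]
        rintro _ rfl
        exact ⟨rfl, hE⟩
      · exact ⟨h1, h2⟩
  · rw [Set.disjoint_left]
    rintro G ⟨-, d, hd, -⟩ ⟨-, -, hn⟩
    rw [hd] at hn
    exact Set.not_nontrivial_singleton hn

end Recurrences

end ChordalCount

namespace ChordalCount

/-! ### Recurrences for `g̃_{≥2}`, `f` and `f̃` -/

section Recurrences

variable {V : Type*} {ω t : ℕ} {X Y K Z : Finset V}

/-- Without further vertices the only candidate is the complete graph on `Y`, with the ambient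
vertices outside `Y` isolated. Its coloring needs `Y.card ≤ ω`. -/
theorem fam_empty_eq (hω : 1 ≤ ω) (hY : Y.card ≤ ω) {P : Set (Piece V) → Prop} (hP : P ∅) :
    Fam ω (Y : Set V) ∅ P = {restr ⊤ (Y : Set V)} := by
  classical
  ext G
  constructor
  · rintro ⟨h, -⟩
    refine SimpleGraph.ext ?_
    ext a b
    constructor
    · intro hab
      have ha := h.within a b hab
      have hb := h.within b a hab.symm
      rw [Set.union_empty] at ha hb
      exact ⟨hab.ne, ha, hb⟩
    · rintro ⟨hab, ha, hb⟩
      exact h.clique ha hb hab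
  · rintro rfl
    refine ⟨⟨fun a b hab => Or.inl hab.2.1, fun a ha b hb hab => ⟨hab, ha, hb⟩, ?_, ?_⟩, ?_⟩
    · refine IsChordal.restr (isChordal_of_simplicial fun R ⟨v, hv⟩ => ⟨v, hv, ?_⟩) _
      exact fun a _ b _ hab => hab
    · refine ⟨SimpleGraph.Coloring.mk (fun v => if h : v ∈ Y then
        Fin.castLE hY (Y.equivFin ⟨v, h⟩) else ⟨0, hω⟩) ?_⟩
      rintro a b ⟨hab, ha, hb⟩ he
      simp only [Finset.mem_coe] at ha hb
      simp only [ha, hb, dif_pos] at he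
      have := Y.equivFin.injective (Fin.castLE_injective hY he)
      exact hab (congrArg Subtype.val this)
    · simpa [prof] using hP

theorem ncard_fam_empty (hω : 1 ≤ ω) (hY : Y.card ≤ ω) {P : Set (Piece V) → Prop} (hP : P ∅) :
    (Fam ω (Y : Set V) ((∅ : Finset V) : Set V) P).ncard = 1 := by
  rw [Finset.coe_empty, fam_empty_eq hω hY hP, Set.ncard_singleton]

variable [DecidableEq V]

theorem ncard_f (hω : 1 ≤ ω) (hK : ∀ v ∈ K, v ∉ Y) (hX : X ⊆ Y)
    (ht : 2 ≤ t) (hl : 1 ≤ (Y \ X).card) :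
    (Fam ω (Y : Set V) K fun A => AllPieces (fun N => ¬ N ⊆ X) (· (t - 1)) A ∧
        LateCovers Y ↑(Y \ X) (t - 1) A).ncard =
      (counters ω).f t X.card (Y \ X).card K.card := by
  have hc := card_add_card_sdiff hX
  obtain ⟨φ, h₀, h₁, h₂, h₃⟩ := exists_block_embedding (subset_refl X) hX hK
    (m := X.card + (Y \ X).card + K.card) (by rw [hc])
  change _ = (fSet ω t X.card (Y \ X).card K.card).ncard
  rw [fSet_eq ht hl]
  rw [← hc] at h₂ h₃
  refine ncard_fam_transport φ hω h₂ h₃ fun A =>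
    and_congr (allPieces_map φ _ (fun N => ?_) A) ?_
  · rw [← h₁, Set.image_subset_image_iff φ.injective]
  · rw [← image_block_sdiff φ h₁ h₂, ← h₂, lateCovers_map]

variable [Finite V]

/-- The graphs all of whose pieces see `Y` are counted twice: as `g̃_1 + g̃_{≥2}`, and by removing
the component of a fixed vertex. In the second count the component that exhausts `K` contributes
`g̃_1`, which cancels. -/
theorem card_gTildeTwo_rec (hω : 1 ≤ ω) (hK : ∀ v ∈ K, v ∉ Y) (hY : 1 ≤ Y.card)
    (hk : 1 ≤ K.card) :
    (counters ω).gTildeTwo t Y.card K.card = ∑ k' ∈ Finset.Icc 1 (K.card - 1),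
      (K.card - 1).choose (k' - 1) * (counters ω).gTildeOne t Y.card k' *
        ((counters ω).gTildeOne t Y.card (K.card - k') +
          (counters ω).gTildeTwo t Y.card (K.card - k')) := by
  obtain ⟨v₀, hv₀⟩ := Finset.card_pos.1 hk
  have h := card_all_eq (t := t) hω hK hY hk
  rw [ncard_peel hω hK hv₀ t (fun N => N = Y)
    (fun _ => AllPieces (fun N => N = (Y : Set V)) (Exactly t))
    fun W N d B => by rw [allPieces_insert, Finset.coe_inj]] at h
  obtain ⟨F, hF⟩ : ∃ F : ℕ → ℕ, F = fun k' => (counters ω).gTildeOne t Y.card k' *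
      if k' = K.card then 1 else (counters ω).gTildeOne t Y.card (K.card - k') +
          (counters ω).gTildeTwo t Y.card (K.card - k') := ⟨_, rfl⟩
  have hW : ∀ W ∈ K.powerset.filter (v₀ ∈ ·), (∑ N ∈ Y.powerset with N = Y,
      (counters ω).gTildeOne t N.card W.card * (Fam ω (Y : Set V) ↑(K \ W)
        (AllPieces (fun N => N = (Y : Set V)) (Exactly t))).ncard) = F W.card := by
    intro W hW
    have hWK := (Finset.mem_filter.1 hW).1
    have hWK' := Finset.mem_powerset.1 hWK
    have : (Y.powerset.filter fun N => N = Y) = {Y} := by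
      ext N
      simp only [Finset.mem_filter, Finset.mem_powerset, Finset.mem_singleton]
      exact ⟨And.right, fun h => ⟨h.le, h⟩⟩
    rw [this, Finset.sum_singleton, hF]
    simp only
    by_cases hc : W.card = K.card
    · have he : K \ W = ∅ := by
        rw [Finset.eq_of_subset_of_card_le hWK' hc.ge, Finset.sdiff_self]
      rw [if_pos hc, he]
      -- The remaining factor is `1` only if `Y` is small enough to be colored. Otherwise `g̃_1`
      -- vanishes too and both sides are zero.
      by_cases hYω : Y.card ≤ ω
      · rw [ncard_fam_empty hω hYω fun c hc => absurd hc (Set.notMem_empty c)]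
      · rw [← ncard_single hω (disjoint_of_subset hK hWK), ncard_fam_colorable (by omega),
          zero_mul, zero_mul]
    · have := card_sdiff_of_mem_powerset hWK
      have hle := Finset.card_le_card hWK'
      rw [if_neg hc, card_all_eq hω (disjoint_sdiff hK W) hY (by omega), this]
  rw [Finset.sum_congr rfl hW, sum_powerset_mem_card hv₀ F] at h
  obtain ⟨j, hj⟩ : ∃ j, K.card = j + 1 := ⟨K.card - 1, by omega⟩
  rw [hj] at h hF ⊢
  rw [Finset.sum_Icc_succ_top (by omega), Nat.add_sub_cancel, Nat.choose_self, hF] at h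
  simp only [if_true, mul_one, one_mul] at h
  rw [add_comm] at h
  rw [Nat.add_sub_cancel, ← Nat.add_left_cancel h]
  refine Finset.sum_congr rfl fun i hi => ?_
  rw [Finset.mem_Icc] at hi
  rw [if_neg (by omega), mul_assoc]

/-- `LateCovers` only looks at late pieces, so the pieces that die before time `t - 1` can be split
off; they are counted by `g` with time bound `t - 2`. -/
theorem card_f_rec (hω : 1 ≤ ω) (hK : ∀ v ∈ K, v ∉ Y) (hX : X ⊆ Y)
    (ht : 2 ≤ t) (hl : 1 ≤ (Y \ X).card) :
    (counters ω).f t X.card (Y \ X).card K.card = ∑ k' ∈ Finset.Icc 0 K.card,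
      K.card.choose k' * (counters ω).fTilde t X.card (Y \ X).card k' *
        (counters ω).g (t - 2) (X.card + (Y \ X).card) (K.card - k') X.card := by
  have hc := card_add_card_sdiff hX
  have h := ncard_allPieces_split (ω := ω) (t := t - 1) hK (fun N => ¬ N ⊆ (X : Set V))
    (Q := LateCovers Y ↑(Y \ X) (t - 1)) ?_
  · rw [← ncard_f hω hK hX ht hl, h, hc]
    simp only [mul_assoc]
    rw [← sum_powerset_card K fun i => (counters ω).fTilde t X.card (Y \ X).card i *
      (counters ω).g (t - 2) Y.card (K.card - i) X.card]
    refine Finset.sum_congr rfl fun W hW => ?_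
    rw [ncard_fTilde hω (disjoint_of_subset hK hW) hX ht hl,
      ncard_g hω (disjoint_sdiff hK W) hX (by omega), card_sdiff_of_mem_powerset hW]
    rfl
  · intro A B hB
    have hA : ∀ c ∈ A ∪ B, c.Late (t - 1) → c ∈ A := fun c hc hl =>
      hc.resolve_right fun hcB => hl (hB c hcB)
    constructor
    · rintro (h | ⟨c, hc, c', hc', hne, h, h'⟩)
      · refine Or.inl fun u hu => ?_
        obtain ⟨c, hc, h1, h2⟩ := h u hu
        exact ⟨c, hA c hc h1, h1, h2⟩
      · exact Or.inr ⟨c, hA c hc h.1, c', hA c' hc' h'.1, hne, h, h'⟩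
    · rintro (h | ⟨c, hc, c', hc', hne, h, h'⟩)
      · refine Or.inl fun u hu => ?_
        obtain ⟨c, hc, h1⟩ := h u hu
        exact ⟨c, Or.inl hc, h1⟩
      · exact Or.inr ⟨c, Or.inl hc, c', Or.inl hc', hne, h, h'⟩

/-- The cases are zero, one, or at least two pieces that see all of `Y`. With at most one, the other
pieces have to cover `Y \ X` by themselves. With two, `LateCovers` holds automatically and the
others are unrestricted, hence `g̃_p`. -/
theorem card_fTilde_rec (hω : 1 ≤ ω) (hK : ∀ v ∈ K, v ∉ Y) (hX : X ⊆ Y)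
    (ht : 2 ≤ t) (hl : 1 ≤ (Y \ X).card) :
    (counters ω).fTilde t X.card (Y \ X).card K.card =
      (counters ω).fTildePZ t X.card (Y \ X).card K.card X.card +
      ∑ k' ∈ Finset.Icc 0 K.card,
        K.card.choose k' * (counters ω).gTildeOne (t - 1) (X.card + (Y \ X).card) k' *
          (counters ω).fTildePZ t X.card (Y \ X).card (K.card - k') X.card +
      ∑ k' ∈ Finset.Icc 0 K.card,
        K.card.choose k' * (counters ω).gTildeTwo (t - 1) (X.card + (Y \ X).card) k' *
          (counters ω).gTildeP (t - 1) (X.card + (Y \ X).card) (K.card - k') X.card := by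
  have hc := card_add_card_sdiff hX
  -- Hence a piece that sees all of `Y` meets the requirement of a neighborhood outside `X`.
  have hYX : ¬ (Y : Set V) ⊆ X := by
    intro h
    have := Finset.card_le_card (Finset.coe_subset.1 h)
    omega
  set s := t - 1 with hs
  set P : Set (Piece V) → Prop := fun A => AllPieces (fun N => ¬ N ⊆ (X : Set V)) (Exactly s) A ∧
    LateCovers Y ↑(Y \ X) s A with hP
  set full : Set (Piece V) → Set (Piece V) := fun A => {c | c ∈ A ∧ c.nbrs = (Y : Set V)} with hfull
  set P₀ : Set (Piece V) → Prop := fun A =>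
    AllPieces (fun N => ¬ N ⊆ (X : Set V) ∧ N ≠ Y) (Exactly s) A ∧ Covers ↑(Y \ X) A with hP₀
  have hcov : ∀ A B : Set (Piece V), B ⊆ A → P₀ B → LateCovers Y ↑(Y \ X) s A := by
    intro A B hBA hB
    refine Or.inl fun u hu => ?_
    obtain ⟨c, hc, huc⟩ := hB.2 u hu
    exact ⟨c, hBA hc, (hB.1 c hc).2.2, huc, (hB.1 c hc).1.2⟩
  have hzero : ∀ A, P₀ A ↔ P A ∧ full A = ∅ := by
    intro A
    constructor
    · intro h
      refine ⟨⟨fun c hc => ⟨(h.1 c hc).1.1, (h.1 c hc).2⟩, hcov A A subset_rfl h⟩, ?_⟩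
      exact Set.eq_empty_of_forall_notMem fun c hc => (h.1 c hc.1).1.2 hc.2
    · rintro ⟨⟨h1, h2⟩, h3⟩
      have hne : ∀ c ∈ A, c.nbrs ≠ (Y : Set V) := fun c hc he => by
        have : c ∈ full A := ⟨hc, he⟩
        rw [h3] at this
        exact this
      refine ⟨fun c hc => ⟨⟨(h1 c hc).1, hne c hc⟩, (h1 c hc).2⟩, fun u hu => ?_⟩
      rcases h2 with h2 | ⟨c, hc, -, -, -, ⟨-, h⟩, -⟩
      · obtain ⟨c, hc, -, h, -⟩ := h2 u hu
        exact ⟨c, hc, h⟩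
      · exact absurd h (hne c hc)
  have hsplit : (Fam ω (Y : Set V) K P).ncard = (Fam ω (Y : Set V) K P₀).ncard +
      (Fam ω (Y : Set V) K fun A => P A ∧ ∃ c, full A = {c}).ncard +
      (Fam ω (Y : Set V) K fun A => P A ∧ (full A).Nontrivial).ncard := by
    rw [← Set.ncard_union_eq, ← Set.ncard_union_eq]
    · congr 1
      ext G
      constructor
      · rintro ⟨h1, h2⟩
        rcases (full (prof G (Y : Set V) K)).eq_empty_or_nonempty with h | ⟨c, hc⟩
        · exact Or.inl (Or.inl ⟨h1, (hzero _).2 ⟨h2, h⟩⟩)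
        · by_cases hn : (full (prof G (Y : Set V) K)).Nontrivial
          · exact Or.inr ⟨h1, h2, hn⟩
          · exact Or.inl (Or.inr ⟨h1, h2, c,
              (Set.not_nontrivial_iff.1 hn).eq_singleton_of_mem hc⟩)
      · rintro ((⟨h1, h2⟩ | ⟨h1, h2, -⟩) | ⟨h1, h2, -⟩)
        · exact ⟨h1, ((hzero _).1 h2).1⟩
        · exact ⟨h1, h2⟩
        · exact ⟨h1, h2⟩
    · rw [Set.disjoint_left]
      rintro G (⟨-, h⟩ | ⟨-, -, c, h⟩) ⟨-, -, h'⟩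
      · rw [((hzero _).1 h).2] at h'
        exact Set.not_nontrivial_empty h'
      · rw [h] at h'
        exact Set.not_nontrivial_singleton h'
    · rw [Set.disjoint_left]
      rintro G ⟨-, h⟩ ⟨-, -, c, h'⟩
      rw [((hzero _).1 h).2] at h'
      exact Set.singleton_ne_empty c h'.symm
  have hsep : ∀ A B : Set (Piece V), (∀ c ∈ A, c.nbrs = (Y : Set V)) →
      (∀ c ∈ B, ¬ c.nbrs = (Y : Set V)) → full (A ∪ B) = A := by
    intro A B hA hB
    ext c
    exact ⟨fun h => h.1.resolve_right fun hc => hB c hc h.2, fun h => ⟨Or.inl h, hA c h⟩⟩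
  have hone : (Fam ω (Y : Set V) K fun A => P A ∧ ∃ c, full A = {c}).ncard =
      ∑ k' ∈ Finset.Icc 0 K.card,
        K.card.choose k' * (counters ω).gTildeOne s (X.card + (Y \ X).card) k' *
          (counters ω).fTildePZ t X.card (Y \ X).card (K.card - k') X.card := by
    rw [ncard_fam_split hK (P₁ := fun A => ∃ c, A = {c} ∧ c.nbrs = (Y : Set V) ∧ Exactly s c.dead)
      (P₂ := P₀) (fun c => c.nbrs = (Y : Set V))]
    · simp only [mul_assoc]
      rw [← sum_powerset_card K fun i => (counters ω).gTildeOne s (X.card + (Y \ X).card) i *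
        (counters ω).fTildePZ t X.card (Y \ X).card (K.card - i) X.card]
      refine Finset.sum_congr rfl fun W hW => ?_
      rw [ncard_fTildePZ hω (disjoint_sdiff hK W) subset_rfl hX ht hl,
        card_sdiff_of_mem_powerset hW, hc, ← ncard_single hω (disjoint_of_subset hK hW)]
      congr 2
      refine fam_congr fun G hG => ?_
      constructor
      · rintro ⟨c, h1, h2, h3⟩
        refine ⟨c.dead, h1.trans ?_, h3⟩
        rw [← h2, ← verts_eq_of_prof_eq hG h1]
      · rintro ⟨d, h1, h2⟩
        exact ⟨_, h1, rfl, h2⟩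
    · intro A B
      constructor
      · rintro ⟨⟨⟨h1, h2⟩, c, h3⟩, h4, h5⟩
        rw [hsep A B h4 h5] at h3
        subst h3
        refine ⟨⟨c, rfl, h4 c rfl, (h1 c (Or.inl rfl)).2⟩,
          fun b hb => ⟨⟨(h1 b (Or.inr hb)).1, h5 b hb⟩, (h1 b (Or.inr hb)).2⟩, fun u hu => ?_⟩
        rcases h2 with h2 | ⟨b, hb, b', hb', hne, ⟨-, h⟩, -, h'⟩
        · obtain ⟨b, hb, -, hu', hne⟩ := h2 u hu
          exact ⟨b, hb.resolve_left fun hb => hne (h4 b hb), hu'⟩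
        · have e1 := hb.resolve_right fun hb => h5 b hb h
          have e2 := hb'.resolve_right fun hb => h5 b' hb h'
          exact absurd (e1.trans e2.symm) hne
      · rintro ⟨⟨c, rfl, h1, h2⟩, h3⟩
        have h4 : ∀ b ∈ ({c} : Set (Piece V)), b.nbrs = (Y : Set V) := by
          rintro _ rfl
          exact h1
        have h5 : ∀ b ∈ B, ¬ b.nbrs = (Y : Set V) := fun b hb => (h3.1 b hb).1.2
        refine ⟨⟨⟨?_, hcov _ B Set.subset_union_right h3⟩, c, hsep _ _ h4 h5⟩, h4, h5⟩
        rintro b (hb | hb)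
        · rw [Set.mem_singleton_iff.1 hb]
          exact ⟨h1 ▸ hYX, h2⟩
        · exact ⟨(h3.1 b hb).1.1, (h3.1 b hb).2⟩
  have htwo : (Fam ω (Y : Set V) K fun A => P A ∧ (full A).Nontrivial).ncard =
      ∑ k' ∈ Finset.Icc 0 K.card,
        K.card.choose k' * (counters ω).gTildeTwo s (X.card + (Y \ X).card) k' *
          (counters ω).gTildeP s (X.card + (Y \ X).card) (K.card - k') X.card := by
    rw [ncard_fam_split hK
      (P₁ := fun A => AllPieces (fun N => N = (Y : Set V)) (Exactly s) A ∧ A.Nontrivial)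
      (P₂ := AllPieces (fun N => ¬ N ⊆ (X : Set V) ∧ N ≠ Y) (Exactly s))
      (fun c => c.nbrs = (Y : Set V))]
    · simp only [mul_assoc]
      rw [← sum_powerset_card K fun i => (counters ω).gTildeTwo s (X.card + (Y \ X).card) i *
        (counters ω).gTildeP s (X.card + (Y \ X).card) (K.card - i) X.card]
      refine Finset.sum_congr rfl fun W hW => ?_
      rw [ncard_gTildeTwo hω (disjoint_of_subset hK hW) (by omega),
        ncard_gTildeP hω (disjoint_sdiff hK W) hX (by omega), card_sdiff_of_mem_powerset hW, hc]
    · intro A B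
      constructor
      · rintro ⟨⟨⟨h1, h2⟩, h3⟩, h4, h5⟩
        rw [hsep A B h4 h5] at h3
        exact ⟨⟨fun c hc => ⟨h4 c hc, (h1 c (Or.inl hc)).2⟩, h3⟩,
          fun b hb => ⟨⟨(h1 b (Or.inr hb)).1, h5 b hb⟩, (h1 b (Or.inr hb)).2⟩⟩
      · rintro ⟨⟨h1, h2⟩, h3⟩
        have h4 : ∀ b ∈ A, b.nbrs = (Y : Set V) := fun b hb => (h1 b hb).1
        have h5 : ∀ b ∈ B, ¬ b.nbrs = (Y : Set V) := fun b hb => (h3 b hb).1.2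
        obtain ⟨c, hc, c', hc', hne⟩ := id h2
        refine ⟨⟨⟨?_, Or.inr ⟨c, Or.inl hc, c', Or.inl hc', hne, ⟨(h1 c hc).2.2, h4 c hc⟩,
          (h1 c' hc').2.2, h4 c' hc'⟩⟩, (hsep A B h4 h5).symm ▸ h2⟩, h4, h5⟩
        rintro b (hb | hb)
        · exact ⟨(h4 b hb) ▸ hYX, (h1 b hb).2⟩
        · exact ⟨(h3 b hb).1.1, (h3 b hb).2⟩
  rw [← ncard_fTilde hω hK hX ht hl, ← ncard_fTildePZ hω hK subset_rfl hX ht hl, ← hone, ← htwo]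
  exact hsplit

end Recurrences

end ChordalCount

namespace ChordalCount

/-! ### The recurrence for `g̃_1`: sorting by the last layer -/

section LastLayer

variable {V W : Type*} {ω t : ℕ}

/-- The graphs that evaporate at time `t` with exception set `X` and last layer `L`, where `X ∪ L` is
a clique and `G \ X` is connected. -/
def lastLayerSet (ω t : ℕ) (X L : Set V) : Set (SimpleGraph V) :=
  {G | Admissible ω G ∧ EvaporatesAt G X t ∧ layer G X t = L ∧ G.IsClique (X ∪ L) ∧
    ConnectedOff G X}

theorem alive_map (e : V ≃ W) (G : SimpleGraph V) (X : Set V) (i : ℕ) :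
    alive (G.map e.toEmbedding) (e '' X) i = e '' alive G X i := by
  ext w
  obtain ⟨v, rfl⟩ := e.surjective w
  rw [e.injective.mem_set_image]
  exact mem_alive_map e.toEmbedding i v

theorem admissible_map_iff (e : V ≃ W) (G : SimpleGraph V) :
    Admissible ω (G.map e.toEmbedding) ↔ Admissible ω G := by
  have φ : G ≃g G.map e.toEmbedding := SimpleGraph.Iso.map e G
  constructor
  · rintro ⟨h1, h2, h3⟩
    exact ⟨h1.of_hom φ.toHom, φ.connected_iff.2 h2, h3.of_map⟩
  · rintro ⟨h1, h2, h3⟩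
    exact ⟨h1.of_hom φ.symm.toHom, φ.connected_iff.1 h2, h3.map _⟩

theorem map_mem_lastLayerSet_iff (e : V ≃ W) (G : SimpleGraph V) (X L : Set V) :
    G.map e.toEmbedding ∈ lastLayerSet ω t (e '' X) (e '' L) ↔ G ∈ lastLayerSet ω t X L := by
  have hinj := e.injective.image_injective
  refine and_congr (admissible_map_iff e G) (and_congr ?_ (and_congr ?_ (and_congr ?_ ?_)))
  · simp only [EvaporatesAt, alive_map, hinj.eq_iff, ne_eq]
  · simp only [layer, alive_map]
    rw [← Set.image_sdiff e.injective, hinj.eq_iff]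
  · rw [← Set.image_union]
    exact map_isClique_iff e.toEmbedding
  · rw [connectedOff_iff, connectedOff_iff]
    have hc : ∀ v, comp (G.map e.toEmbedding) (e '' X) (e v) = e '' comp G X v :=
      comp_map e.toEmbedding
    simp only [← e.forall_congr_right, ← e.exists_congr_right, hc, e.injective.mem_set_image]

theorem ncard_lastLayerSet (e : V ≃ W) (X L : Set V) :
    (lastLayerSet ω t (e '' X) (e '' L)).ncard = (lastLayerSet ω t X L).ncard := by
  rw [← (SimpleGraph.map_injective e.toEmbedding).injOn.ncard_image (s := lastLayerSet ω t X L)]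
  congr 1
  ext H
  constructor
  · intro hH
    have hmap : (H.comap e).map e.toEmbedding = H := by
      ext a b
      obtain ⟨a, rfl⟩ := e.surjective a
      obtain ⟨b, rfl⟩ := e.surjective b
      exact SimpleGraph.map_adj_apply (f := e.toEmbedding)
    refine ⟨H.comap e, ?_, hmap⟩
    rwa [← map_mem_lastLayerSet_iff e, hmap]
  · rintro ⟨G, hG, rfl⟩
    exact (map_mem_lastLayerSet_iff e G X L).2 hG

/-- Forwards, `last_layer` makes the last layer a clique complete to the neighborhood of the only
component, which is `X`. Backwards, a vertex of `L` is adjacent to all of `X`, so the connected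
remainder sees all of `X`. -/
theorem mem_single_and_layer_iff {G : SimpleGraph V} {X L : Set V} (ht : 1 ≤ t) (hL : L.Nonempty)
    (hLX : L ⊆ Xᶜ) :
    (G ∈ Fam ω X Xᶜ (Single Xᶜ X (Exactly t)) ∧ layer G X t = L) ↔ G ∈ lastLayerSet ω t X L := by
  obtain ⟨i, rfl⟩ : ∃ i, t = i + 1 := ⟨t - 1, by omega⟩
  constructor
  · rintro ⟨hG, rfl⟩
    obtain ⟨⟨h1, h2, h3, -⟩, -⟩ := mem_single_iff.2 hG
    rw [evaporatesWithin_iff] at h3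
    obtain ⟨hB, d, hd, hE⟩ := hG
    have hpc : ∀ v ∉ X, piece G X v = ⟨Xᶜ, X, d⟩ := by
      intro v hv
      have : piece G X v ∈ prof G X Xᶜ := ⟨v, hv, rfl⟩
      rwa [hd] at this
    have hcomp : ∀ v ∉ X, comp G X v = Xᶜ := fun v hv => congrArg Piece.verts (hpc v hv)
    have hnb : ∀ v ∉ X, nbhd G (comp G X v) = X := fun v hv => congrArg Piece.nbrs (hpc v hv)
    obtain ⟨w, hw⟩ := hL
    have hwX : w ∉ X := hLX hw
    have hlast := last_layer (G := G) hwX (i := i) fun u hu => by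
      rw [h3]; exact notMem_of_mem_comp hwX hu
    rw [hnb w hwX, hcomp w hwX] at hlast
    have hLe : layer G X (i + 1) = Xᶜ ∩ alive G X i := by
      change alive G X i \ alive G X (i + 1) = _
      rw [h3, Set.sdiff_eq, Set.inter_comm]
    refine ⟨h1, ⟨h3, fun s hs hsX => ?_⟩, rfl, ?_, ?_⟩
    · rw [hLe] at hw
      exact hw.1 (hsX ▸ alive_antitone G X (by omega) hw.2)
    · rw [hLe]
      rintro a (ha | ha) b (hb | hb) hab
      · exact h2 ha hb hab
      · exact (hlast.2 b hb a ha).symm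
      · exact hlast.2 a ha b hb
      · exact hlast.1 ha hb hab
    · rw [connectedOff_iff]
      refine ⟨⟨w, hwX⟩, fun v hv u hu => ?_⟩
      rw [hcomp v hv]
      exact hu
  · rintro ⟨h1, ⟨h2, h3⟩, rfl, h4, h5⟩
    rw [connectedOff_iff] at h5
    obtain ⟨w, hw⟩ := hL
    have hwX : w ∉ X := hLX hw
    have hcomp : ∀ v ∉ X, comp G X v = Xᶜ := fun v hv =>
      Set.Subset.antisymm (fun u hu => notMem_of_mem_comp hv hu) fun u hu => h5.2 v hv u hu
    have hX : G.IsClique X := h4.subset Set.subset_union_left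
    refine ⟨⟨⟨fun a _ _ => by simp, hX, h1.chordal, h1.colorable⟩, (piece G X w).dead, ?_, ?_⟩,
      rfl⟩
    · have hp : ∀ v ∉ X, piece G X v = ⟨Xᶜ, X, (piece G X w).dead⟩ := by
        intro v hv
        refine Piece.ext (hcomp v hv) (Set.Subset.antisymm (nbhd_comp_subset hv) fun y hy => ?_) ?_
        · refine ⟨fun h => notMem_of_mem_comp hv h hy, w, h5.2 v hv w hwX, ?_⟩
          exact h4 (Or.inr hw) (Or.inl hy) (by rintro rfl; exact hwX hy)
        · simp only [piece, hcomp v hv, hcomp w hwX]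
      ext c
      constructor
      · rintro ⟨v, hv, rfl⟩
        exact hp v hv
      · rintro rfl
        exact ⟨w, hwX, hp w hwX⟩
    · refine ⟨fun u hu => ?_, fun hd => hd w (mem_comp_self _ _ _) hw.1⟩
      rw [h2]
      exact notMem_of_mem_comp hwX hu

theorem fSet_eq_lastLayerSet {x l k : ℕ} : fSet ω t x l k =
    lastLayerSet ω t (block (x + l + k) 0 x) (block (x + l + k) x (x + l)) := by
  have : block (x + l + k) 0 x ∪ block (x + l + k) x (x + l) = block (x + l + k) 0 (x + l) := by
    have h := Set.union_sdiff_cancel (block_mono (m := x + l + k) (Nat.le_add_right x l))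
    rwa [block_sdiff] at h
  ext G
  simp only [fSet, fCoreSet, lastLayerSet, Set.mem_ofPred_eq, this, and_assoc]

variable [DecidableEq V] {X L K : Finset V}

/-- The last layer is not recorded in the pieces, so `ncard_fam_transport` does not apply. The whole
graph is relabeled along a bijection, which is why `X ∪ K` has to be everything. -/
theorem ncard_lastLayerSet_eq_f [Fintype V] (hX : X ∪ K = Finset.univ) (hK : ∀ v ∈ K, v ∉ X)
    (hL : L ⊆ K) :
    (lastLayerSet ω t (X : Set V) L).ncard =
      (counters ω).f t X.card L.card (K.card - L.card) := by
  have hLX : Disjoint X L := by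
    rw [Finset.disjoint_right]
    exact fun v hv => hK v (hL hv)
  have hXL : (X ∪ L).card = X.card + L.card := Finset.card_union_of_disjoint hLX
  have hKL : (K \ L).card = K.card - L.card := Finset.card_sdiff_of_subset hL
  obtain ⟨φ, -, h₁, h₂, h₃⟩ := exists_block_embedding (subset_refl X)
    (Finset.subset_union_left : X ⊆ X ∪ L) (K := K \ L) (by
      intro v hv
      rw [Finset.mem_sdiff] at hv
      rw [Finset.mem_union, not_or]
      exact ⟨hK v hv.1, hv.2⟩) (m := X.card + L.card + (K.card - L.card)) (by omega)
  have hsurj : Function.Surjective φ := by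
    intro v
    have : v ∈ φ '' Set.univ := by
      rw [← Set.union_compl_self (block _ 0 (X ∪ L).card), Set.image_union, h₂, h₃,
        ← Finset.coe_union]
      have hv : v ∈ X ∪ K := hX ▸ Finset.mem_univ v
      simp only [Finset.coe_union, Finset.coe_sdiff, Set.mem_union, Set.mem_sdiff, Finset.mem_coe]
      rw [Finset.mem_union] at hv
      tauto
    obtain ⟨u, -, hu⟩ := this
    exact ⟨u, hu⟩
  set e := Equiv.ofBijective φ ⟨φ.injective, hsurj⟩ with he
  have e₁ : e '' block _ 0 X.card = X := h₁
  have e₂ : e '' block _ X.card (X.card + L.card) = L := by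
    have : φ '' block _ X.card (X.card + L.card) = ↑((X ∪ L) \ X) :=
      image_block_sdiff φ h₁ ((congrArg (fun i => φ '' block _ 0 i) hXL).symm.trans h₂)
    rw [Finset.union_sdiff_cancel_left hLX] at this
    exact this
  change _ = (fSet ω t X.card L.card (K.card - L.card)).ncard
  rw [fSet_eq_lastLayerSet, ← ncard_lastLayerSet e, e₁, e₂]

theorem card_gTildeOne_rec [Fintype V] (hω : 1 ≤ ω) (hX : X ∪ K = Finset.univ)
    (hK : ∀ v ∈ K, v ∉ X) (ht : 1 ≤ t) :
    (counters ω).gTildeOne t X.card K.card =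
      ∑ l ∈ Finset.Icc 1 K.card, K.card.choose l * (counters ω).f t X.card l (K.card - l) := by
  classical
  have hKX : (K : Set V) = (X : Set V)ᶜ := by
    ext v
    have hv : v ∈ X ∪ K := hX ▸ Finset.mem_univ v
    rw [Finset.mem_union] at hv
    have := hK v
    simp only [Finset.mem_coe, Set.mem_compl_iff]
    tauto
  rw [← ncard_single hω hK, ncard_eq_sum_fiber _ (fun G => K.filter (· ∈ layer G (X : Set V) t))
    (K.powerset.filter fun L => 1 ≤ L.card)]
  · have hterm : ∀ L ∈ K.powerset.filter (fun L => 1 ≤ L.card),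
        {G | G ∈ Fam ω (X : Set V) K (Single K X (Exactly t)) ∧
          K.filter (· ∈ layer G (X : Set V) t) = L}.ncard =
        (counters ω).f t X.card L.card (K.card - L.card) := by
      intro L hL
      obtain ⟨hLK, hL1⟩ := Finset.mem_filter.1 hL
      rw [Finset.mem_powerset] at hLK
      rw [← ncard_lastLayerSet_eq_f hX hK hLK]
      congr 1
      ext G
      have hLne : (L : Set V).Nonempty := Finset.card_pos.1 hL1
      rw [← mem_single_and_layer_iff ht hLne (by rw [← hKX]; exact hLK), ← hKX]
      refine and_congr_right fun _ => ?_
      have hlay : layer G (X : Set V) t ⊆ K := by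
        rintro v ⟨-, hv⟩
        rw [hKX]
        exact fun hvX => hv (subset_alive _ _ _ hvX)
      rw [← Finset.coe_inj, Finset.coe_filter]
      have : {x | x ∈ K ∧ x ∈ layer G (X : Set V) t} = layer G (X : Set V) t := by
        ext x
        exact ⟨And.right, fun h => ⟨hlay h, h⟩⟩
      rw [this]
    rw [Finset.sum_congr rfl hterm, Finset.sum_filter]
    have := sum_powerset_card K fun i => if 1 ≤ i then
      (counters ω).f t X.card i (K.card - i) else 0
    rw [this, sum_Icc_zero_eq (by simp)]
    refine Finset.sum_congr rfl fun i hi => ?_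
    rw [if_pos (Finset.mem_Icc.1 hi).1]
  · rintro G ⟨hB, d, hd, hE⟩
    -- What remains is that the last layer is nonempty: some vertex of the only component survives
    -- time `t - 1` and is gone at time `t`.
    simp only [Finset.mem_filter, Finset.mem_powerset, Finset.filter_subset, true_and]
    have hmem : (⟨K, X, d⟩ : Piece V) ∈ prof G (X : Set V) K := hd ▸ rfl
    obtain ⟨v, hv, hp⟩ := hmem
    have hp' : (piece G (X : Set V) v).dead = d := congrArg Piece.dead hp
    rw [← hp'] at hE
    have h2 := hE.2
    simp only [piece, not_forall, not_not] at h2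
    obtain ⟨u, hu, hua⟩ := h2
    have hverts : comp G (X : Set V) v = K := congrArg Piece.verts hp
    refine Finset.card_pos.2 ⟨u, Finset.mem_filter.2 ⟨?_, hua, hE.1 u hu⟩⟩
    rw [hverts] at hu
    exact hu

end LastLayer

end ChordalCount

namespace ChordalCount

/-! ### The counters satisfy the system -/

section Counters

variable {ω : ℕ}

/-- Provides sets with prescribed sizes, so that the recurrences for sets become recurrences for
numbers. -/
theorem exists_finsets {z x y : ℕ} (k : ℕ) (hzx : z ≤ x) (hxy : x ≤ y) :
    ∃ (m : ℕ) (Z X Y K : Finset (Fin m)), Z ⊆ X ∧ X ⊆ Y ∧ (∀ v ∈ K, v ∉ Y) ∧ Y ∪ K = Finset.univ ∧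
      Z.card = z ∧ X.card = x ∧ Y.card = y ∧ K.card = k := by
  obtain ⟨Y, -, hY⟩ := Finset.exists_subset_card_eq
    (s := (Finset.univ : Finset (Fin (y + k)))) (n := y) (by simp)
  obtain ⟨X, hXY, hX⟩ := Finset.exists_subset_card_eq (s := Y) (n := x) (by omega)
  obtain ⟨Z, hZX, hZ⟩ := Finset.exists_subset_card_eq (s := X) (n := z) (by omega)
  refine ⟨y + k, Z, X, Y, Yᶜ, hZX, hXY, fun v hv => Finset.mem_compl.1 hv, Finset.union_compl Y, hZ, hX,
    hY, ?_⟩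
  rw [Finset.card_compl, hY, Fintype.card_fin]
  omega

theorem exists_finset_pair (x k : ℕ) : ∃ (m : ℕ) (X K : Finset (Fin m)),
    (∀ v ∈ K, v ∉ X) ∧ X ∪ K = Finset.univ ∧ X.card = x ∧ K.card = k := by
  obtain ⟨m, -, -, X, K, -, -, h1, h2, -, -, h3, h4⟩ := exists_finsets k (Nat.zero_le x) le_rfl
  exact ⟨m, X, K, h1, h2, h3, h4⟩

theorem exists_finsets_sdiff {z x : ℕ} (l k : ℕ) (hzx : z ≤ x) :
    ∃ (m : ℕ) (Z X Y K : Finset (Fin m)), Z ⊆ X ∧ X ⊆ Y ∧ (∀ v ∈ K, v ∉ Y) ∧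
      Z.card = z ∧ X.card = x ∧ (Y \ X).card = l ∧ K.card = k := by
  obtain ⟨m, Z, X, Y, K, h1, h2, h3, -, h4, h5, h6, h7⟩ :=
    exists_finsets k hzx (Nat.le_add_right x l)
  have := card_add_card_sdiff h2
  exact ⟨m, Z, X, Y, K, h1, h2, h3, h4, h5, by omega, h7⟩

theorem prof_empty {V : Type*} (G : SimpleGraph V) (Y : Set V) : prof G Y ∅ = ∅ :=
  Set.image_empty _

theorem counters_g_zero (hω : 1 ≤ ω) {x z : ℕ} (k : ℕ) (hx : x ≤ ω) (hz : z < x) :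
    (counters ω).g 0 x k z = if k = 0 then 1 else 0 := by
  obtain ⟨m, Z, X, Y, K, hZ, hY, hK, -, rfl, -, rfl, rfl⟩ := exists_finsets k hz.le le_rfl
  rw [← ncard_g hω hK (hZ.trans hY) hz]
  split_ifs with hk
  · rw [Finset.card_eq_zero.1 hk]
    exact ncard_fam_empty hω hx fun c hc => absurd hc (Set.notMem_empty c)
  · obtain ⟨v, hv⟩ := Finset.nonempty_iff_ne_empty.2 fun h => hk (Finset.card_eq_zero.2 h)
    rw [Set.ncard_eq_zero (Set.toFinite _)]
    refine Set.eq_empty_of_forall_notMem fun G hG => ?_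
    exact (hG.2 _ ⟨v, hv, rfl⟩).2 v (mem_comp_self _ _ _) (Set.mem_univ v)

theorem counters_gTilde_zero (hω : 1 ≤ ω) {t x z : ℕ} (hx : x ≤ ω) (hz : z < x) :
    (counters ω).gTilde t x 0 z = 1 := by
  obtain ⟨m, Z, X, Y, K, hZ, hY, hK, -, rfl, -, rfl, hk⟩ := exists_finsets 0 hz.le le_rfl
  obtain rfl := Finset.card_eq_zero.1 hk
  have := ncard_gTilde (t := t) hω hK (hZ.trans hY) hz
  rw [Finset.card_empty] at this
  rw [← this]
  exact ncard_fam_empty hω hx fun c hc => absurd hc (Set.notMem_empty c)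

theorem counters_gTildeP_zero (hω : 1 ≤ ω) {t x z : ℕ} (hx : x ≤ ω) (hz : z < x) :
    (counters ω).gTildeP t x 0 z = 1 := by
  obtain ⟨m, Z, X, Y, K, hZ, hY, hK, -, rfl, -, rfl, hk⟩ := exists_finsets 0 hz.le le_rfl
  obtain rfl := Finset.card_eq_zero.1 hk
  have := ncard_gTildeP (t := t) hω hK (hZ.trans hY) hz
  rw [Finset.card_empty] at this
  rw [← this]
  exact ncard_fam_empty hω hx fun c hc => absurd hc (Set.notMem_empty c)

theorem counters_gTildeOne_zero (hω : 1 ≤ ω) {t k : ℕ} (x : ℕ) (h : t = 0 ∨ k = 0) :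
    (counters ω).gTildeOne t x k = 0 := by
  obtain ⟨m, X, K, hK, -, rfl, rfl⟩ := exists_finset_pair x k
  rw [← ncard_single hω hK, Set.ncard_eq_zero (Set.toFinite _)]
  refine Set.eq_empty_of_forall_notMem fun G hG => ?_
  obtain ⟨-, d, hd, hE⟩ := hG
  rcases h with rfl | h
  · exact hE.2 hE.1
  · rw [Finset.card_eq_zero.1 h, Finset.coe_empty, prof_empty] at hd
    exact Set.singleton_ne_empty _ hd.symm

theorem counters_gTildeTwo_zero (hω : 1 ≤ ω) {t x k : ℕ} (hx : 1 ≤ x) (h : t = 0 ∨ k = 0) :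
    (counters ω).gTildeTwo t x k = 0 := by
  obtain ⟨m, X, K, hK, -, rfl, rfl⟩ := exists_finset_pair x k
  rw [← ncard_gTildeTwo hω hK hx, Set.ncard_eq_zero (Set.toFinite _)]
  refine Set.eq_empty_of_forall_notMem fun G hG => ?_
  obtain ⟨-, h1, h2⟩ := hG
  obtain ⟨c, hc⟩ := h2.nonempty
  rcases h with rfl | h
  · exact (h1 c hc).2.2 (h1 c hc).2.1
  · rw [Finset.card_eq_zero.1 h, Finset.coe_empty, prof_empty] at hc
    exact hc

theorem exists_lastLayerSet_eq_f (ω t x l k : ℕ) : ∃ (m : ℕ) (X L K : Finset (Fin m)),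
    X ∪ K = Finset.univ ∧ (∀ v ∈ K, v ∉ X) ∧ L ⊆ K ∧ X.card = x ∧ L.card = l ∧ K.card = l + k ∧
      (counters ω).f t x l k = (lastLayerSet ω t (X : Set (Fin m)) L).ncard := by
  obtain ⟨m, X, K, h1, h2, h3, h4⟩ := exists_finset_pair x (l + k)
  obtain ⟨L, hL, h5⟩ := Finset.exists_subset_card_eq (s := K) (n := l) (by omega)
  refine ⟨m, X, L, K, h2, h1, hL, h3, h5, h4, ?_⟩
  rw [ncard_lastLayerSet_eq_f h2 h1 hL, h3, h4, h5, Nat.add_sub_cancel_left]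

theorem counters_f_of_lt {t x l : ℕ} (k : ℕ) (h : ω < x + l) : (counters ω).f t x l k = 0 := by
  obtain ⟨m, X, L, K, hXK, hK, hL, rfl, rfl, -, hf⟩ := exists_lastLayerSet_eq_f ω t x l k
  rw [hf, Set.ncard_eq_zero (Set.toFinite _)]
  refine Set.eq_empty_of_forall_notMem fun G hG => ?_
  have hc : G.IsClique ↑(X ∪ L) := by
    rw [Finset.coe_union]
    exact hG.2.2.2.1
  have := hc.card_le_of_colorable hG.1.colorable
  rw [Finset.card_union_of_disjoint (Finset.disjoint_right.2 fun v hv => hK v (hL hv))] at this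
  omega

theorem isChordal_top {V : Type*} [Finite V] : IsChordal (⊤ : SimpleGraph V) :=
  isChordal_of_simplicial fun _ ⟨v, hv⟩ => ⟨v, hv, fun _ _ _ _ hab => hab⟩

theorem top_mem_lastLayerSet {V : Type*} [Finite V] {X L : Set V} (hXL : X ∪ L = Set.univ)
    (hd : ∀ v ∈ L, v ∉ X) (hL : L.Nonempty) (hω : (⊤ : SimpleGraph V).Colorable ω) :
    ⊤ ∈ lastLayerSet ω 1 X L := by
  have hLX : ∀ v, v ∉ X → v ∈ L := fun v hv => by
    have : v ∈ X ∪ L := hXL ▸ Set.mem_univ v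
    exact this.resolve_left hv
  have h1 : alive (⊤ : SimpleGraph V) X 1 = X := by
    refine Set.Subset.antisymm (fun v hv => ?_) (subset_alive _ _ _)
    by_contra hvX
    exact hv.2 ⟨⟨Set.mem_univ v, fun a _ b _ hab => hab⟩, hvX⟩
  obtain ⟨w, hw⟩ := hL
  have : Nonempty V := ⟨w⟩
  refine ⟨⟨hω, SimpleGraph.connected_top, isChordal_top⟩, ⟨h1, fun s hs hs' => ?_⟩, ?_,
    fun a _ b _ hab => hab, connectedOff_iff.2 ⟨⟨w, hd w hw⟩, fun v hv u hu => ?_⟩⟩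
  · obtain rfl : s = 0 := by omega
    exact hd w hw (hs' ▸ Set.mem_univ w)
  · change Set.univ \ alive (⊤ : SimpleGraph V) X 1 = L
    rw [h1]
    ext v
    exact ⟨fun h => hLX v h.2, fun h => ⟨Set.mem_univ v, hd v h⟩⟩
  · by_cases huv : v = u
    · exact huv ▸ mem_comp_self _ _ _
    · exact mem_comp_of_adj (mem_comp_self _ _ _) huv hv hu

/-- If everything outside `X` evaporates in the first step, the last layer is the whole complement
of `X`. So `k = 0`, and the graph is complete. -/
theorem counters_f_one {x l : ℕ} (k : ℕ) (hl : 1 ≤ l) (h : x + l ≤ ω) :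
    (counters ω).f 1 x l k = if k = 0 then 1 else 0 := by
  obtain ⟨m, X, L, K, hXK, hK, hL, hX, hLl, hKl, hf⟩ := exists_lastLayerSet_eq_f ω 1 x l k
  have key : ∀ G ∈ lastLayerSet ω 1 (X : Set (Fin m)) L, K ⊆ L := by
    rintro G ⟨-, ⟨h1, -⟩, h2, -⟩ v hv
    change v ∈ (L : Set _)
    rw [← h2]
    refine ⟨Set.mem_univ v, ?_⟩
    rw [h1]
    exact hK v hv
  rw [hf]
  split_ifs with hk
  · subst hk
    have hLK : L = K := Finset.eq_of_subset_of_card_le hL (by omega)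
    subst hLK
    have hXL : (X : Set (Fin m)) ∪ L = Set.univ := by
      rw [← Finset.coe_union, hXK, Finset.coe_univ]
    rw [Set.ncard_eq_one]
    refine ⟨⊤, Set.eq_singleton_iff_unique_mem.2 ⟨?_, fun G hG => ?_⟩⟩
    · refine top_mem_lastLayerSet hXL hK (Finset.card_pos.1 (by omega)) ?_
      have hc := Finset.card_univ (α := Fin m)
      rw [← hXK, Finset.card_union_of_disjoint (Finset.disjoint_right.2 hK), hX, hLl] at hc
      exact (SimpleGraph.colorable_of_fintype _).mono (hc ▸ h)
    · have := hG.2.2.2.1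
      rw [hXL] at this
      ext a b
      exact ⟨fun hab => hab.ne, fun hab => this (Set.mem_univ a) (Set.mem_univ b) hab⟩
  · rw [Set.ncard_eq_zero (Set.toFinite _)]
    refine Set.eq_empty_of_forall_notMem fun G hG => ?_
    have := Finset.card_le_card (key G hG)
    omega

/-- Without vertices outside `Y` there are no pieces, so nothing can keep the nonempty last layer
from evaporating in the first step. -/
theorem counters_f_zero (hω : 1 ≤ ω) {t l : ℕ} (x : ℕ) (ht : 2 ≤ t) (hl : 1 ≤ l) :
    (counters ω).f t x l 0 = 0 := by
  obtain ⟨m, -, X, Y, K, -, hX, hK, -, rfl, rfl, hk⟩ := exists_finsets_sdiff l 0 (Nat.zero_le x)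
  have hf := ncard_f (K := K) hω hK hX ht hl
  rw [hk] at hf
  rw [← hf, Set.ncard_eq_zero (Set.toFinite _)]
  refine Set.eq_empty_of_forall_notMem fun G hG => ?_
  obtain ⟨u, hu⟩ := Finset.card_pos.1 hl
  have h := hG.2.2
  rw [Finset.card_eq_zero.1 hk, Finset.coe_empty, prof_empty] at h
  rcases h with h | ⟨c, hc, -⟩
  · obtain ⟨c, hc, -⟩ := h u hu
    exact hc
  · exact hc

/-- For `t = 1` the components would have to evaporate at time `0`, but by truncated subtraction the
layer of index `0` is empty. For `k = 0` there are no components. -/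
theorem not_lateComps {t x l k : ℕ} (h : t = 1 ∨ k = 0) (G : SimpleGraph (Fin (x + l + k))) :
    ¬ LateComps t x l k G := by
  rintro ⟨⟨C, hC⟩, hG⟩
  rcases h with rfl | rfl
  · obtain ⟨⟨v, hv, -⟩, -⟩ := hG C hC
    exact hv.2 hv.1
  · rw [compsOff_eq] at hC
    obtain ⟨v, hv, -⟩ := hC
    exact hv ⟨Nat.zero_le _, v.isLt⟩

theorem counters_fTilde_zero {t k : ℕ} (x l : ℕ) (h : t = 1 ∨ k = 0) :
    (counters ω).fTilde t x l k = 0 := by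
  change (fTildeSet ω t x l k).ncard = 0
  rw [Set.ncard_eq_zero (Set.toFinite _)]
  exact Set.eq_empty_of_forall_notMem fun G hG => not_lateComps h G hG.2

theorem counters_fTildePZ_zero {t k : ℕ} (x l z : ℕ) (h : t = 1 ∨ k = 0) :
    (counters ω).fTildePZ t x l k z = 0 := by
  change (fTildePZSet ω t x l k z).ncard = 0
  rw [Set.ncard_eq_zero (Set.toFinite _)]
  exact Set.eq_empty_of_forall_notMem fun G hG => not_lateComps h G hG.2.2.1

theorem satisfiesRecurrences_counters (hω : 1 ≤ ω) : SatisfiesRecurrences ω (counters ω) where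
  g_base x k z _ hx hz := counters_g_zero hω k hx hz
  g_rec t x k z _ _ hz := by
    obtain ⟨m, Z, X, Y, K, hZ, hY, hK, -, rfl, -, rfl, rfl⟩ := exists_finsets k hz.le le_rfl
    exact card_g_rec hω hK (hZ.trans hY) hz
  gTilde_base t x z _ _ hx hz := counters_gTilde_zero hω hx hz
  gTilde_rec t x k z _ _ hk hz := by
    obtain ⟨m, Z, X, Y, K, hZ, hY, hK, -, rfl, -, rfl, rfl⟩ := exists_finsets k hz.le le_rfl
    exact card_gTilde_rec hω hK (hZ.trans hY) hz hk
  gTildeP_base t x z _ _ hx hz := counters_gTildeP_zero hω hx hz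
  gTildeP_rec t x k z _ _ hk hz := by
    obtain ⟨m, Z, X, Y, K, hZ, hY, hK, -, rfl, -, rfl, rfl⟩ := exists_finsets k hz.le le_rfl
    exact card_gTildeP_rec hω hK (hZ.trans hY) hz hk
  gTildeOne_base t x k h := counters_gTildeOne_zero hω x h
  gTildeOne_rec t x k ht _ := by
    obtain ⟨m, X, K, hK, hX, rfl, rfl⟩ := exists_finset_pair x k
    exact card_gTildeOne_rec hω hX hK ht
  gTildeTwo_base t x k hx h := counters_gTildeTwo_zero hω hx h
  gTildeTwo_rec t x k _ hx hk := by
    obtain ⟨m, X, K, hK, -, rfl, rfl⟩ := exists_finset_pair x k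
    exact card_gTildeTwo_rec hω hK hx hk
  f_base_large t x l k _ _ h := counters_f_of_lt k h
  f_base_one x l k hl h := counters_f_one k hl h
  f_base_zero t x l ht hl _ := counters_f_zero hω x ht hl
  f_rec t x l k ht hl _ _ := by
    obtain ⟨m, -, X, Y, K, -, hX, hK, -, rfl, rfl, rfl⟩ := exists_finsets_sdiff l k (Nat.zero_le x)
    rw [card_f_rec hω hK hX ht hl]
    -- The counting argument also produces a summand for `k' = 0`; it vanishes by the base case of
    -- `f̃`.
    exact sum_Icc_zero_eq (by rw [counters_fTilde_zero _ _ (Or.inr rfl), mul_zero, zero_mul])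
  fTilde_base t x l k _ _ h := counters_fTilde_zero x l h
  fTilde_rec t x l k ht hl _ := by
    have hP : ∀ k, (counters ω).fTildeP t x l k = (counters ω).fTildePZ t x l k x :=
      fun k => congrArg Set.ncard fTildePSet_eq
    simp only [hP]
    obtain ⟨m, -, X, Y, K, -, hX, hK, -, rfl, rfl, rfl⟩ := exists_finsets_sdiff l k (Nat.zero_le x)
    rw [card_fTilde_rec hω hK hX ht hl]
    congr 1
    · congr 1
      exact sum_Icc_zero_eq (by rw [counters_gTildeOne_zero hω _ (Or.inr rfl), mul_zero, zero_mul])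
    · refine sum_Icc_zero_eq ?_
      rw [counters_gTildeTwo_zero hω (by omega) (Or.inr rfl), mul_zero, zero_mul]
  fTildeP_eq t x l k _ _ := congrArg Set.ncard fTildePSet_eq
  fTildePZ_base t x l k z _ _ _ h := counters_fTildePZ_zero x l z h
  fTildePZ_rec t x l k z ht hl hk hz := by
    obtain ⟨m, Z, X, Y, K, hZ, hX, hK, rfl, rfl, rfl, rfl⟩ := exists_finsets_sdiff l k hz
    exact card_fTildePZ_rec hω hK hZ hX ht hl hk

end Counters

/-! ### The number of connected chordal graphs as a sum over evaporation times -/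

section Total

variable {V : Type*} {ω : ℕ}

/-- By Dirac's theorem each step removes at least one vertex until nothing is left. -/
theorem alive_card_add_le [Finite V] {G : SimpleGraph V} (hG : IsChordal G) (i : ℕ) :
    alive G ∅ i = ∅ ∨ (alive G ∅ i).ncard + i ≤ Nat.card V := by
  induction i with
  | zero => right; simp [alive, Set.ncard_univ]
  | succ i ih =>
    rcases ih with h | h
    · left
      exact Set.subset_eq_empty (alive_succ_subset G ∅ i) h
    · by_cases he : alive G ∅ i ⊆ ∅
      · left
        exact Set.subset_eq_empty ((alive_succ_subset G ∅ i).trans he) rfl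
      · obtain ⟨v, hv, -⟩ := hG.exists_simplicial (alive G ∅ i) ∅ (by simp) he
        have : (alive G ∅ (i + 1)).ncard < (alive G ∅ i).ncard :=
          Set.ncard_lt_ncard ⟨alive_succ_subset G ∅ i, fun h =>
            (h hv.1).2 ⟨hv, Set.notMem_empty v⟩⟩
        right
        omega

theorem alive_card_eq_empty [Finite V] {G : SimpleGraph V} (hG : IsChordal G) :
    alive G ∅ (Nat.card V) = ∅ := by
  rcases alive_card_add_le hG (Nat.card V) with h | h
  · exact h
  · exact (Set.ncard_eq_zero (Set.toFinite _)).1 (by omega)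

theorem exists_evaporatesAt {G : SimpleGraph V} {X : Set V} {t : ℕ} (h : alive G X t = X) :
    ∃ s ≤ t, EvaporatesAt G X s := evaporatesWithin_iff.2 h

theorem evaporatesAt_unique {G : SimpleGraph V} {X : Set V} {s t : ℕ} (hs : EvaporatesAt G X s)
    (ht : EvaporatesAt G X t) : s = t := by
  rcases lt_trichotomy s t with h | h | h
  · exact absurd hs.1 (ht.2 s h)
  · exact h
  · exact absurd ht.1 (hs.2 t h)

/-- With empty exception set a connected graph has exactly one component, which trivially sees all
of the exception set. -/
theorem mem_fam_single_univ_iff [Nonempty V] {G : SimpleGraph V} {t : ℕ} (ht : 1 ≤ t) :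
    G ∈ Fam ω ∅ (∅ : Set V)ᶜ (Single (∅ : Set V)ᶜ ∅ (Exactly t)) ↔
      Admissible ω G ∧ EvaporatesAt G ∅ t := by
  rw [← mem_single_iff]
  constructor
  · rintro ⟨⟨h1, -, h3, h4⟩, h5⟩
    refine ⟨h1, ?_⟩
    obtain ⟨s, hs, hE⟩ := h3
    obtain ⟨C, hC⟩ := Set.ncard_eq_one.1 h5
    have : C ∈ compsOff G ∅ := hC ▸ rfl
    obtain ⟨⟨v, hv, hvC⟩, -⟩ := (h4 C this).1
    obtain rfl : s = t := by
      by_contra hne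
      exact (Set.notMem_empty v) (hE.1 ▸ alive_antitone G ∅ (show s ≤ t - 1 by omega) hv.1)
    exact hE
  · rintro ⟨h1, h2⟩
    have hcomp : ∀ v, comp G ∅ v = Set.univ := fun v =>
      Set.eq_univ_of_forall fun w => (connected_iff_comp_empty.1 h1.connected).2 v
        (Set.notMem_empty v) w (Set.notMem_empty w)
    have hoff : compsOff G ∅ = {Set.univ} := by
      rw [compsOff_eq]
      ext C
      constructor
      · rintro ⟨v, -, rfl⟩
        exact hcomp v
      · rintro rfl
        obtain ⟨v⟩ := ‹Nonempty V›
        exact ⟨v, Set.notMem_empty v, hcomp v⟩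
    refine ⟨⟨h1, by simp, ⟨t, le_rfl, h2⟩, ?_⟩, by rw [hoff, Set.ncard_singleton]⟩
    rw [hoff]
    rintro C rfl
    refine ⟨(setEvaporatesAt_iff (T := t) fun u _ => by rw [h2.1]; exact Set.notMem_empty u).2
      ⟨fun u _ => by rw [h2.1]; exact Set.notMem_empty u, fun h => ?_⟩, Set.empty_subset _⟩
    refine h2.2 (t - 1) (by omega) (Set.eq_empty_of_forall_notMem fun u hu => h u trivial hu)

theorem connChordalCount_eq_sum (hω : 1 ≤ ω) {n : ℕ} (hn : 1 ≤ n) :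
    connChordalCount ω n = ∑ t ∈ Finset.Icc 1 n, (counters ω).gTildeOne t 0 n := by
  classical
  have : Nonempty (Fin n) := ⟨⟨0, hn⟩⟩
  have hterm : ∀ t ∈ Finset.Icc 1 n, (counters ω).gTildeOne t 0 n =
      {G : SimpleGraph (Fin n) | G ∈ {G | Admissible ω G} ∧
        -- The default value `0` lies outside the range of `t` and so belongs to no summand.
        (if h : ∃ s, EvaporatesAt G ∅ s then h.choose else 0) = t}.ncard := by
    intro t ht
    have h := ncard_single (ω := ω) (t := t) (Y := (∅ : Finset (Fin n))) (K := Finset.univ) hω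
      fun v _ => Finset.notMem_empty v
    rw [Finset.card_empty, Finset.card_univ, Fintype.card_fin, Finset.coe_univ, Finset.coe_empty,
      ← Set.compl_empty] at h
    rw [← h]
    congr 1
    ext G
    have ht1 := (Finset.mem_Icc.1 ht).1
    rw [mem_fam_single_univ_iff ht1]
    refine and_congr_right fun hG => ?_
    constructor
    · intro hE
      have hex : ∃ s, EvaporatesAt G ∅ s := ⟨t, hE⟩
      rw [dif_pos hex]
      exact evaporatesAt_unique hex.choose_spec hE
    · intro hE
      split_ifs at hE with hex
      · exact hE ▸ hex.choose_spec
      · omega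
  rw [Finset.sum_congr rfl hterm]
  refine ncard_eq_sum_fiber _ _ _ fun G hG => ?_
  have hal := alive_card_eq_empty hG.chordal
  rw [Nat.card_eq_fintype_card, Fintype.card_fin] at hal
  obtain ⟨s, hs, hE⟩ := exists_evaporatesAt hal
  have hex : ∃ s, EvaporatesAt G ∅ s := ⟨s, hE⟩
  rw [dif_pos hex, evaporatesAt_unique hex.choose_spec hE, Finset.mem_Icc]
  refine ⟨Nat.one_le_iff_ne_zero.2 ?_, hs⟩
  rintro rfl
  exact Set.empty_ne_univ hE.1.symm

/-- The bound on the number of colors is irrelevant if it is at least the number of vertices. -/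
theorem connChordalCount_min (ω n : ℕ) : connChordalCount (min n ω) n = connChordalCount ω n := by
  refine congrArg Set.ncard (Set.ext fun G => ?_)
  have hn : G.Colorable n := by
    have := G.colorable_of_fintype
    rwa [Fintype.card_fin] at this
  refine ⟨fun h => ⟨h.colorable.mono (min_le_right _ _), h.connected, h.chordal⟩, fun h =>
    ⟨?_, h.connected, h.chordal⟩⟩
  rcases min_choice n ω with e | e
  · rw [e]; exact hn
  · rw [e]; exact h.colorable

end Total

end ChordalCount

namespace ChordalCount

/-! ### Indicators in truncated arithmetic -/

section Indicator

/-- The indicator of `a ≤ b`. -/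
def ind (a b : ℕ) : ℕ := 1 - (a - b)

theorem ind_of_le {a b : ℕ} (h : a ≤ b) : ind a b = 1 := by
  rw [ind, Nat.sub_eq_zero_of_le h]

theorem ind_of_lt {a b : ℕ} (h : b < a) : ind a b = 0 := by
  rw [ind]
  omega

theorem ind_eq (a b : ℕ) : ind a b = if a ≤ b then 1 else 0 := by
  split_ifs with h
  · exact ind_of_le h
  · exact ind_of_lt (not_le.1 h)

theorem sum_range_ind_zero {N : ℕ} (hN : 0 < N) (F : ℕ → ℕ) (h : ∀ b, 0 < b → F b = 0) :
    ∑ b ∈ Finset.range N, F b = F 0 :=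
  Finset.sum_eq_single_of_mem 0 (Finset.mem_range.2 hN) fun b _ hb => h b (Nat.pos_of_ne_zero hb)

/-- Brings sums with varying limits into the uniform range `0, …, N - 1` of the program's loops;
indicators in `G` do the cutting off. -/
theorem sum_Icc_eq_range {N p q : ℕ} (hq : q < N) {F G : ℕ → ℕ}
    (h : ∀ a, p ≤ a → a ≤ q → F a = G a) (h₀ : ∀ a, a < p ∨ q < a → G a = 0) :
    ∑ a ∈ Finset.Icc p q, F a = ∑ a ∈ Finset.range N, G a := by
  rw [← Finset.sum_subset (f := G) (s₁ := Finset.Icc p q) (s₂ := Finset.range N)]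
  · exact Finset.sum_congr rfl fun a ha => h a (Finset.mem_Icc.1 ha).1 (Finset.mem_Icc.1 ha).2
  · intro a ha
    rw [Finset.mem_Icc] at ha
    exact Finset.mem_range.2 (by omega)
  · intro a _ ha
    rw [Finset.mem_Icc] at ha
    exact h₀ a (by omega)

end Indicator

/-! ### The tables of the program

All tables have the five arguments `t, x, l, k, z`; the arguments that do not occur are ignored. The
tables with numbers `2, …, 9` are `f̃_p`, `f̃`, `f`, `g̃_1`, `g̃`, `g̃_p`, `g̃_{≥2}` and `g`, extended by
zero. There are two auxiliary tables: the binomial coefficients and a partial sum in the recurrence for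
`f̃_p`, which keeps the number of operations in `O(n ^ 7)`. -/

section TableValues

variable (w : ℕ) (T : Tables)

/-- The contents of the tables. -/
def tableVal : ℕ → ℕ → ℕ → ℕ → ℕ → ℕ → ℕ
  | 0, _, x, _, k, _ => k.choose x
  | 1, t, x, l, k, _ => if x + l ≤ w then
      ∑ a ∈ Finset.Icc 0 x, x.choose a * T.gTildeOne (t - 1) (a + l) k else 0
  | 2, t, x, l, k, z => if 2 ≤ t ∧ 1 ≤ l ∧ z ≤ x ∧ x + l ≤ w then T.fTildePZ t x l k z else 0
  | 3, t, x, l, k, _ => if 2 ≤ t ∧ 1 ≤ l ∧ x + l ≤ w then T.fTilde t x l k else 0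
  | 4, t, x, l, k, _ => if 1 ≤ t ∧ 1 ≤ l ∧ x + l ≤ w then T.f t x l k else 0
  | 5, t, x, _, k, _ => T.gTildeOne t x k
  | 6, t, x, _, k, z => if 1 ≤ t ∧ z < x ∧ x ≤ w then T.gTilde t x k z else 0
  | 7, t, x, _, k, z => if 1 ≤ t ∧ z < x ∧ x ≤ w then T.gTildeP t x k z else 0
  | 8, t, x, _, k, _ => if 1 ≤ x then T.gTildeTwo t x k else 0
  | 9, t, x, _, k, z => if z < x ∧ x ≤ w then T.g t x k z else 0
  | _, _, _, _, _, _ => 0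

/-- The contribution of `a, b` to the entry `t, x, l, k, z` of the tables, in terms of the entries
`L` that are already known. -/
def term (L : ℕ → ℕ → ℕ → ℕ → ℕ → ℕ → ℕ) (w t x l k z a b : ℕ) : ℕ → ℕ
  | 0 => ind a 0 * ind b 0 * (ind k 0 * ind x 0 +
      ind 1 k * (ind 1 x * L 0 t (x - 1) l (k - 1) z + L 0 t x l (k - 1) z))
  | 1 => ind (x + l) w * (ind 1 t * ind a x * ind b 0 * (L 0 t a 0 x 0 * L 5 (t - 1) (a + l) 0 k 0))
  | 2 => ind 2 t * ind 1 l * ind z x * ind (x + l) w * (ind 1 a * ind a k * (L 0 t (a - 1) 0 (k - 1) 0 *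
      (ind 1 b * ind b x *
          ((L 0 t b 0 x 0 - L 0 t b 0 z 0) * L 5 (t - 1) b 0 a 0 * L 2 t x l (k - a) z) +
        ind 1 b * ind (b + 1) l * (L 0 t b 0 l 0 * L 1 t x b a 0 * L 2 t (x + b) (l - b) (k - a) z) +
        ind (b + 1) x *
          (L 0 t b 0 x 0 * L 5 (t - 1) (b + l) 0 a 0 * L 7 (t - 1) (x + l) 0 (k - a) z))))
  | 3 => ind 2 t * ind 1 l * ind (x + l) w * (ind b 0 * ind a k * (ind a 0 * L 2 t x l k x +
      ind 1 a * (L 0 t a 0 k 0 * (L 5 (t - 1) (x + l) 0 a 0 * L 2 t x l (k - a) x +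
        L 8 (t - 1) (x + l) 0 a 0 * L 7 (t - 1) (x + l) 0 (k - a) x))))
  | 4 => ind 1 l * ind (x + l) w * (ind b 0 * (ind 1 t * ind t 1 * ind a 0 * ind k 0 +
      ind 2 t * ind 1 a * ind a k *
        (L 0 t a 0 k 0 * L 3 t x l a 0 * L 9 (t - 2) (x + l) 0 (k - a) x)))
  | 5 => ind b 0 * ind 1 a * ind a k * (L 0 t a 0 k 0 * L 4 t x a (k - a) 0)
  | 6 => ind 1 t * ind (z + 1) x * ind x w * (ind k 0 * ind a 0 * ind b 0 +
      ind 1 a * ind a k * (ind 1 b * ind b x * ((L 0 t b 0 x 0 - L 0 t b 0 z 0) *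
        L 0 t (a - 1) 0 (k - 1) 0 * L 5 t b 0 a 0 * L 6 t x 0 (k - a) z)))
  | 7 => ind 1 t * ind (z + 1) x * ind x w * (ind k 0 * ind a 0 * ind b 0 +
      ind 1 a * ind a k * (ind 1 b * ind (b + 1) x * ((L 0 t b 0 x 0 - L 0 t b 0 z 0) *
        L 0 t (a - 1) 0 (k - 1) 0 * L 5 t b 0 a 0 * L 7 t x 0 (k - a) z)))
  | 8 => ind 1 x * (ind b 0 * ind 1 a * ind (a + 1) k * (L 0 t (a - 1) 0 (k - 1) 0 *
      L 5 t x 0 a 0 * (L 5 t x 0 (k - a) 0 + L 8 t x 0 (k - a) 0)))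
  | 9 => ind (z + 1) x * ind x w * (ind b 0 * (ind t 0 * ind k 0 * ind a 0 +
      ind 1 t * ind a k * (L 0 t a 0 k 0 * L 6 t x 0 a z * L 9 (t - 1) x 0 (k - a) z)))
  | _ => 0

/-- The entries that are needed for row `k` of table `i` at time `t` are known. -/
def Known (N i t k : ℕ) (L : ℕ → ℕ → ℕ → ℕ → ℕ → ℕ → ℕ) : Prop :=
  ∀ i' t' x l k' z, i' < 10 → x < N → l < N → k' < N → z < N →
    (t' < t ∨ t' = t ∧ (i' < i ∨ i' = i ∧ k' < k)) → L i' t' x l k' z = tableVal w T i' t' x l k' z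

variable {w T} {N i t k : ℕ} {L : ℕ → ℕ → ℕ → ℕ → ℕ → ℕ → ℕ}

theorem Known.choose (h : Known w T N i t k L) (hi : 0 < i) {p q : ℕ} (hp : p < N) (hq : q < N) :
    L 0 t q 0 p 0 = p.choose q :=
  h 0 t q 0 p 0 (by omega) hq (by omega) hp (by omega) (by omega)

variable {x l z : ℕ}

/-- Pascal's rule, placed entirely in the summand `a = b = 0`. The binomials are recomputed for each
`t`, so that every reference to them stays within the current round. -/
theorem sum_term_choose (hx : x < N) (hk : k < N) (hl : l < N) (hz : z < N)
    (hL : Known w T N 0 t k L) :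
    ∑ a ∈ Finset.range N, ∑ b ∈ Finset.range N, term L w t x l k z a b 0 =
      tableVal w T 0 t x l k z := by
  rw [sum_range_ind_zero (by omega), sum_range_ind_zero (by omega)]
  · simp only [term, tableVal, ind_of_le le_rfl, one_mul]
    rcases k with _ | k
    · rcases x with _ | x
      · simp [ind]
      · simp [ind]
    · rw [ind_of_le (show 1 ≤ k + 1 by omega), ind_of_lt (show 0 < k + 1 by omega), Nat.add_sub_cancel,
        hL 0 t x l k z (by omega) hx hl (by omega) hz (by omega)]
      rcases x with _ | x
      · simp [ind, tableVal]
      · rw [Nat.add_sub_cancel,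
          hL 0 t x l k z (by omega) (by omega) hl (by omega) hz (by omega), Nat.choose_succ_succ]
        simp [ind, tableVal]
  · intro b hb
    simp [term, ind_of_lt hb]
  · intro a ha
    simp [term, ind_of_lt ha]


theorem sum_term_partial (hT : SatisfiesRecurrences w T) (hw : w < N) (hx : x < N) (hk : k < N)
    (hL : Known w T N 1 t k L) :
    ∑ a ∈ Finset.range N, ∑ b ∈ Finset.range N, term L w t x l k z a b 1 =
      tableVal w T 1 t x l k z := by
  by_cases h : x + l ≤ w
  · rw [tableVal, if_pos h]
    refine (sum_Icc_eq_range hx (fun a _ ha => ?_) fun a ha => ?_).symm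
    · rw [sum_range_ind_zero (by omega) _ fun b hb => by simp [term, ind_of_lt hb]]
      simp only [term, ind_of_le h, ind_of_le ha, ind_of_le (le_refl 0), one_mul, mul_one]
      -- At `t = 0` the index `t - 1` is truncated to `0`, which would refer to a later table of the
      -- same round. The indicator removes this summand, and the true value is zero as well.
      rcases Nat.eq_zero_or_pos t with rfl | ht
      · rw [hT.gTildeOne_base _ _ _ (Or.inl rfl), ind_of_lt one_pos, zero_mul, mul_zero]
      · rw [ind_of_le ht, one_mul, hL.choose one_pos hx (by omega),
          hL 5 (t - 1) (a + l) 0 k 0 (by omega) (by omega) (by omega) hk (by omega) (by omega)]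
        rfl
    · refine Finset.sum_eq_zero fun b _ => ?_
      simp [term, ind_of_lt (show x < a by omega)]
  · simp [tableVal, h, term, ind_of_lt (not_le.1 h)]

/-- Cutting off the table of `f` at clique size `w` is harmless because `f` vanishes beyond it. -/
theorem sum_term_gTildeOne (hT : SatisfiesRecurrences w T) (hk : k < N) (hx : x < N)
    (hL : Known w T N 5 t k L) :
    ∑ a ∈ Finset.range N, ∑ b ∈ Finset.range N, term L w t x l k z a b 5 =
      tableVal w T 5 t x l k z := by
  have key : T.gTildeOne t x k =
      ∑ l ∈ Finset.Icc 1 k, k.choose l * tableVal w T 4 t x l (k - l) 0 := by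
    by_cases h : t = 0 ∨ k = 0
    · rw [hT.gTildeOne_base _ _ _ h]
      symm
      refine Finset.sum_eq_zero fun l hl => ?_
      rw [Finset.mem_Icc] at hl
      rw [tableVal, if_neg (by omega), mul_zero]
    · rw [hT.gTildeOne_rec t x k (by omega) (by omega)]
      refine Finset.sum_congr rfl fun l hl => ?_
      rw [Finset.mem_Icc] at hl
      by_cases hxl : x + l ≤ w
      · rw [tableVal, if_pos (by omega)]
      · rw [tableVal, if_neg (by omega), hT.f_base_large t x l _ (by omega) hl.1 (by omega)]
  rw [tableVal, key]
  refine (sum_Icc_eq_range hk (fun a ha ha' => ?_) fun a ha => ?_).symm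
  · rw [sum_range_ind_zero (by omega) _ fun b hb => by simp [term, ind_of_lt hb]]
    simp only [term, ind_of_le ha, ind_of_le ha', ind_of_le (le_refl 0), one_mul]
    rw [hL.choose (by omega) hk (by omega),
      hL 4 t x a (k - a) 0 (by omega) hx (by omega) (by omega) (by omega) (by omega)]
  · refine Finset.sum_eq_zero fun b _ => ?_
    rcases ha with ha | ha <;> simp [term, ind_of_lt ha]

theorem sum_term_gTildeTwo (hT : SatisfiesRecurrences w T) (hk : k < N) (hx : x < N)
    (hL : Known w T N 8 t k L) :
    ∑ a ∈ Finset.range N, ∑ b ∈ Finset.range N, term L w t x l k z a b 8 =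
      tableVal w T 8 t x l k z := by
  by_cases h : 1 ≤ x
  · have key : T.gTildeTwo t x k = ∑ a ∈ Finset.Icc 1 (k - 1), (k - 1).choose (a - 1) *
        T.gTildeOne t x a * (T.gTildeOne t x (k - a) + T.gTildeTwo t x (k - a)) := by
      by_cases h' : t = 0 ∨ k = 0
      · rw [hT.gTildeTwo_base _ _ _ h h']
        symm
        refine Finset.sum_eq_zero fun a ha => ?_
        rw [Finset.mem_Icc] at ha
        rw [hT.gTildeOne_base t _ a (by omega), mul_zero, zero_mul]
      · exact hT.gTildeTwo_rec t x k (by omega) h (by omega)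
    rw [tableVal, if_pos h, key]
    refine (sum_Icc_eq_range (by omega) (fun a ha ha' => ?_) fun a ha => ?_).symm
    · rw [sum_range_ind_zero (by omega) _ fun b hb => by simp [term, ind_of_lt hb]]
      simp only [term, ind_of_le h, ind_of_le ha, ind_of_le (show a + 1 ≤ k by omega),
        ind_of_le (le_refl 0), one_mul]
      rw [hL.choose (by omega) (by omega) (by omega),
        hL 5 t x 0 a 0 (by omega) hx (by omega) (by omega) (by omega) (by omega),
        hL 5 t x 0 (k - a) 0 (by omega) hx (by omega) (by omega) (by omega) (by omega),
        hL 8 t x 0 (k - a) 0 (by omega) hx (by omega) (by omega) (by omega) (by omega)]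
      simp only [tableVal, if_pos h]
    · refine Finset.sum_eq_zero fun b _ => ?_
      rcases ha with ha | ha
      · simp [term, ind_of_lt ha]
      · simp [term, ind_of_lt (show k < a + 1 by omega)]
  · simp [tableVal, h, term, ind_of_lt (not_le.1 h)]

theorem sum_term_g (hT : SatisfiesRecurrences w T) (hk : k < N) (hx : x < N) (hz : z < N)
    (hL : Known w T N 9 t k L) :
    ∑ a ∈ Finset.range N, ∑ b ∈ Finset.range N, term L w t x l k z a b 9 =
      tableVal w T 9 t x l k z := by
  by_cases h : z < x ∧ x ≤ w
  · have hg : ind (z + 1) x * ind x w = 1 := by rw [ind_of_le h.1, ind_of_le h.2]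
    rw [tableVal, if_pos h]
    rcases Nat.eq_zero_or_pos t with rfl | ht
    · rw [hT.g_base x k z (by omega) h.2 h.1, sum_range_ind_zero (by omega),
        sum_range_ind_zero (by omega)]
      · simp only [term, hg, ind_of_le (le_refl 0), ind_of_lt one_pos, one_mul, zero_mul,
          add_zero, mul_one]
        simp only [ind_eq, Nat.le_zero]
      · intro b hb
        simp [term, ind_of_lt hb]
      · intro a ha
        simp [term, ind_of_lt ha, ind_of_lt one_pos]
    · rw [hT.g_rec t x k z ht (by omega) h.1]
      refine (sum_Icc_eq_range hk (fun a _ ha => ?_) fun a ha => ?_).symm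
      · rw [sum_range_ind_zero (by omega) _ fun b hb => by simp [term, ind_of_lt hb]]
        simp only [term, hg, ind_of_le ha, ind_of_le ht, ind_of_lt ht, ind_of_le (le_refl 0),
          one_mul, zero_mul, zero_add]
        rw [hL.choose (by omega) hk (by omega),
          hL 6 t x 0 a z (by omega) hx (by omega) (by omega) hz (by omega),
          hL 9 (t - 1) x 0 (k - a) z (by omega) hx (by omega) (by omega) hz (by omega)]
        simp only [tableVal]
        rw [if_pos ⟨ht, h⟩, if_pos h]
      · refine Finset.sum_eq_zero fun b _ => ?_
        simp [term, ind_of_lt (show k < a by omega), ind_of_lt (show 0 < a by omega)]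
  · have hg : ind (z + 1) x * ind x w = 0 := by
      simp only [ind_eq]
      grind
    simp [tableVal, h, term, hg]

theorem sum_term_gTilde (hT : SatisfiesRecurrences w T) (hk : k < N) (hx : x < N) (hz : z < N)
    (hL : Known w T N 6 t k L) :
    ∑ a ∈ Finset.range N, ∑ b ∈ Finset.range N, term L w t x l k z a b 6 =
      tableVal w T 6 t x l k z := by
  by_cases h : 1 ≤ t ∧ z < x ∧ x ≤ w
  · have hg : ind 1 t * ind (z + 1) x * ind x w = 1 := by
      rw [ind_of_le h.1, ind_of_le h.2.1, ind_of_le h.2.2]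
    rw [tableVal, if_pos h]
    rcases Nat.eq_zero_or_pos k with rfl | hk0
    · rw [hT.gTilde_base t x z h.1 (by omega) h.2.2 h.2.1, sum_range_ind_zero (by omega),
        sum_range_ind_zero (by omega)]
      · rw [term, hg]
        simp [ind]
      · intro b hb
        simp [term, ind_of_lt hb, ind_of_lt one_pos]
      · intro a ha
        simp [term, ind_of_lt ha]
    · rw [hT.gTilde_rec t x k z h.1 (by omega) hk0 h.2.1]
      refine (sum_Icc_eq_range hk (fun a ha ha' => ?_) fun a ha => ?_).symm
      · refine sum_Icc_eq_range hx (fun b hb hb' => ?_) fun b hb => ?_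
        · simp only [term, hg, ind_of_le ha, ind_of_le ha', ind_of_le hb, ind_of_le hb',
            ind_of_lt hk0, one_mul, zero_mul, zero_add]
          rw [hL.choose (by omega) hx (by omega), hL.choose (by omega) hz (by omega),
            hL.choose (by omega) (by omega) (by omega),
            hL 5 t b 0 a 0 (by omega) (by omega) (by omega) (by omega) (by omega) (by omega),
            hL 6 t x 0 (k - a) z (by omega) hx (by omega) (by omega) hz (by omega)]
          simp only [tableVal]
          rw [if_pos h]
        · rcases hb with hb | hb <;> simp [term, ind_of_lt hb, ind_of_lt hk0]
      · refine Finset.sum_eq_zero fun b _ => ?_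
        rcases ha with ha | ha <;> simp [term, ind_of_lt ha, ind_of_lt hk0]
  · have hg : ind 1 t * ind (z + 1) x * ind x w = 0 := by
      simp only [ind_eq]
      grind
    simp [tableVal, h, term, hg]

theorem sum_term_gTildeP (hT : SatisfiesRecurrences w T) (hk : k < N) (hx : x < N) (hz : z < N)
    (hL : Known w T N 7 t k L) :
    ∑ a ∈ Finset.range N, ∑ b ∈ Finset.range N, term L w t x l k z a b 7 =
      tableVal w T 7 t x l k z := by
  by_cases h : 1 ≤ t ∧ z < x ∧ x ≤ w
  · have hg : ind 1 t * ind (z + 1) x * ind x w = 1 := by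
      rw [ind_of_le h.1, ind_of_le h.2.1, ind_of_le h.2.2]
    rw [tableVal, if_pos h]
    rcases Nat.eq_zero_or_pos k with rfl | hk0
    · rw [hT.gTildeP_base t x z h.1 (by omega) h.2.2 h.2.1, sum_range_ind_zero (by omega),
        sum_range_ind_zero (by omega)]
      · rw [term, hg]
        simp [ind]
      · intro b hb
        simp [term, ind_of_lt hb, ind_of_lt one_pos]
      · intro a ha
        simp [term, ind_of_lt ha]
    · rw [hT.gTildeP_rec t x k z h.1 (by omega) hk0 h.2.1]
      refine (sum_Icc_eq_range hk (fun a ha ha' => ?_) fun a ha => ?_).symm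
      · refine sum_Icc_eq_range (by omega) (fun b hb hb' => ?_) fun b hb => ?_
        · simp only [term, hg, ind_of_le ha, ind_of_le ha', ind_of_le hb,
            ind_of_le (show b + 1 ≤ x by omega), ind_of_lt hk0, one_mul, zero_mul, zero_add]
          rw [hL.choose (by omega) hx (by omega), hL.choose (by omega) hz (by omega),
            hL.choose (by omega) (by omega) (by omega),
            hL 5 t b 0 a 0 (by omega) (by omega) (by omega) (by omega) (by omega) (by omega),
            hL 7 t x 0 (k - a) z (by omega) hx (by omega) (by omega) hz (by omega)]
          simp only [tableVal]
          rw [if_pos h]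
        · rcases hb with hb | hb
          · simp [term, ind_of_lt hb, ind_of_lt hk0]
          · simp [term, ind_of_lt (show x < b + 1 by omega), ind_of_lt hk0]
      · refine Finset.sum_eq_zero fun b _ => ?_
        rcases ha with ha | ha <;> simp [term, ind_of_lt ha, ind_of_lt hk0]
  · have hg : ind 1 t * ind (z + 1) x * ind x w = 0 := by
      simp only [ind_eq]
      grind
    simp [tableVal, h, term, hg]

/-- Time `1` is the base case. For `t ≥ 2` the summands use `f̃` from the same round and `g` from
two rounds earlier. -/
theorem sum_term_f (hT : SatisfiesRecurrences w T) (hw : w < N) (hk : k < N) (hx : x < N)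
    (hl : l < N) (hL : Known w T N 4 t k L) :
    ∑ a ∈ Finset.range N, ∑ b ∈ Finset.range N, term L w t x l k z a b 4 =
      tableVal w T 4 t x l k z := by
  by_cases h : 1 ≤ t ∧ 1 ≤ l ∧ x + l ≤ w
  · obtain ⟨ht, hl1, hxl⟩ := h
    have hg : ind 1 l * ind (x + l) w = 1 := by rw [ind_of_le hl1, ind_of_le hxl]
    rw [tableVal, if_pos ⟨ht, hl1, hxl⟩]
    rcases Nat.lt_or_ge t 2 with ht2 | ht2
    · obtain rfl : t = 1 := by omega
      rw [hT.f_base_one x l k hl1 hxl, sum_range_ind_zero (by omega),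
        sum_range_ind_zero (by omega)]
      · simp only [term, hg, ind_of_le (le_refl 0), ind_of_le (le_refl 1), ind_of_lt ht2,
          one_mul, zero_mul, add_zero, mul_one]
        simp only [ind_eq, Nat.le_zero]
      · intro b hb
        simp [term, ind_of_lt hb]
      · intro a ha
        simp [term, ind_of_lt ha, ind_of_lt ht2]
    · have hf : T.f t x l k = ∑ k' ∈ Finset.Icc 1 k,
          k.choose k' * T.fTilde t x l k' * T.g (t - 2) (x + l) (k - k') x := by
        rcases Nat.eq_zero_or_pos k with rfl | hk0
        · rw [hT.f_base_zero t x l ht2 hl1 hxl]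
          rfl
        · exact hT.f_rec t x l k ht2 hl1 hk0 hxl
      rw [hf]
      refine (sum_Icc_eq_range hk (fun a ha ha' => ?_) fun a ha => ?_).symm
      · rw [sum_range_ind_zero (by omega) _ fun b hb => by simp [term, ind_of_lt hb]]
        simp only [term, hg, ind_of_le ha, ind_of_le ha', ind_of_le ht2, ind_of_lt ht2,
          ind_of_le (le_refl 0), one_mul, zero_mul, zero_add, mul_zero]
        rw [hL.choose (by omega) hk (by omega),
          hL 3 t x l a 0 (by omega) hx hl (by omega) (by omega) (by omega),
          hL 9 (t - 2) (x + l) 0 (k - a) x (by omega) (by omega) (by omega) (by omega) hx (by omega)]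
        simp only [tableVal]
        rw [if_pos ⟨ht2, hl1, hxl⟩, if_pos (by omega)]
      · refine Finset.sum_eq_zero fun b _ => ?_
        rcases ha with ha | ha <;> simp [term, ind_of_lt ha, ind_of_lt ht2]
  · rw [tableVal, if_neg h]
    refine Finset.sum_eq_zero fun a _ => Finset.sum_eq_zero fun b _ => ?_
    rcases Nat.eq_zero_or_pos t with rfl | ht
    · simp [term, ind_of_lt one_pos, ind_of_lt two_pos]
    · have hg : ind 1 l * ind (x + l) w = 0 := by
        simp only [ind_eq]
        grind
      simp [term, hg]

theorem sum_term_fTilde (hT : SatisfiesRecurrences w T) (hw : w < N) (hk : k < N) (hx : x < N)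
    (hl : l < N) (hL : Known w T N 3 t k L) :
    ∑ a ∈ Finset.range N, ∑ b ∈ Finset.range N, term L w t x l k z a b 3 =
      tableVal w T 3 t x l k z := by
  by_cases h : 2 ≤ t ∧ 1 ≤ l ∧ x + l ≤ w
  · have hg : ind 2 t * ind 1 l * ind (x + l) w = 1 := by
      rw [ind_of_le h.1, ind_of_le h.2.1, ind_of_le h.2.2]
    have hF : ∀ j ≤ k, L 2 t x l j x = T.fTildePZ t x l j x := by
      intro j hj
      rw [hL 2 t x l j x (by omega) hx hl (by omega) hx (by omega)]
      simp only [tableVal]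
      rw [if_pos (by omega)]
    -- By the base cases this form of the recurrence is valid for `k = 0` too.
    have hf : T.fTilde t x l k = T.fTildePZ t x l k x + ∑ k' ∈ Finset.Icc 1 k,
        k.choose k' * (T.gTildeOne (t - 1) (x + l) k' * T.fTildePZ t x l (k - k') x +
          T.gTildeTwo (t - 1) (x + l) k' * T.gTildeP (t - 1) (x + l) (k - k') x) := by
      rcases Nat.eq_zero_or_pos k with rfl | hk0
      · rw [hT.fTilde_base t x l 0 (by omega) h.2.1 (Or.inr rfl),
          hT.fTildePZ_base t x l 0 x (by omega) h.2.1 le_rfl (Or.inr rfl)]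
        rfl
      · rw [hT.fTilde_rec t x l k h.1 h.2.1 hk0]
        simp only [hT.fTildeP_eq _ _ _ _ h.1 h.2.1]
        rw [add_assoc, ← Finset.sum_add_distrib]
        simp only [mul_add, mul_assoc]
    -- The stand-alone summand `f̃_p` uses the slot `a = 0`, which the sum over `k' ≥ 1` leaves
    -- free.
    have hsum : ∀ a ∈ Finset.range N, ∑ b ∈ Finset.range N, term L w t x l k z a b 3 =
        ind a 0 * T.fTildePZ t x l k x + ind 1 a * ind a k * (k.choose a *
          (T.gTildeOne (t - 1) (x + l) a * T.fTildePZ t x l (k - a) x +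
          T.gTildeTwo (t - 1) (x + l) a * T.gTildeP (t - 1) (x + l) (k - a) x)) := by
      intro a ha
      rw [Finset.mem_range] at ha
      rw [sum_range_ind_zero (by omega) _ fun b hb => by simp [term, ind_of_lt hb]]
      simp only [term, hg, ind_of_le (le_refl 0), one_mul]
      rcases Nat.lt_or_ge k a with hka | hka
      · simp [ind_of_lt hka, ind_of_lt (show 0 < a by omega)]
      · rw [ind_of_le hka, hF k le_rfl, hF (k - a) (by omega), hL.choose (by omega) hk ha,
          hL 5 (t - 1) (x + l) 0 a 0 (by omega) (by omega) (by omega) ha (by omega) (by omega),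
          hL 8 (t - 1) (x + l) 0 a 0 (by omega) (by omega) (by omega) ha (by omega) (by omega),
          hL 7 (t - 1) (x + l) 0 (k - a) x (by omega) (by omega) (by omega) (by omega) hx
            (by omega)]
        simp only [tableVal]
        rw [if_pos (show 1 ≤ x + l by omega), if_pos (by omega)]
        ring
    rw [tableVal, if_pos h, hf, Finset.sum_congr rfl hsum, Finset.sum_add_distrib]
    congr 1
    · rw [sum_range_ind_zero (by omega) _ fun b hb => by simp [ind_of_lt hb]]
      simp [ind]
    · refine (sum_Icc_eq_range hk (fun a ha ha' => ?_) fun a ha => ?_).symm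
      · rw [ind_of_le ha, ind_of_le ha', one_mul, one_mul]
      · rcases ha with ha | ha <;> simp [ind_of_lt ha]
  · have hg : ind 2 t * ind 1 l * ind (x + l) w = 0 := by
      simp only [ind_eq]
      grind
    simp [tableVal, h, term, hg]

/-- The sum over `x', l'` in the recurrence for `f̃_p`, split according to `l' = 0`, `0 < l' < l` and
`l' = l`. -/
theorem sum_proper_split {x l : ℕ} (hl : 1 ≤ l) (c cz G d F : ℕ → ℕ) (e A : ℕ)
    (hd : d 0 = 1) (hdl : d l = 1) :
    (∑ x' ∈ Finset.Icc 0 x, ∑ l' ∈ Finset.Icc 0 l,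
      if 0 < x' + l' ∧ x' + l' < x + l then
        A * d l' * G (x' + l') * (if 0 < l' then c x' else c x' - cz x') *
          (if l' < l then F l' else e)
      else 0) =
    A * (∑ b ∈ Finset.Icc 1 x, (c b - cz b) * G b * F 0 +
      ∑ b ∈ Finset.Icc 1 (l - 1), d b * (∑ x' ∈ Finset.Icc 0 x, c x' * G (x' + b)) * F b +
      ∑ b ∈ Finset.range x, c b * G (b + l) * e) := by
  rw [Finset.sum_comm]
  have h1 : Finset.Icc 0 l = insert 0 (insert l (Finset.Icc 1 (l - 1))) := by
    ext i
    simp only [Finset.mem_Icc, Finset.mem_insert]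
    omega
  rw [h1, Finset.sum_insert (by simp only [Finset.mem_insert, Finset.mem_Icc]; omega),
    Finset.sum_insert (by simp only [Finset.mem_Icc]; omega)]
  have e1 : (∑ x' ∈ Finset.Icc 0 x, if 0 < x' + 0 ∧ x' + 0 < x + l then
        A * d 0 * G (x' + 0) * (if 0 < 0 then c x' else c x' - cz x') *
          (if 0 < l then F 0 else e) else 0) =
      A * ∑ b ∈ Finset.Icc 1 x, (c b - cz b) * G b * F 0 := by
    rw [Finset.mul_sum, sum_Icc_zero_eq (by simp)]
    refine Finset.sum_congr rfl fun b hb => ?_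
    rw [Finset.mem_Icc] at hb
    rw [if_pos (by omega), if_neg (lt_irrefl 0), if_pos (by omega), hd, add_zero]
    ring
  have e2 : (∑ x' ∈ Finset.Icc 0 x, if 0 < x' + l ∧ x' + l < x + l then
        A * d l * G (x' + l) * (if 0 < l then c x' else c x' - cz x') *
          (if l < l then F l else e) else 0) =
      A * ∑ b ∈ Finset.range x, c b * G (b + l) * e := by
    rw [← Nat.range_succ_eq_Icc_zero, Finset.sum_range_succ,
      if_neg (c := 0 < x + l ∧ x + l < x + l) (by omega), add_zero,
      Finset.mul_sum]
    refine Finset.sum_congr rfl fun b hb => ?_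
    rw [Finset.mem_range] at hb
    rw [if_pos (by omega), if_pos (by omega), if_neg (lt_irrefl l), hdl]
    ring
  have e3 : (∑ l' ∈ Finset.Icc 1 (l - 1), ∑ x' ∈ Finset.Icc 0 x,
        if 0 < x' + l' ∧ x' + l' < x + l then
          A * d l' * G (x' + l') * (if 0 < l' then c x' else c x' - cz x') *
            (if l' < l then F l' else e) else 0) =
      A * ∑ b ∈ Finset.Icc 1 (l - 1), d b * (∑ x' ∈ Finset.Icc 0 x, c x' * G (x' + b)) * F b := by
    rw [Finset.mul_sum]
    refine Finset.sum_congr rfl fun b hb => ?_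
    rw [Finset.mem_Icc] at hb
    rw [Finset.mul_sum, Finset.sum_mul, Finset.mul_sum]
    refine Finset.sum_congr rfl fun y hy => ?_
    rw [Finset.mem_Icc] at hy
    rw [if_pos (by omega), if_pos (by omega), if_pos (by omega)]
    ring
  rw [e1, e2, e3]
  ring

/-- Here the triple sum becomes a double sum. The index `a` is `k'`, and `b` serves three ranges at
once: `x'` for `l' = 0`, then `l'` for `0 < l' < l`, and `x'` for `l' = l`. In the middle range the
sum over `x'` is unrestricted and is read from table `1`. -/
theorem sum_term_fTildePZ (hT : SatisfiesRecurrences w T) (hw : w < N) (hk : k < N) (hx : x < N)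
    (hl : l < N) (hz : z < N) (hL : Known w T N 2 t k L) :
    ∑ a ∈ Finset.range N, ∑ b ∈ Finset.range N, term L w t x l k z a b 2 =
      tableVal w T 2 t x l k z := by
  by_cases h : 2 ≤ t ∧ 1 ≤ l ∧ z ≤ x ∧ x + l ≤ w
  · obtain ⟨ht, hl1, hzx, hxl⟩ := h
    have hg : ind 2 t * ind 1 l * ind z x * ind (x + l) w = 1 := by
      rw [ind_of_le ht, ind_of_le hl1, ind_of_le hzx, ind_of_le hxl]
    rw [tableVal, if_pos ⟨ht, hl1, hzx, hxl⟩]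
    rcases Nat.eq_zero_or_pos k with rfl | hk0
    · rw [hT.fTildePZ_base t x l 0 z (by omega) hl1 hzx (Or.inr rfl)]
      refine Finset.sum_eq_zero fun a _ => Finset.sum_eq_zero fun b _ => ?_
      rcases Nat.eq_zero_or_pos a with rfl | ha
      · simp [term, ind_of_lt one_pos]
      · simp [term, ind_of_lt ha]
    · rw [hT.fTildePZ_rec t x l k z ht hl1 hk0 hzx]
      refine (sum_Icc_eq_range hk (fun a ha ha' => ?_) fun a ha => ?_).symm
      · have hsplit := sum_proper_split (x := x) hl1 x.choose z.choose
          (fun y => T.gTildeOne (t - 1) y a) l.choose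
          (fun l' => T.fTildePZ t (x + l') (l - l') (k - a) z)
          (T.gTildeP (t - 1) (x + l) (k - a) z) ((k - 1).choose (a - 1))
          (Nat.choose_zero_right l) (Nat.choose_self l)
        rw [hsplit]
        simp only [term, hg, ind_of_le ha, ind_of_le ha', one_mul]
        rw [← Finset.mul_sum, Finset.sum_add_distrib, Finset.sum_add_distrib,
          hL.choose (by omega) (by omega) (by omega)]
        congr 2
        · congr 1
          · refine sum_Icc_eq_range hx (fun b hb hb' => ?_) fun b hb => ?_
            · rw [ind_of_le hb, ind_of_le hb', hL.choose (by omega) hx (by omega),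
                hL.choose (by omega) hz (by omega),
                hL 5 (t - 1) b 0 a 0 (by omega) (by omega) (by omega) (by omega) (by omega) (by omega),
                hL 2 t x l (k - a) z (by omega) hx hl (by omega) hz (by omega)]
              simp only [tableVal]
              rw [if_pos ⟨ht, hl1, hzx, hxl⟩, one_mul, one_mul]
              rfl
            · rcases hb with hb | hb <;> simp [ind_of_lt hb]
          · refine sum_Icc_eq_range (by omega) (fun b hb hb' => ?_) fun b hb => ?_
            · rw [ind_of_le hb, ind_of_le (by omega), hL.choose (by omega) hl (by omega),
                hL 1 t x b a 0 (by omega) hx (by omega) (by omega) (by omega) (by omega),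
                hL 2 t (x + b) (l - b) (k - a) z (by omega) (by omega) (by omega) (by omega) hz
                  (by omega)]
              simp only [tableVal]
              rw [if_pos (by omega), if_pos (by omega), one_mul, one_mul]
            · rcases hb with hb | hb
              · simp [ind_of_lt hb]
              · simp [ind_of_lt (show l < b + 1 by omega)]
        · rw [← Finset.sum_subset (Finset.range_subset_range.2 hx.le)]
          · refine Finset.sum_congr rfl fun b hb => ?_
            rw [Finset.mem_range] at hb
            rw [ind_of_le (show b + 1 ≤ x by omega), hL.choose (by omega) hx (by omega),
              hL 5 (t - 1) (b + l) 0 a 0 (by omega) (by omega) (by omega) (by omega) (by omega)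
                (by omega),
              hL 7 (t - 1) (x + l) 0 (k - a) z (by omega) (by omega) (by omega) (by omega) hz
                (by omega)]
            simp only [tableVal]
            rw [if_pos (by omega), one_mul]
          · intro b _ hb
            rw [Finset.mem_range] at hb
            rw [ind_of_lt (by omega), zero_mul]
      · refine Finset.sum_eq_zero fun b _ => ?_
        rcases ha with ha | ha <;> simp [term, ind_of_lt ha]
  · have hg : ind 2 t * ind 1 l * ind z x * ind (x + l) w = 0 := by
      simp only [ind_eq]
      grind
    simp [tableVal, h, term, hg]

/-- The tables satisfy the recurrences that are evaluated by the program. -/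
theorem sum_term {i : ℕ} (hT : SatisfiesRecurrences w T) (hw : w < N) (hi : i < 10) (hk : k < N)
    (hx : x < N) (hl : l < N) (hz : z < N) (hL : Known w T N i t k L) :
    ∑ a ∈ Finset.range N, ∑ b ∈ Finset.range N, term L w t x l k z a b i =
      tableVal w T i t x l k z := by
  match i, hi with
  | 0, _ => exact sum_term_choose hx hk hl hz hL
  | 1, _ => exact sum_term_partial hT hw hx hk hL
  | 2, _ => exact sum_term_fTildePZ hT hw hk hx hl hz hL
  | 3, _ => exact sum_term_fTilde hT hw hk hx hl hL
  | 4, _ => exact sum_term_f hT hw hk hx hl hL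
  | 5, _ => exact sum_term_gTildeOne hT hk hx hL
  | 6, _ => exact sum_term_gTilde hT hk hx hz hL
  | 7, _ => exact sum_term_gTildeP hT hk hx hz hL
  | 8, _ => exact sum_term_gTildeTwo hT hk hx hL
  | 9, _ => exact sum_term_g hT hk hx hz hL

end TableValues

end ChordalCount

namespace ChordalCount

/-! ### The layout of the memory -/

section Layout

/-- The address of an entry of the tables. -/
def addr (N i t x l k z : ℕ) : ℕ :=
  ((((t * 10 + i) * N + k) * N + x) * N + l) * N + z

/-- The final contents of the memory. -/
def memVal (w : ℕ) (T : Tables) (N a : ℕ) : ℕ :=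
  tableVal w T (a / N / N / N / N % 10) (a / N / N / N / N / 10) (a / N / N % N) (a / N % N)
    (a / N / N / N % N) (a % N)

/-- The content of a memory cell, or zero if its address is not less than `c`. -/
def lookup (N c : ℕ) (m : ℕ → ℕ) (i t x l k z : ℕ) : ℕ :=
  ind (addr N i t x l k z + 1) c * m (addr N i t x l k z)

variable {w : ℕ} {T T' : Tables} {N i t x l k z : ℕ}

theorem mul_add_div_self {N q r : ℕ} (h : r < N) : (q * N + r) / N = q := by
  rw [mul_comm, Nat.mul_add_div (by omega), Nat.div_eq_of_lt h, add_zero]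

theorem mul_add_mod_self {N q r : ℕ} (h : r < N) : (q * N + r) % N = r := by
  rw [mul_comm, Nat.mul_add_mod, Nat.mod_eq_of_lt h]

theorem mul_add_lt {N p q r s : ℕ} (hr : r < N) (h : p < q) : p * N + r < q * N + s := by
  have := Nat.mul_le_mul_right N (show p + 1 ≤ q from h)
  rw [Nat.add_mul, one_mul] at this
  omega

theorem memVal_addr (hi : i < 10) (hx : x < N) (hl : l < N) (hk : k < N) (hz : z < N) :
    memVal w T N (addr N i t x l k z) = tableVal w T i t x l k z := by
  simp only [memVal, addr, mul_add_div_self hi, mul_add_div_self hx, mul_add_div_self hl,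
    mul_add_div_self hk, mul_add_div_self hz, mul_add_mod_self hi, mul_add_mod_self hx,
    mul_add_mod_self hl, mul_add_mod_self hk, mul_add_mod_self hz]

/-- Addresses order the entries lexicographically by `t`, table number and `k` first, which is the
order of dependence of the recurrences. -/
theorem addr_lt_addr {i' t' x' l' k' z' : ℕ} (hi : i' < 10) (hx : x' < N) (hl : l' < N)
    (hk : k' < N) (hz : z' < N) (h : t' < t ∨ t' = t ∧ (i' < i ∨ i' = i ∧ k' < k)) :
    addr N i' t' x' l' k' z' < addr N i t x l k z := by
  refine mul_add_lt hz (mul_add_lt hl (mul_add_lt hx ?_))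
  rcases h with h | ⟨rfl, h | ⟨rfl, h⟩⟩
  · exact mul_add_lt hk (mul_add_lt hi h)
  · exact mul_add_lt hk (by omega)
  · omega

theorem known_lookup (w : ℕ) (T : Tables) (N i t x l k z : ℕ) :
    Known w T N i t k (lookup N (addr N i t x l k z) (memVal w T N)) := by
  intro i' t' x' l' k' z' hi hx hl hk hz h
  rw [lookup, ind_of_le (addr_lt_addr hi hx hl hk hz h), one_mul, memVal_addr hi hx hl hk hz]

/-- The memory below the address `c` has its final contents. -/
def Correct (w : ℕ) (T : Tables) (N c : ℕ) (m : ℕ → ℕ) : Prop :=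
  ∀ a < c, m a = memVal w T N a

/-- Reads at or above `c` are masked to zero. So the summands depend neither on unfinished cells nor
on the cell `c` itself, which holds a partial sum while they are evaluated. -/
theorem Correct.lookup_eq {c : ℕ} {m : ℕ → ℕ} (h : Correct w T N c m) :
    lookup N c m = lookup N c (memVal w T N) := by
  funext i t x l k z
  rw [lookup, lookup]
  rcases Nat.lt_or_ge (addr N i t x l k z) c with hc | hc
  · rw [h _ hc]
  · rw [ind_of_lt (by omega), zero_mul, zero_mul]

theorem Correct.update {c v : ℕ} {m : ℕ → ℕ} (h : Correct w T N c m) :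
    Correct w T N c (Function.update m c v) := fun a ha => by
  rw [Function.update_of_ne ha.ne, h a ha]

theorem Correct.succ {c : ℕ} {m : ℕ → ℕ} (h : Correct w T N c m) (hc : m c = memVal w T N c) :
    Correct w T N (c + 1) m := fun a ha => by
  rcases Nat.lt_succ_iff_lt_or_eq.1 ha with ha | rfl
  · exact h a ha
  · exact hc

/-- The recurrences have at most one solution. -/
theorem tableVal_unique (hT : SatisfiesRecurrences w T) (hT' : SatisfiesRecurrences w T')
    (hw : w < N) : ∀ r i t k, (t * 10 + i) * N + k = r → i < 10 → k < N →
      ∀ x < N, ∀ l < N, ∀ z < N, tableVal w T i t x l k z = tableVal w T' i t x l k z := by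
  intro r
  induction r using Nat.strong_induction_on with
  | _ r ih =>
    rintro i t k rfl hi hk x hx l hl z hz
    -- The induction hypothesis says that all earlier entries of the two solutions agree, so both
    -- are given by the same double sum.
    have hL : Known w T N i t k (fun i t x l k z => tableVal w T' i t x l k z) := by
      intro i' t' x' l' k' z' hi' hx' hl' hk' hz' h
      refine (ih ((t' * 10 + i') * N + k') ?_ i' t' k' rfl hi' hk' x' hx' l' hl' z' hz').symm
      rcases h with h | ⟨rfl, h | ⟨rfl, h⟩⟩
      · exact mul_add_lt hk' (mul_add_lt hi' h)
      · exact mul_add_lt hk' (by omega)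
      · omega
    rw [← sum_term hT hw hi hk hx hl hz hL,
      ← sum_term hT' hw hi hk hx hl hz fun i' t' x' l' k' z' _ _ _ _ _ _ => rfl]

theorem gTildeOne_unique (hT : SatisfiesRecurrences w T) (hT' : SatisfiesRecurrences w T')
    (t x k : ℕ) : T.gTildeOne t x k = T'.gTildeOne t x k :=
  tableVal_unique (N := w + x + k + 1) hT hT' (by omega) _ 5 t k rfl (by omega) (by omega) x
    (by omega) 0 (by omega) 0 (by omega)

end Layout

/-! ### Programs -/

section Programs

instance : Add Expr := ⟨Expr.add⟩
instance : Sub Expr := ⟨Expr.sub⟩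
instance : Mul Expr := ⟨Expr.mul⟩
instance (n : ℕ) : OfNat Expr n := ⟨Expr.const n⟩

/-- The indicator of `a ≤ b`. -/
def indExpr (a b : Expr) : Expr := 1 - (a - b)

/-- The address of an entry of the tables; the variable `2` holds the size `N`. -/
def addrExpr (i : ℕ) (t x l k z : Expr) : Expr :=
  ((((t * 10 + Expr.const i) * Expr.var 2 + k) * Expr.var 2 + x) * Expr.var 2 + l) * Expr.var 2 + z

/-- The content of an entry with an address less than `c`. -/
def lookupExpr (c : Expr) (i : ℕ) (t x l k z : Expr) : Expr :=
  indExpr (addrExpr i t x l k z + 1) c * Expr.mem (addrExpr i t x l k z)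

/-- The expression that computes `term`. -/
def termExpr (L : ℕ → Expr → Expr → Expr → Expr → Expr → Expr) (w t x l k z a b : Expr) : ℕ → Expr
  | 0 => indExpr a 0 * indExpr b 0 * (indExpr k 0 * indExpr x 0 +
      indExpr 1 k * (indExpr 1 x * L 0 t (x - 1) l (k - 1) z + L 0 t x l (k - 1) z))
  | 1 => indExpr (x + l) w * (indExpr 1 t * indExpr a x * indExpr b 0 *
      (L 0 t a 0 x 0 * L 5 (t - 1) (a + l) 0 k 0))
  | 2 => indExpr 2 t * indExpr 1 l * indExpr z x * indExpr (x + l) w *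
      (indExpr 1 a * indExpr a k * (L 0 t (a - 1) 0 (k - 1) 0 *
      (indExpr 1 b * indExpr b x *
          ((L 0 t b 0 x 0 - L 0 t b 0 z 0) * L 5 (t - 1) b 0 a 0 * L 2 t x l (k - a) z) +
        indExpr 1 b * indExpr (b + 1) l *
          (L 0 t b 0 l 0 * L 1 t x b a 0 * L 2 t (x + b) (l - b) (k - a) z) +
        indExpr (b + 1) x *
          (L 0 t b 0 x 0 * L 5 (t - 1) (b + l) 0 a 0 * L 7 (t - 1) (x + l) 0 (k - a) z))))
  | 3 => indExpr 2 t * indExpr 1 l * indExpr (x + l) w * (indExpr b 0 * indExpr a k *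
      (indExpr a 0 * L 2 t x l k x +
      indExpr 1 a * (L 0 t a 0 k 0 * (L 5 (t - 1) (x + l) 0 a 0 * L 2 t x l (k - a) x +
        L 8 (t - 1) (x + l) 0 a 0 * L 7 (t - 1) (x + l) 0 (k - a) x))))
  | 4 => indExpr 1 l * indExpr (x + l) w * (indExpr b 0 *
      (indExpr 1 t * indExpr t 1 * indExpr a 0 * indExpr k 0 +
      indExpr 2 t * indExpr 1 a * indExpr a k *
        (L 0 t a 0 k 0 * L 3 t x l a 0 * L 9 (t - 2) (x + l) 0 (k - a) x)))
  | 5 => indExpr b 0 * indExpr 1 a * indExpr a k * (L 0 t a 0 k 0 * L 4 t x a (k - a) 0)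
  | 6 => indExpr 1 t * indExpr (z + 1) x * indExpr x w *
      (indExpr k 0 * indExpr a 0 * indExpr b 0 +
      indExpr 1 a * indExpr a k * (indExpr 1 b * indExpr b x * ((L 0 t b 0 x 0 - L 0 t b 0 z 0) *
        L 0 t (a - 1) 0 (k - 1) 0 * L 5 t b 0 a 0 * L 6 t x 0 (k - a) z)))
  | 7 => indExpr 1 t * indExpr (z + 1) x * indExpr x w *
      (indExpr k 0 * indExpr a 0 * indExpr b 0 +
      indExpr 1 a * indExpr a k * (indExpr 1 b * indExpr (b + 1) x *
        ((L 0 t b 0 x 0 - L 0 t b 0 z 0) *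
        L 0 t (a - 1) 0 (k - 1) 0 * L 5 t b 0 a 0 * L 7 t x 0 (k - a) z)))
  | 8 => indExpr 1 x * (indExpr b 0 * indExpr 1 a * indExpr (a + 1) k *
      (L 0 t (a - 1) 0 (k - 1) 0 * L 5 t x 0 a 0 * (L 5 t x 0 (k - a) 0 + L 8 t x 0 (k - a) 0)))
  | 9 => indExpr (z + 1) x * indExpr x w * (indExpr b 0 *
      (indExpr t 0 * indExpr k 0 * indExpr a 0 +
      indExpr 1 t * indExpr a k * (L 0 t a 0 k 0 * L 6 t x 0 a z * L 9 (t - 1) x 0 (k - a) z)))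
  | _ => 0

theorem eval_termExpr (s : State) (L : ℕ → Expr → Expr → Expr → Expr → Expr → Expr)
    (L' : ℕ → ℕ → ℕ → ℕ → ℕ → ℕ → ℕ)
    (hL : ∀ i t x l k z, (L i t x l k z).eval s =
      L' i (t.eval s) (x.eval s) (l.eval s) (k.eval s) (z.eval s))
    (w t x l k z a b : Expr) (i : ℕ) : (termExpr L w t x l k z a b i).eval s =
      term L' (w.eval s) (t.eval s) (x.eval s) (l.eval s) (k.eval s) (z.eval s) (a.eval s)
        (b.eval s) i := by
  have h₁ : ∀ e e' : Expr, (e + e').eval s = e.eval s + e'.eval s := fun _ _ => rfl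
  have h₂ : ∀ e e' : Expr, (e - e').eval s = e.eval s - e'.eval s := fun _ _ => rfl
  have h₃ : ∀ e e' : Expr, (e * e').eval s = e.eval s * e'.eval s := fun _ _ => rfl
  have h₄ : ∀ e e' : Expr, (indExpr e e').eval s = ind (e.eval s) (e'.eval s) := fun _ _ => rfl
  have h₅ : Expr.eval s 0 = 0 ∧ Expr.eval s 1 = 1 ∧ Expr.eval s 2 = 2 := ⟨rfl, rfl, rfl⟩
  rcases i with _ | _ | _ | _ | _ | _ | _ | _ | _ | _ | i <;>
  simp only [termExpr, term, h₁, h₂, h₃, h₄, hL, h₅]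

theorem eval_lookupExpr (s : State) (c : Expr) (i : ℕ) (t x l k z : Expr) :
    (lookupExpr c i t x l k z).eval s = lookup (s.var 2) (c.eval s) s.mem i (t.eval s) (x.eval s)
      (l.eval s) (k.eval s) (z.eval s) := rfl

/-- Started in the state `s`, the program `p` halts after at most `B` steps; it does not change the
variables below `j`, and afterwards the memory satisfies `Q`. -/
def Exec (p : Prog) (j B : ℕ) (s : State) (Q : (ℕ → ℕ) → Prop) : Prop :=
  ∃ s' c, Runs p s s' c ∧ (∀ r < j, s'.var r = s.var r) ∧ Q s'.mem ∧ c ≤ B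

theorem Exec.mono {p : Prog} {j B B' : ℕ} {s : State} {Q : (ℕ → ℕ) → Prop} (h : Exec p j B s Q)
    (hB : B ≤ B') : Exec p j B' s Q := by
  obtain ⟨s', c, h1, h2, h3, h4⟩ := h
  exact ⟨s', c, h1, h2, h3, h4.trans hB⟩

theorem Exec.seq {p q : Prog} {j B B' : ℕ} {s : State} {Q Q' : (ℕ → ℕ) → Prop}
    (h : Exec p j B s Q)
    (h' : ∀ s' : State, (∀ r < j, s'.var r = s.var r) → Q s'.mem → Exec q j B' s' Q') :
    Exec (p.seq q) j (B + B') s Q' := by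
  obtain ⟨s₁, c₁, h1, h2, h3, h4⟩ := h
  obtain ⟨s₂, c₂, k1, k2, k3, k4⟩ := h' s₁ h2 h3
  exact ⟨s₂, c₁ + c₂, h1.seq k1, fun r hr => (k2 r hr).trans (h2 r hr), k3, Nat.add_le_add h4 k4⟩

theorem exec_store {a e : Expr} {j : ℕ} {s : State} {Q : (ℕ → ℕ) → Prop}
    (h : Q (Function.update s.mem (a.eval s) (e.eval s))) :
    Exec (.store a e) j (a.cost + e.cost + 1) s Q :=
  ⟨_, _, .store a e s, fun _ _ => rfl, h, le_rfl⟩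

/-- Repetition of `p` for the values `0, …, N - 1` of the variable `j`. -/
def forLoop (j : ℕ) (p : Prog) : Prog :=
  .seq (.assign j 0) (.loop (.var 2 - .var j) (.seq p (.assign j (.var j + 1))))

/-- Each pass costs `4` for the test and `4` for the increment, in addition to the body; the final
test costs `4` and the initialization `2`. Since `8 * N + 6 ≤ 14 * N ^ (d + 1)`, the overhead is
covered by `14`. -/
theorem exec_forLoop {p : Prog} {j N d κ : ℕ} {s : State} (I : ℕ → (ℕ → ℕ) → Prop) (hj : 2 < j)
    (hN : s.var 2 = N) (hN1 : 1 ≤ N) (h₀ : I 0 s.mem)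
    (h : ∀ i < N, ∀ s' : State, (∀ r < j, s'.var r = s.var r) → s'.var j = i → I i s'.mem →
      Exec p (j + 1) (N ^ d * κ) s' (I (i + 1))) :
    Exec (forLoop j p) j (N ^ (d + 1) * (κ + 14)) s (I N) := by
  have key : ∀ m i, i + m = N → ∀ s' : State, (∀ r < j, s'.var r = s.var r) → s'.var j = i →
      I i s'.mem → Exec (.loop (.var 2 - .var j) (.seq p (.assign j (.var j + 1)))) j
        (m * (N ^ d * κ + 8) + 4) s' (I N) := by
    intro m
    induction m with
    | zero =>
      intro i hi s' hs hi' hI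
      obtain rfl : i = N := hi
      refine ⟨s', _, .loop_zero ?_, fun _ _ => rfl, hI, ?_⟩
      · change s'.var 2 - s'.var j = 0
        rw [hs 2 hj, hN, hi', Nat.sub_self]
      · rw [zero_mul, zero_add]
        exact le_refl 4
    | succ m ih =>
      intro i hi s' hs hi' hI
      obtain ⟨s₁, c₁, h1, h2, h3, h4⟩ := h i (by omega) s' hs hi' hI
      obtain ⟨s₂, c₂, k1, k2, k3, k4⟩ := ih (i + 1) (by omega)
        ⟨Function.update s₁.var j (s₁.var j + 1), s₁.mem⟩
        (fun r hr => by
          change Function.update s₁.var j (s₁.var j + 1) r = _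
          rw [Function.update_of_ne hr.ne, h2 r (by omega), hs r hr])
        (by
          change Function.update s₁.var j (s₁.var j + 1) j = _
          rw [Function.update_self, h2 j (by omega), hi']) h3
      refine ⟨s₂, _, .loop_pos ?_ (h1.seq (.assign j (.var j + 1) s₁)) k1, fun r hr => ?_, k3, ?_⟩
      · change s'.var 2 - s'.var j ≠ 0
        rw [hs 2 hj, hN, hi']
        omega
      · rw [k2 r hr]
        change Function.update s₁.var j (s₁.var j + 1) r = _
        rw [Function.update_of_ne hr.ne, h2 r (by omega)]
      · change 3 + 1 + (c₁ + (3 + 1)) + c₂ ≤ _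
        rw [Nat.add_mul, one_mul]
        omega
  obtain ⟨s₂, c₂, k1, k2, k3, k4⟩ := key N 0 (by omega) ⟨Function.update s.var j 0, s.mem⟩
    (fun r hr => Function.update_of_ne hr.ne _ _) (Function.update_self _ _ _) h₀
  refine ⟨s₂, _, (Runs.assign j 0 s).seq k1, fun r hr => ?_, k3, ?_⟩
  · rw [k2 r hr]
    exact Function.update_of_ne hr.ne _ _
  · change 1 + 1 + c₂ ≤ _
    have h1 : 1 ≤ N ^ (d + 1) := Nat.one_le_pow _ _ hN1
    have h2 : N ≤ N ^ (d + 1) := Nat.le_self_pow (Nat.succ_ne_zero d) N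
    have h3 : N * (N ^ d * κ + 8) = N ^ (d + 1) * κ + N * 8 := by ring
    rw [Nat.mul_add]
    omega

/-! The variables `3, …, 9` hold `t, k, x, l, z, a, b`; the variable `1` holds the bound `w` for the
clique sizes. -/

/-- The address of the current entry of table `i`. -/
def cellExpr (i : ℕ) : Expr := addrExpr i (.var 3) (.var 5) (.var 6) (.var 4) (.var 7)

/-- The summand for the current entry of table `i`. -/
def summandExpr (i : ℕ) : Expr :=
  termExpr (lookupExpr (cellExpr i)) (.var 1) (.var 3) (.var 5) (.var 6) (.var 4) (.var 7) (.var 8)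
    (.var 9) i

/-- The number of steps for the computation of an entry of table `i`, up to a factor `N ^ 2`. -/
def cellCost (i : ℕ) : ℕ :=
  (cellExpr i).cost + ((cellExpr i).cost + 1 + (summandExpr i).cost + 1) + 1 + 14 + 14

/-- The computation of an entry of table `i`. -/
def cellProg (i : ℕ) : Prog :=
  .seq (.store (cellExpr i) 0)
    (forLoop 8 (forLoop 9 (.store (cellExpr i) (.mem (cellExpr i) + summandExpr i))))

/-- The computation of table `i` for a given `t`. -/
def tableProg (i : ℕ) : Prog :=
  forLoop 4 (forLoop 5 (forLoop 6 (forLoop 7 (cellProg i))))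

/-- The computation of the first `m` tables for a given `t`. -/
def roundProg : ℕ → Prog
  | 0 => .skip
  | m + 1 => .seq (roundProg m) (tableProg m)

variable {w : ℕ} {T : Tables} {N : ℕ}

theorem eval_cellExpr (s : State) (i : ℕ) : (cellExpr i).eval s =
    addr (s.var 2) i (s.var 3) (s.var 5) (s.var 6) (s.var 4) (s.var 7) := rfl

theorem eval_summandExpr (s : State) (i : ℕ) : (summandExpr i).eval s =
    term (lookup (s.var 2) ((cellExpr i).eval s) s.mem) (s.var 1) (s.var 3) (s.var 5) (s.var 6)
      (s.var 4) (s.var 7) (s.var 8) (s.var 9) i :=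
  eval_termExpr s _ _ (eval_lookupExpr s _) _ _ _ _ _ _ _ _ i

/-- The cell is cleared and then accumulates the double sum. Everything below it is final, so
`sum_term` identifies the result with the table entry and the correct region grows by one cell. -/
theorem exec_cellProg (hT : SatisfiesRecurrences w T) (hw : w < N) {i t x l k z : ℕ} {s : State}
    (hi : i < 10) (hx : x < N) (hl : l < N) (hk : k < N) (hz : z < N) (h1 : s.var 1 = w)
    (h2 : s.var 2 = N) (h3 : s.var 3 = t) (h4 : s.var 4 = k) (h5 : s.var 5 = x) (h6 : s.var 6 = l)
    (h7 : s.var 7 = z) (hs : Correct w T N (addr N i t x l k z) s.mem) :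
    Exec (cellProg i) 8 (N ^ 2 * ((cellExpr i).cost + 2 + cellCost i)) s
      (Correct w T N (addr N i t x l k (z + 1))) := by
  set c := addr N i t x l k z with hc
  set τ : ℕ → ℕ → ℕ := fun a b => term (lookup N c (memVal w T N)) w t x l k z a b i with hτ
  have hsum : ∑ a ∈ Finset.range N, ∑ b ∈ Finset.range N, τ a b = memVal w T N c := by
    rw [hc, memVal_addr hi hx hl hk hz]
    exact sum_term hT hw hi hk hx hl hz (known_lookup w T N i t x l k z)
  have hcell : ∀ s' : State, (∀ r < 8, s'.var r = s.var r) → (cellExpr i).eval s' = c := by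
    intro s' hs'
    rw [eval_cellExpr, hs' 2 (by omega), hs' 3 (by omega), hs' 4 (by omega), hs' 5 (by omega),
      hs' 6 (by omega), hs' 7 (by omega), h2, h3, h4, h5, h6, h7]
  have hN1 : 1 ≤ N := by omega
  refine Exec.mono (Exec.seq (Q := fun m => Correct w T N c m ∧ m c = 0)
    (B' := N ^ 2 * cellCost i) (exec_store ?_) fun s₁ hs₁ hI => ?_) ?_
  · rw [hcell s fun _ _ => rfl]
    exact ⟨hs.update, Function.update_self _ _ _⟩
  · have hfor : Exec (forLoop 8 (forLoop 9 (.store (cellExpr i)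
        (.mem (cellExpr i) + summandExpr i)))) 8 (N ^ 2 * cellCost i) s₁ fun m => Correct w T N c m ∧
          m c = ∑ a ∈ Finset.range N, ∑ b ∈ Finset.range N, τ a b := by
      refine exec_forLoop (N := N) (d := 1) (fun A m => Correct w T N c m ∧
          m c = ∑ a ∈ Finset.range A, ∑ b ∈ Finset.range N, τ a b) (by omega)
        ((hs₁ 2 (by omega)).trans h2) hN1 hI fun a ha s₂ hs₂ ha₂ hI₂ => ?_
      rw [Finset.sum_range_succ]
      refine exec_forLoop (N := N) (d := 0) (fun B m => Correct w T N c m ∧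
          m c = ∑ a' ∈ Finset.range a, ∑ b ∈ Finset.range N, τ a' b +
            ∑ b ∈ Finset.range B, τ a b) (by omega)
        ((hs₂ 2 (by omega)).trans ((hs₁ 2 (by omega)).trans h2)) hN1 ?_
        fun b hb s₃ hs₃ hb₃ hI₃ => ?_
      · rw [Finset.sum_range_zero, add_zero]
        exact hI₂
      · have hv : ∀ r < 8, s₃.var r = s.var r := fun r hr => by
          rw [hs₃ r (by omega), hs₂ r hr, hs₁ r hr]
        rw [pow_zero, one_mul]
        refine exec_store ?_
        have he : (Expr.mem (cellExpr i) + summandExpr i).eval s₃ = s₃.mem c + τ a b := by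
          change s₃.mem ((cellExpr i).eval s₃) + (summandExpr i).eval s₃ = _
          rw [eval_summandExpr, hcell s₃ hv, hv 1 (by omega), hv 2 (by omega), hv 3 (by omega),
            hv 4 (by omega), hv 5 (by omega), hv 6 (by omega), hv 7 (by omega), hs₃ 8 (by omega),
            h1, h2, h3, h4, h5, h6, h7, ha₂, hb₃, hI₃.1.lookup_eq]
        rw [hcell s₃ hv, he, Finset.sum_range_succ]
        refine ⟨hI₃.1.update, ?_⟩
        rw [Function.update_self, hI₃.2, add_assoc]
    obtain ⟨s₂, c₂, k1, k2, ⟨k3, k5⟩, k4⟩ := hfor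
    exact ⟨s₂, c₂, k1, k2, k3.succ (k5.trans hsum), k4⟩
  · have : 1 ≤ N ^ 2 := Nat.one_le_pow _ _ hN1
    rw [Nat.mul_add (N ^ 2) ((cellExpr i).cost + 2)]
    refine Nat.add_le_add_right ?_ _
    calc (cellExpr i).cost + (0 : Expr).cost + 1 = 1 * ((cellExpr i).cost + 2) := by
          rw [one_mul]
          rfl
      _ ≤ _ := Nat.mul_le_mul_right _ this

theorem exec_tableProg {i : ℕ} (hi : i < 10) : ∃ κ, ∀ (w N t : ℕ) (T : Tables) (s : State),
    SatisfiesRecurrences w T → w < N → s.var 1 = w → s.var 2 = N → s.var 3 = t →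
    Correct w T N (addr N i t 0 0 0 0) s.mem →
    Exec (tableProg i) 4 (N ^ 6 * κ) s (Correct w T N (addr N (i + 1) t 0 0 0 0)) := by
  refine ⟨(cellExpr i).cost + 2 + cellCost i + 14 + 14 + 14 + 14,
    fun w N t T s hT hw h1 h2 h3 hs => ?_⟩
  have hN1 : 1 ≤ N := by omega
  -- The loops over `k`, `x`, `l`, `z` visit the addresses consecutively. The value `N` of an inner
  -- index is a carry into the next outer one; this and the identities below link the loop
  -- invariants.
  have e4 : addr N (i + 1) t 0 0 0 0 = addr N i t 0 0 N 0 := by simp only [addr]; ring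
  rw [e4]
  refine exec_forLoop (d := 5) (fun k => Correct w T N (addr N i t 0 0 k 0)) (by omega) h2 hN1 hs
    fun k hk s₁ v₁ hk₁ hs₁ => ?_
  have e5 : addr N i t 0 0 (k + 1) 0 = addr N i t N 0 k 0 := by simp only [addr]; ring
  rw [e5]
  refine exec_forLoop (d := 4) (fun x => Correct w T N (addr N i t x 0 k 0)) (by omega)
    ((v₁ 2 (by omega)).trans h2) hN1 hs₁ fun x hx s₂ v₂ hx₂ hs₂ => ?_
  have e6 : addr N i t (x + 1) 0 k 0 = addr N i t x N k 0 := by simp only [addr]; ring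
  rw [e6]
  refine exec_forLoop (d := 3) (fun l => Correct w T N (addr N i t x l k 0)) (by omega)
    (by rw [v₂ 2 (by omega), v₁ 2 (by omega), h2]) hN1 hs₂ fun l hl s₃ v₃ hl₃ hs₃ => ?_
  have e7 : addr N i t x (l + 1) k 0 = addr N i t x l k N := by simp only [addr]; ring
  rw [e7]
  refine exec_forLoop (d := 2) (fun z => Correct w T N (addr N i t x l k z)) (by omega)
    (by rw [v₃ 2 (by omega), v₂ 2 (by omega), v₁ 2 (by omega), h2]) hN1 hs₃
    fun z hz s₄ v₄ hz₄ hs₄ => ?_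
  refine exec_cellProg hT hw hi hx hl hk hz ?_ ?_ ?_ ?_ ?_ ?_ hz₄ hs₄
  · rw [v₄ 1 (by omega), v₃ 1 (by omega), v₂ 1 (by omega), v₁ 1 (by omega), h1]
  · rw [v₄ 2 (by omega), v₃ 2 (by omega), v₂ 2 (by omega), v₁ 2 (by omega), h2]
  · rw [v₄ 3 (by omega), v₃ 3 (by omega), v₂ 3 (by omega), v₁ 3 (by omega), h3]
  · rw [v₄ 4 (by omega), v₃ 4 (by omega), v₂ 4 (by omega), hk₁]
  · rw [v₄ 5 (by omega), v₃ 5 (by omega), hx₂]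
  · rw [v₄ 6 (by omega), hl₃]

theorem exec_roundProg {m : ℕ} (hm : m ≤ 10) : ∃ κ, ∀ (w N t : ℕ) (T : Tables) (s : State),
    SatisfiesRecurrences w T → w < N → s.var 1 = w → s.var 2 = N → s.var 3 = t →
    Correct w T N (addr N 0 t 0 0 0 0) s.mem →
    Exec (roundProg m) 4 (N ^ 6 * κ) s (Correct w T N (addr N m t 0 0 0 0)) := by
  induction m with
  | zero =>
    refine ⟨1, fun w N t T s _ hw _ _ _ hs => ⟨s, 1, .skip s, fun _ _ => rfl, hs, ?_⟩⟩
    rw [mul_one]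
    exact Nat.one_le_pow _ _ (by omega)
  | succ m ih =>
    obtain ⟨κ, hκ⟩ := ih (by omega)
    obtain ⟨κ', hκ'⟩ := exec_tableProg (i := m) (by omega)
    refine ⟨κ + κ', fun w N t T s hT hw h1 h2 h3 hs => ?_⟩
    rw [Nat.mul_add]
    refine (hκ w N t T s hT hw h1 h2 h3 hs).seq fun s' v' hs' => ?_
    exact hκ' w N t T s' hT hw ((v' 1 (by omega)).trans h1) ((v' 2 (by omega)).trans h2)
      ((v' 3 (by omega)).trans h3) hs'

/-- The computation of all tables. -/
def tablesProg : Prog := forLoop 3 (roundProg 10)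

theorem exec_tablesProg : ∃ κ, ∀ (w N : ℕ) (T : Tables) (s : State),
    SatisfiesRecurrences w T → w < N → s.var 1 = w → s.var 2 = N →
    Exec tablesProg 3 (N ^ 7 * κ) s (Correct w T N (addr N 0 N 0 0 0 0)) := by
  obtain ⟨κ, hκ⟩ := exec_roundProg (le_refl 10)
  refine ⟨κ + 14, fun w N T s hT hw h1 h2 => ?_⟩
  refine exec_forLoop (d := 6) (fun t => Correct w T N (addr N 0 t 0 0 0 0)) (by omega) h2
    (by omega) (fun a ha => ?_) fun t _ s₁ v₁ ht₁ hs₁ => ?_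
  · simp [addr] at ha
  · have e : addr N 0 (t + 1) 0 0 0 0 = addr N 10 t 0 0 0 0 := by simp only [addr]; ring
    rw [e]
    exact hκ w N t T s₁ hT hw ((v₁ 1 (by omega)).trans h1) ((v₁ 2 (by omega)).trans h2) ht₁ hs₁

/-- The address of the cell for the result. -/
def resultExpr : Expr := addrExpr 0 (.var 2) 0 0 0 0

/-- The summation of `g̃_1(t, 0, n)` over `t`. -/
def sumProg : Prog :=
  .seq (.store resultExpr 0) (forLoop 3 (.store resultExpr
    (.mem resultExpr + .mem (addrExpr 5 (.var 3) 0 0 (.var 0) 0))))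

/-- The result cell is the first one after all tables, so accumulating there leaves them intact. -/
theorem exec_sumProg : ∃ κ, ∀ (w N n : ℕ) (T : Tables) (s : State), n < N →
    s.var 0 = n → s.var 2 = N → Correct w T N (addr N 0 N 0 0 0 0) s.mem →
    Exec sumProg 3 (N ^ 1 * κ) s fun m =>
      m (addr N 0 N 0 0 0 0) = ∑ t ∈ Finset.range N, T.gTildeOne t 0 n := by
  set κ := resultExpr.cost + (Expr.mem resultExpr +
    .mem (addrExpr 5 (.var 3) 0 0 (.var 0) 0)).cost + 1 with hκ
  refine ⟨resultExpr.cost + 2 + (κ + 14), fun w N n T s hn h0 h2 hs => ?_⟩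
  set c := addr N 0 N 0 0 0 0 with hc
  have hres : ∀ s' : State, (∀ r < 3, s'.var r = s.var r) → resultExpr.eval s' = c := by
    intro s' hs'
    change addr (s'.var 2) 0 (s'.var 2) 0 0 0 0 = _
    rw [hs' 2 (by omega), h2]
  refine Exec.mono (Exec.seq (Q := fun m => Correct w T N c m ∧ m c = 0)
    (B' := N ^ 1 * (κ + 14)) (exec_store ?_) fun s₁ hs₁ hI => ?_) ?_
  · rw [hres s fun _ _ => rfl]
    exact ⟨hs.update, Function.update_self _ _ _⟩
  · have hfor : Exec (forLoop 3 (.store resultExpr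
        (.mem resultExpr + .mem (addrExpr 5 (.var 3) 0 0 (.var 0) 0)))) 3 (N ^ 1 * (κ + 14)) s₁ fun m =>
        Correct w T N c m ∧ m c = ∑ t ∈ Finset.range N, T.gTildeOne t 0 n := by
      refine exec_forLoop (N := N) (d := 0) (fun A m => Correct w T N c m ∧
          m c = ∑ t ∈ Finset.range A, T.gTildeOne t 0 n) (by omega)
        ((hs₁ 2 (by omega)).trans h2) (by omega) hI fun t ht s₂ hs₂ ht₂ hI₂ => ?_
      have hv : ∀ r < 3, s₂.var r = s.var r := fun r hr => by rw [hs₂ r hr, hs₁ r hr]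
      rw [pow_zero, one_mul]
      refine exec_store ?_
      have he : (Expr.mem resultExpr + .mem (addrExpr 5 (.var 3) 0 0 (.var 0) 0)).eval s₂ =
          s₂.mem c + T.gTildeOne t 0 n := by
        change s₂.mem (resultExpr.eval s₂) +
          s₂.mem (addr (s₂.var 2) 5 (s₂.var 3) 0 0 (s₂.var 0) 0) = _
        have hN : 0 < N := by omega
        rw [hres s₂ hv, hv 2 (by omega), h2, ht₂, hv 0 (by omega), h0,
          hI₂.1 _ (addr_lt_addr (by omega) hN hN hn hN (Or.inl ht)),
          memVal_addr (by omega) hN hN hn hN]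
        rfl
      rw [hres s₂ hv, he, Finset.sum_range_succ]
      refine ⟨hI₂.1.update, ?_⟩
      rw [Function.update_self, hI₂.2]
    obtain ⟨s₂, c₂, k1, k2, k3, k4⟩ := hfor
    exact ⟨s₂, c₂, k1, k2, k3.2, k4⟩
  · rw [Nat.mul_add (N ^ 1) (resultExpr.cost + 2)]
    refine Nat.add_le_add_right ?_ _
    rw [pow_one]
    exact Nat.le_mul_of_pos_left _ (by omega)

/-- The program that computes the number of `ω`-colorable connected chordal graphs. Only clique sizes
up to `w = min n ω` are taken into account. -/
def countProg : Prog :=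
  .seq (.assign 1 (.var 0 - (.var 0 - .var 1))) (.seq (.assign 2 (.var 0 + 1))
    (.seq (.seq tablesProg sumProg) (.assign 0 (.mem resultExpr))))

theorem computesWithin_countProg : ∃ K, ∀ n ω : ℕ, 1 ≤ n → 1 ≤ ω →
    ComputesWithin countProg n ω (connChordalCount ω n) (K * n ^ 7) := by
  obtain ⟨κ, hκ⟩ := exec_tablesProg
  obtain ⟨κ', hκ'⟩ := exec_sumProg
  -- The summand `10` pays for the two initial assignments, `2 ^ 7` comes from `n + 1 ≤ 2 * n`, and
  -- the last summand pays for the final read and assignment.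
  refine ⟨10 + 2 ^ 7 * (κ + κ') + (resultExpr.cost + 2), fun n ω hn hω => ?_⟩
  have hw : n - (n - ω) = min n ω := by omega
  have hw1 : 1 ≤ min n ω := by omega
  set s₁ : State := ⟨Function.update (Function.update (inputState n ω).var 1 (n - (n - ω))) 2 (n + 1),
    fun _ => 0⟩ with hs₁
  have hT := satisfiesRecurrences_counters hw1
  have hwn : min n ω < n + 1 := by omega
  obtain ⟨s₂, c₂, h1, h2, h3, h4⟩ := (hκ (min n ω) (n + 1) _ s₁ hT hwn hw rfl).seq
    fun s' hv hs' => hκ' (min n ω) (n + 1) n _ s' (by omega) (hv 0 (by omega)) (hv 2 (by omega)) hs'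
  have hr : resultExpr.eval s₂ = addr (n + 1) 0 (n + 1) 0 0 0 0 := by
    change addr (s₂.var 2) 0 (s₂.var 2) 0 0 0 0 = _
    rw [h2 2 (by omega)]
    rfl
  refine ⟨_, _, (Runs.assign 1 _ _).seq ((Runs.assign 2 _ _).seq (h1.seq (.assign 0 _ _))), ?_, ?_⟩
  · change Function.update s₂.var 0 (s₂.mem (resultExpr.eval s₂)) 0 = _
    rw [Function.update_self, hr, h3, ← connChordalCount_min, connChordalCount_eq_sum hw1 hn]
    -- The program starts its sum at `t = 0`, where the entry is zero.
    rw [Nat.range_succ_eq_Icc_zero]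
    exact sum_Icc_zero_eq (hT.gTildeOne_base 0 0 n (Or.inl rfl))
  · change 6 + (4 + (c₂ + (resultExpr.cost + 1 + 1))) ≤ _
    have hp : 1 ≤ n ^ 7 := Nat.one_le_pow _ _ hn
    have hp7 : (n + 1) ^ 7 ≤ 2 ^ 7 * n ^ 7 := by
      rw [← mul_pow]
      exact Nat.pow_le_pow_left (by omega) 7
    have hp1 : (n + 1) ^ 1 ≤ (n + 1) ^ 7 := Nat.pow_le_pow_right (by omega) (by omega)
    calc 6 + (4 + (c₂ + (resultExpr.cost + 1 + 1))) = 10 + c₂ + (resultExpr.cost + 2) := by ring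
      _ ≤ 10 * n ^ 7 + (2 ^ 7 * n ^ 7) * (κ + κ') + (resultExpr.cost + 2) * n ^ 7 := by
        refine Nat.add_le_add (Nat.add_le_add (Nat.le_mul_of_pos_right _ hp) (h4.trans ?_))
          (Nat.le_mul_of_pos_right _ hp)
        rw [Nat.mul_add]
        exact Nat.add_le_add (Nat.mul_le_mul_right _ hp7)
          (Nat.mul_le_mul_right _ (hp1.trans hp7))
      _ = _ := by ring

end Programs

end ChordalCount

open ChordalCount in
/-- The counter functions satisfy the recurrences and base cases; the number `c(n)` of `ω`-colorable
connected chordal graphs on `[n]` is `∑ t, g̃_1(t, 0, n)`; every solution of the system of recurrences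
yields this number; and one program computes it from `n` and `ω` with `O(n ^ 7)` operations. -/
theorem theorem2 :
    (∀ ω : ℕ, 1 ≤ ω →
      SatisfiesRecurrences ω (counters ω) ∧
      (∀ n : ℕ, 1 ≤ n →
        connChordalCount ω n = ∑ t ∈ Finset.Icc 1 n, (counters ω).gTildeOne t 0 n) ∧
      (∀ T : Tables, SatisfiesRecurrences ω T → ∀ n : ℕ, 1 ≤ n →
        connChordalCount ω n = ∑ t ∈ Finset.Icc 1 n, T.gTildeOne t 0 n)) ∧
    ∃ (p : Prog) (K : ℕ), ∀ n ω : ℕ, 1 ≤ n → 1 ≤ ω →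
      ComputesWithin p n ω (connChordalCount ω n) (K * n ^ 7) := by
  refine ⟨fun ω hω => ?_, countProg, computesWithin_countProg⟩
  have hT := satisfiesRecurrences_counters hω
  refine ⟨hT, fun n hn => connChordalCount_eq_sum hω hn, fun T hT' n hn => ?_⟩
  rw [connChordalCount_eq_sum hω hn]
  exact Finset.sum_congr rfl fun t _ => gTildeOne_unique hT hT' t 0 n
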